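/- For $f:\mathbb Z\to\mathbb C$ and an integer $N\ge 1$ put $A_N f(x)=\frac1N\sum_{k=1}^N f(x+k^2)$. For a finite nonempty interval $I=[a,b]\cap\mathbb Z$ with $a,b\in\mathbb Z$, let $|I|=b-a+1$ denote its length (number of points), let $2I=[a,2b-a+1]\cap\mathbb Z$ be the interval doubled on the right, and for $1\le p<\infty$ let $\langle f\rangle_{I,p}=\bigl(\frac1{|I|}\sum_{x\in I}|f(x)|^p\bigr)^{1/p}$. For $p>1$ write $p'=\frac p{p-1}$. **Theorem.** (1) For every $3/2<p\le 2$ there is a constant $C_p>0$, depending only on $p$, such that for every integer $N\ge1$, every interval $I\subset\mathbb Z$ of length $N^2$, and every $f$ supported on $2I$, $$\langle A_N f\rangle_{I,p'}\le C_p\,\langle f\rangle_{2I,p}.$$ (2) For every $1<p<3/2$ there is no constant $C_p$ for which this inequality holds for all integers $N\ge1$, all intervals $I\subset\mathbb Z$ of length $N^2$, and all $f$ supported on $2I$. -/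

import Mathlib

/-- The average over the square integers, `A_N f (x) = (1/N) ∑_{k=1}^N f(x + k²)`. -/
noncomputable def squareAverage (N : ℕ) (f : ℤ → ℂ) (x : ℤ) : ℂ :=
  (1 / (N : ℂ)) * ∑ k ∈ Finset.Icc 1 N, f (x + (k : ℤ) ^ 2)

/-- The normalized `ℓ^p` norm `⟨f⟩_{I,p} = ((1/|I|) ∑_{x ∈ I} |f(x)|^p)^{1/p}`. -/
noncomputable def normalizedNorm (I : Finset ℤ) (p : ℝ) (f : ℤ → ℂ) : ℝ :=
  ((1 / (I.card : ℝ)) * ∑ x ∈ I, ‖f x‖ ^ p) ^ (1 / p)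

/-- For `I = [a, b] ∩ ℤ`, the interval `2I = [a, 2b - a + 1] ∩ ℤ`, doubled on the right. -/
noncomputable def doubledInterval (a b : ℤ) : Finset ℤ :=
  Finset.Icc a (2 * b - a + 1)

/-! Part (1). By duality it is enough to bound the bilinear form `∑ K(y - x) f(y) g(x)`, with `K`
the indicator of the squares `k²`, `1 ≤ k ≤ N`, by `C N^(3 - 4/p) ‖f‖_p ‖g‖_p` for nonnegative `f,
g`. Since `3 - 4/p > 0`, dyadic blocks `N/2 < k ≤ N` sum geometrically, so one block suffices.

The indicator of a block is dominated, up to a constant, by the nonnegative Fourier coefficients of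
`squareSymbol`, a difference of two theta series. Poisson summation describes this symbol on the arc
of radius `1/(qN)` around `a/q`, for every `q ≤ N`: it is a normalized Gauss sum times
`squareDensity`, up to `O(√N)` (`exists_squareSymbol_arc_approx`). A single theta series would give
a density of decay `|β|^(-1/2)`; the difference improves this to `|β|^(-3/2)`, so that the density
has `L¹` norm `O(1/N)`.

High-low decomposition: keep the arcs with `q ≤ Q`. The remainder is `O(N/√Q)` in sup norm, because
Gauss sums are `O(√q)` and Dirichlet approximation covers the circle; this gives an `ℓ²` bound
(`exists_squareSymbol_sub_majorPart_le`, `norm_sum_multiplier_le`). The kept part has a kernel of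
size `O(Q^(1+ε)/N)` pointwise (`exists_integral_majorPart_le`). The size of the Gauss sums alone
would only give `Q^(3/2)/N`; the gain comes from summing over numerators, which turns Gauss sums
into counts of square roots modulo the divisors of `q`, and these counts are `O(Q^ε)` on average.

Interpolation: split normalized `f, g` into levels of size about `4^i` and `4^j`. Taking `Q =
2^(i+j)` when `i + j ≥ 0`, and the plain `ℓ²` bound otherwise, gives bounds which decay
geometrically in `|i + j|`, apart from a low term that sums without loss. The decay requires exactly
`3/2 < p < 2`; the endpoint `p = 2` is Cauchy-Schwarz.

Part (2). A point mass just to the right of `I` is averaged to `1/N` at `N` points of `I`, and the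
ratio of the two sides grows like `N^(3/p - 2)`. -/

/-! ### Additive characters and orthogonality -/

/-- The additive character `t ↦ e^{2πit}` of the real line. -/
noncomputable def unitExp (t : ℝ) : ℂ := Complex.exp (2 * Real.pi * t * Complex.I)

lemma unitExp_add (s t : ℝ) : unitExp (s + t) = unitExp s * unitExp t := by
  rw [unitExp, unitExp, unitExp, ← Complex.exp_add]
  congr 1
  push_cast
  ring

@[simp] lemma unitExp_zero : unitExp 0 = 1 := by simp [unitExp]

@[simp] lemma norm_unitExp (t : ℝ) : ‖unitExp t‖ = 1 := by
  rw [unitExp, show (2 * Real.pi * t * Complex.I : ℂ) = ((2 * Real.pi * t : ℝ) : ℂ) * Complex.I by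
    push_cast; ring]
  exact Complex.norm_exp_ofReal_mul_I _

@[simp] lemma unitExp_intCast (n : ℤ) : unitExp n = 1 := by
  rw [unitExp, show (2 * Real.pi * ((n : ℝ) : ℂ) * Complex.I : ℂ)
    = n * (2 * Real.pi * Complex.I) by push_cast; ring]
  exact Complex.exp_int_mul_two_pi_mul_I n

lemma unitExp_add_intCast (t : ℝ) (n : ℤ) : unitExp (t + n) = unitExp t := by
  rw [unitExp_add, unitExp_intCast, mul_one]

lemma conj_unitExp (t : ℝ) : (starRingEnd ℂ) (unitExp t) = unitExp (-t) := by
  rw [unitExp, unitExp, ← Complex.exp_conj]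
  congr 1
  simp [map_ofNat]

@[fun_prop] lemma continuous_unitExp : Continuous unitExp := by
  unfold unitExp
  fun_prop

lemma unitExp_nat_mul (n : ℕ) (t : ℝ) : unitExp (n * t) = unitExp t ^ n := by
  rw [unitExp, unitExp, ← Complex.exp_nat_mul]
  congr 1
  push_cast
  ring

lemma unitExp_eq_one_iff (t : ℝ) : unitExp t = 1 ↔ ∃ n : ℤ, t = n := by
  constructor
  · intro h
    rw [unitExp, Complex.exp_eq_one_iff] at h
    obtain ⟨n, hn⟩ := h
    refine ⟨n, ?_⟩
    have h2 : (2 * Real.pi * Complex.I : ℂ) ≠ 0 := by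
      simp [Real.pi_ne_zero]
    have h3 : (2 * Real.pi * Complex.I : ℂ) * t = (2 * Real.pi * Complex.I) * n := by
      linear_combination hn
    have h4 := mul_left_cancel₀ h2 h3
    exact_mod_cast h4
  · rintro ⟨n, rfl⟩
    exact unitExp_intCast n

lemma unitExp_int_div_eq_one_iff {q : ℕ} (hq : 0 < q) (m : ℤ) :
    unitExp ((m : ℝ) / q) = 1 ↔ (q : ℤ) ∣ m := by
  have hq' : (q : ℝ) ≠ 0 := by positivity
  rw [unitExp_eq_one_iff]
  constructor
  · rintro ⟨n, hn⟩
    refine ⟨n, ?_⟩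
    rw [div_eq_iff hq'] at hn
    have : (m : ℝ) = ((q * n : ℤ) : ℝ) := by push_cast; linarith
    exact_mod_cast this
  · rintro ⟨n, rfl⟩
    refine ⟨n, ?_⟩
    push_cast
    field_simp

/-- Orthogonality of the additive characters modulo `q`. -/
lemma sum_unitExp_div {q : ℕ} (hq : 0 < q) (m : ℤ) :
    ∑ b ∈ Finset.range q, unitExp ((b : ℝ) * m / q) = if (q : ℤ) ∣ m then (q : ℂ) else 0 := by
  have hq' : (q : ℝ) ≠ 0 := by positivity
  have h : ∀ b ∈ Finset.range q, unitExp ((b : ℝ) * m / q) = unitExp ((m : ℝ) / q) ^ b := by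
    intro b _
    rw [← unitExp_nat_mul, mul_div_assoc]
  rw [Finset.sum_congr rfl h]
  split_ifs with hd
  · rw [(unitExp_int_div_eq_one_iff hq m).2 hd]
    simp
  · have h1 : unitExp ((m : ℝ) / q) ≠ 1 := fun h => hd ((unitExp_int_div_eq_one_iff hq m).1 h)
    rw [geom_sum_eq h1, ← unitExp_nat_mul, mul_div_cancel₀ _ hq', unitExp_intCast]
    simp

/-- Orthogonality of the characters `α ↦ e(nα)` on an interval of length one. -/
lemma integral_unitExp_int_mul (t : ℝ) (n : ℤ) :
    ∫ α in t..(t + 1), unitExp (α * n) = if n = 0 then 1 else 0 := by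
  split_ifs with hn
  · simp [hn]
  · have hc : (2 * Real.pi * n * Complex.I : ℂ) ≠ 0 := by
      simp [Real.pi_ne_zero, hn]
    have h : ∀ α : ℝ, unitExp (α * n) = Complex.exp ((2 * Real.pi * n * Complex.I) * α) := by
      intro α
      rw [unitExp]
      congr 1
      push_cast
      ring
    have h2 : unitExp ((t + 1) * n) = unitExp (t * n) := by
      rw [add_mul, one_mul, unitExp_add_intCast]
    simp_rw [h]
    rw [integral_exp_mul_complex hc, ← h, ← h, h2]
    simp

/-! ### Quadratic Gauss sums -/

/-- The quadratic Gauss sum `∑_{r mod q} e((-a r² + n r)/q)`. -/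
noncomputable def quadGauss (a n : ℤ) (q : ℕ) : ℂ :=
  ∑ r ∈ Finset.range q, unitExp (((-a * (r : ℤ) ^ 2 + n * r : ℤ) : ℝ) / q)

lemma unitExp_div_congr {q : ℕ} (hq : 0 < q) {m n : ℤ} (h : (q : ℤ) ∣ m - n) :
    unitExp ((m : ℝ) / q) = unitExp ((n : ℝ) / q) := by
  have := (unitExp_int_div_eq_one_iff hq (m - n)).2 h
  have h2 : (m : ℝ) / q = (n : ℝ) / q + ((m - n : ℤ) : ℝ) / q := by
    push_cast; ring
  rw [h2, unitExp_add, this, mul_one]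

/-- Sums of `q`-periodic functions over a complete residue system are translation invariant. -/
lemma sum_range_periodic_add {q : ℕ} (F : ℤ → ℂ) (hF : ∀ x y : ℤ, (q : ℤ) ∣ x - y → F x = F y)
    (s : ℕ) : ∑ r ∈ Finset.range q, F (r + s) = ∑ r ∈ Finset.range q, F r := by
  induction s with
  | zero => simp
  | succ s ih =>
    rw [← ih]
    have h1 := Finset.sum_range_succ (fun r : ℕ => F (r + s)) q
    have h2 := Finset.sum_range_succ' (fun r : ℕ => F (r + s)) q
    have h3 : F ((q : ℤ) + s) = F ((0 : ℕ) + s) := hF _ _ ⟨1, by push_cast; ring⟩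
    rw [h1] at h2
    simp only [h3] at h2
    rw [add_right_cancel h2]
    refine Finset.sum_congr rfl fun r _ => ?_
    congr 1
    push_cast
    ring

/-- As `a` is invertible modulo `q`, the condition is `q ∣ 2t`, so `2t` is `0` or `q` for `t < q`.
-/
lemma card_filter_dvd_two_mul_le {q : ℕ} {a : ℤ} (ha : IsCoprime a q) :
    ((Finset.range q).filter fun t : ℕ => (q : ℤ) ∣ 2 * a * t).card ≤ 2 := by
  have hsub : ((Finset.range q).filter fun t : ℕ => (q : ℤ) ∣ 2 * a * t)
      ⊆ (Finset.range 2).image (fun i => i * q / 2) := by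
    intro t ht
    rw [Finset.mem_filter, Finset.mem_range] at ht
    obtain ⟨htq, hd⟩ := ht
    have hd2 : (q : ℤ) ∣ 2 * t := by
      refine ha.symm.dvd_of_dvd_mul_left (y := a) ?_
      rwa [show a * (2 * (t : ℤ)) = 2 * a * t by ring]
    have hd3 : q ∣ 2 * t := by exact_mod_cast hd2
    obtain ⟨c, hc⟩ := hd3
    have hc2 : c < 2 := by
      by_contra h
      push Not at h
      have : q * 2 ≤ q * c := Nat.mul_le_mul_left q h
      omega
    refine Finset.mem_image.2 ⟨c, Finset.mem_range.2 hc2, ?_⟩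
    rw [mul_comm c q, ← hc]
    omega
  exact (Finset.card_le_card hsub).trans (Finset.card_image_le.trans (by simp))

/-- Weyl differencing: in `G · conj G` shift the variable of `G` by that of the conjugate. The phase
becomes linear in the conjugate variable `s`, with frequency `-2at`, so orthogonality leaves at most
two values of `t`. -/
lemma norm_sq_quadGauss_le {q : ℕ} (hq : 0 < q) {a : ℤ} (ha : IsCoprime a q) (n : ℤ) :
    ‖quadGauss a n q‖ ^ 2 ≤ 2 * q := by
  have hqR : (q : ℝ) ≠ 0 := by positivity
  set P : ℤ → ℤ := fun r => -a * r ^ 2 + n * r with hP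
  have hper : ∀ x y : ℤ, (q : ℤ) ∣ x - y → (q : ℤ) ∣ P x - P y := by
    intro x y h
    have : P x - P y = (x - y) * (-a * (x + y) + n) := by simp only [hP]; ring
    rw [this]
    exact h.mul_right _
  have h1 : quadGauss a n q * (starRingEnd ℂ) (quadGauss a n q)
      = ∑ t ∈ Finset.range q, unitExp ((P t : ℝ) / q) *
          (if (q : ℤ) ∣ -2 * a * t then (q : ℂ) else 0) := by
    have h2 : (starRingEnd ℂ) (quadGauss a n q)
        = ∑ s ∈ Finset.range q, unitExp (-((P s : ℝ) / q)) := by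
      rw [quadGauss, map_sum]
      exact Finset.sum_congr rfl fun s _ => conj_unitExp _
    rw [h2, Finset.mul_sum]
    have h3 : ∀ s ∈ Finset.range q, quadGauss a n q * unitExp (-((P s : ℝ) / q))
        = ∑ t ∈ Finset.range q, unitExp ((P t : ℝ) / q) *
            unitExp ((s : ℝ) * ((-2 * a * t : ℤ) : ℝ) / q) := by
      intro s _
      have h4 : quadGauss a n q = ∑ t ∈ Finset.range q, unitExp ((P (t + s) : ℝ) / q) := by
        rw [sum_range_periodic_add (fun r => unitExp ((P r : ℝ) / q))
          (fun x y h => unitExp_div_congr hq (hper x y h)) s]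
        rfl
      rw [h4, Finset.sum_mul]
      refine Finset.sum_congr rfl fun t _ => ?_
      rw [← unitExp_add, ← unitExp_add]
      congr 1
      simp only [hP]
      push_cast
      field_simp
      ring
    rw [Finset.sum_congr rfl h3, Finset.sum_comm]
    refine Finset.sum_congr rfl fun t _ => ?_
    rw [← Finset.mul_sum, sum_unitExp_div hq]
  have h5 : ‖quadGauss a n q‖ ^ 2 = ‖quadGauss a n q * (starRingEnd ℂ) (quadGauss a n q)‖ := by
    rw [norm_mul, RCLike.norm_conj, sq]
  rw [h5, h1]
  refine (norm_sum_le _ _).trans ?_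
  have h6 : ∀ t ∈ Finset.range q, ‖unitExp ((P t : ℝ) / q) *
          (if (q : ℤ) ∣ -2 * a * t then (q : ℂ) else 0)‖
        = if (q : ℤ) ∣ 2 * a * t then (q : ℝ) else 0 := by
    intro t _
    have h7 : ((q : ℤ) ∣ -2 * a * t) ↔ ((q : ℤ) ∣ 2 * a * t) := by
      rw [show -2 * a * (t : ℤ) = -(2 * a * t) by ring, dvd_neg]
    rw [norm_mul, norm_unitExp, one_mul]
    simp only [h7]
    split_ifs <;> simp
  rw [Finset.sum_congr rfl h6, ← Finset.sum_filter, Finset.sum_const, nsmul_eq_mul]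
  have h8 : (((Finset.range q).filter fun t : ℕ => (q : ℤ) ∣ 2 * a * t).card : ℝ) ≤ 2 := by
    exact_mod_cast card_filter_dvd_two_mul_le ha
  exact mul_le_mul_of_nonneg_right h8 (by positivity)

lemma norm_quadGauss_le {q : ℕ} (hq : 0 < q) {a : ℤ} (ha : IsCoprime a q) (n : ℤ) :
    ‖quadGauss a n q‖ ≤ Real.sqrt (2 * q) :=
  Real.le_sqrt_of_sq_le (norm_sq_quadGauss_le hq ha n)

/-! ### Theta series near rational points -/

/-- The theta series `∑_{k ∈ ℤ} e^{-π z k²}`. -/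
noncomputable def thetaSeries (z : ℂ) : ℂ := ∑' k : ℤ, Complex.exp (-Real.pi * z * (k : ℂ) ^ 2)

/-- The principal square root. -/
noncomputable def csqrt (z : ℂ) : ℂ := z ^ (1 / 2 : ℂ)

lemma csqrt_sq (z : ℂ) : csqrt z ^ 2 = z := by
  have := Complex.cpow_nat_inv_pow z (n := 2) two_ne_zero
  rw [csqrt, one_div]
  exact_mod_cast this

lemma norm_csqrt_sq (z : ℂ) : ‖csqrt z‖ ^ 2 = ‖z‖ := by
  rw [← norm_pow, csqrt_sq]

lemma norm_csqrt (z : ℂ) : ‖csqrt z‖ = Real.sqrt ‖z‖ := by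
  rw [← norm_csqrt_sq z, Real.sqrt_sq (norm_nonneg _)]

lemma csqrt_ne_zero {z : ℂ} (hz : z ≠ 0) : csqrt z ≠ 0 := by
  intro h
  apply hz
  rw [← csqrt_sq z, h]
  simp

lemma csqrt_natCast_sq_mul {q : ℕ} (hq : 0 < q) {z : ℂ} (hz : z ≠ 0) :
    csqrt ((q : ℂ) ^ 2 * z) = q * csqrt z := by
  have hq' : (q : ℂ) ≠ 0 := by exact_mod_cast hq.ne'
  have hqR : (0 : ℝ) < q := by exact_mod_cast hq
  have h1 : ((q : ℂ) ^ 2 * z) = (((q : ℝ) ^ 2 : ℝ) : ℂ) * z := by push_cast; rfl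
  rw [csqrt, csqrt, Complex.cpow_def_of_ne_zero (mul_ne_zero (pow_ne_zero 2 hq') hz),
    Complex.cpow_def_of_ne_zero hz, h1, Complex.log_ofReal_mul (by positivity) hz, add_mul,
    Complex.exp_add]
  congr 1
  rw [Real.log_pow]
  have : ((((2 : ℕ) : ℝ) * Real.log q : ℝ) : ℂ) * (1 / 2) = ((Real.log q : ℝ) : ℂ) := by
    push_cast; ring
  rw [this, ← Complex.ofReal_exp, Real.exp_log hqR]
  simp

lemma csqrt_re_pos {z : ℂ} (hz : 0 < z.re) : 0 < (csqrt z).re := by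
  have hz0 : z ≠ 0 := by rintro rfl; simp at hz
  rw [csqrt, Complex.cpow_def_of_ne_zero hz0, Complex.exp_re]
  refine mul_pos (Real.exp_pos _) (Real.cos_pos_of_mem_Ioo ?_)
  have h1 : (Complex.log z * (1 / 2)).im = Complex.arg z / 2 := by
    have : Complex.log z * (1 / 2) = ((1 / 2 : ℝ) : ℂ) * Complex.log z := by push_cast; ring
    rw [this, Complex.im_ofReal_mul, Complex.log_im]
    ring
  rw [h1]
  have h2 := Complex.neg_pi_lt_arg z
  have h3 := Complex.arg_le_pi z
  constructor <;> nlinarith [Real.pi_pos, Complex.abs_arg_lt_pi_div_two_iff.2 (Or.inl hz),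
    abs_lt.1 (Complex.abs_arg_lt_pi_div_two_iff.2 (Or.inl hz))]

/-- Square roots of points of the right half-plane lie in the sector `|im| ≤ re`, so two of them
make an angle of at most `π/2` and adding one cannot shorten the other. -/
lemma norm_csqrt_le_norm_add {z w : ℂ} (hz : 0 < z.re) (hw : 0 < w.re) :
    ‖csqrt z‖ ≤ ‖csqrt z + csqrt w‖ := by
  have key : ∀ u : ℂ, 0 < u.re → |(csqrt u).im| ≤ (csqrt u).re := by
    intro u hu
    refine abs_le_of_sq_le_sq ?_ (csqrt_re_pos hu).le
    have h := congrArg Complex.re (csqrt_sq u)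
    rw [sq, Complex.mul_re] at h
    nlinarith
  have h1 := key z hz
  have h2 := key w hw
  have h3 : -((csqrt z).re * (csqrt w).re) ≤ (csqrt z).im * (csqrt w).im := by
    have : |(csqrt z).im * (csqrt w).im| ≤ (csqrt z).re * (csqrt w).re := by
      rw [abs_mul]
      exact mul_le_mul h1 h2 (abs_nonneg _) (csqrt_re_pos hz).le
    exact (abs_le.1 this).1
  refine le_of_sq_le_sq ?_ (norm_nonneg _)
  rw [← Complex.normSq_eq_norm_sq, ← Complex.normSq_eq_norm_sq, Complex.normSq_apply,
    Complex.normSq_apply, Complex.add_re, Complex.add_im]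
  nlinarith [sq_nonneg (csqrt w).re, sq_nonneg (csqrt w).im]

lemma summable_exp_neg_pi_mul_sq {z : ℂ} (hz : 0 < z.re) :
    Summable fun k : ℤ => Complex.exp (-Real.pi * z * (k : ℂ) ^ 2) := by
  have h : 0 < (Complex.I * z).im := by simpa using hz
  refine (hasSum_jacobiTheta₂_term 0 h).summable.congr fun k => ?_
  rw [jacobiTheta₂_term]
  congr 1
  linear_combination (Real.pi * z * (k : ℂ) ^ 2) * Complex.I_sq

lemma norm_exp_neg_pi_mul_sq (z : ℂ) (k : ℤ) :
    ‖Complex.exp (-Real.pi * z * (k : ℂ) ^ 2)‖ = Real.exp (-Real.pi * z.re * (k : ℝ) ^ 2) := by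
  rw [Complex.norm_exp]
  congr 1
  have : (-Real.pi * z * (k : ℂ) ^ 2) = ((-Real.pi * (k : ℝ) ^ 2 : ℝ) : ℂ) * z := by
    push_cast; ring
  rw [this, Complex.re_ofReal_mul]
  ring

/-- Poisson summation in a residue class. -/
lemma tsum_exp_residue_class {q : ℕ} (hq : 0 < q) {z : ℂ} (hz : 0 < z.re) (r : ℕ) :
    ∑' m : ℤ, Complex.exp (-Real.pi * z * ((m : ℂ) * q + r) ^ 2) =
      1 / (q * csqrt z) * ∑' n : ℤ, unitExp (((n * r : ℤ) : ℝ) / q) *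
        Complex.exp (-Real.pi * (1 / ((q : ℂ) ^ 2 * z)) * (n : ℂ) ^ 2) := by
  have hz0 : z ≠ 0 := by rintro rfl; simp at hz
  have hq' : (q : ℂ) ≠ 0 := by exact_mod_cast hq.ne'
  have hqR : (0 : ℝ) < q := by exact_mod_cast hq
  have h1 : 0 < ((q : ℂ) ^ 2 * z).re := by
    have : ((q : ℂ) ^ 2 * z) = (((q : ℝ) ^ 2 : ℝ) : ℂ) * z := by push_cast; rfl
    rw [this, Complex.re_ofReal_mul]
    positivity
  have h2 := Complex.tsum_exp_neg_quadratic h1 (-(r * q * z))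
  have h3 : ∀ m : ℤ, Complex.exp (-Real.pi * z * ((m : ℂ) * q + r) ^ 2)
      = Complex.exp (-Real.pi * z * r ^ 2) *
        Complex.exp (-Real.pi * ((q : ℂ) ^ 2 * z) * m ^ 2 + 2 * Real.pi * (-(r * q * z)) * m) := by
    intro m
    rw [← Complex.exp_add]
    congr 1
    ring
  have h4 : ∀ n : ℤ, Complex.exp (-Real.pi / ((q : ℂ) ^ 2 * z) *
        (n + Complex.I * (-(r * q * z))) ^ 2) = Complex.exp (Real.pi * z * r ^ 2) *
        (unitExp (((n * r : ℤ) : ℝ) / q) *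
        Complex.exp (-Real.pi * (1 / ((q : ℂ) ^ 2 * z)) * (n : ℂ) ^ 2)) := by
    intro n
    rw [unitExp, ← Complex.exp_add, ← Complex.exp_add]
    congr 1
    push_cast
    field_simp
    linear_combination (-(r : ℂ) ^ 2 * q ^ 2 * z ^ 2) * Complex.I_sq
  simp_rw [h3]
  rw [tsum_mul_left, h2]
  simp_rw [h4]
  rw [tsum_mul_left, ← csqrt_natCast_sq_mul hq hz0]
  -- Completing the square in the Poisson formula produces `e^(πzr²)`, which cancels the factor
  -- pulled out of `(mq + r)²`.
  have h5 : Complex.exp (-Real.pi * z * r ^ 2) * Complex.exp (Real.pi * z * r ^ 2) = 1 := by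
    rw [← Complex.exp_add]
    ring_nf
    simp
  rw [csqrt]
  linear_combination (1 / ((q : ℂ) ^ 2 * z) ^ (1 / 2 : ℂ) *
    ∑' n : ℤ, unitExp (((n * r : ℤ) : ℝ) / q) *
        Complex.exp (-Real.pi * (1 / ((q : ℂ) ^ 2 * z)) * (n : ℂ) ^ 2)) * h5

/-- The transformation of the theta series near a rational point. -/
lemma thetaSeries_rational {q : ℕ} (hq : 0 < q) (a : ℤ) {z : ℂ} (hz : 0 < z.re) :
    thetaSeries (z + 2 * ((a : ℂ) / q) * Complex.I) =
      1 / (q * csqrt z) * ∑' n : ℤ, quadGauss a n q *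
        Complex.exp (-Real.pi * (1 / ((q : ℂ) ^ 2 * z)) * (n : ℂ) ^ 2) := by
  have hz0 : z ≠ 0 := by rintro rfl; simp at hz
  have hq' : (q : ℂ) ≠ 0 := by exact_mod_cast hq.ne'
  have hqR : (0 : ℝ) < q := by exact_mod_cast hq
  have : NeZero q := ⟨hq.ne'⟩
  have hw : 0 < (z + 2 * ((a : ℂ) / q) * Complex.I).re := by
    have : (2 * ((a : ℂ) / q) * Complex.I) = ((2 * ((a : ℝ) / q) : ℝ) : ℂ) * Complex.I := by
      push_cast; ring
    rw [this, Complex.add_re, Complex.re_ofReal_mul]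
    simpa using hz
  have hzinv : 0 < (1 / ((q : ℂ) ^ 2 * z)).re := by
    have : (1 / ((q : ℂ) ^ 2 * z)) = ((1 / (q : ℝ) ^ 2 : ℝ) : ℂ) * z⁻¹ := by
      push_cast; field_simp
    rw [this, Complex.re_ofReal_mul, Complex.inv_re]
    have : 0 < Complex.normSq z := Complex.normSq_pos.2 hz0
    positivity
  have hsum := summable_exp_neg_pi_mul_sq hw
  set F : ℤ → ℂ := fun k => Complex.exp (-Real.pi *
    (z + 2 * ((a : ℂ) / q) * Complex.I) * (k : ℂ) ^ 2) with hF
  have hs3 : Summable ((F ∘ (Int.divModEquiv q).symm) ∘ Equiv.prodComm (Fin q) ℤ) :=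
    (Equiv.prodComm (Fin q) ℤ).summable_iff.2 ((Int.divModEquiv q).symm.summable_iff.2 hsum)
  have h0 : thetaSeries (z + 2 * ((a : ℂ) / q) * Complex.I) = ∑' p : Fin q × ℤ,
      ((F ∘ (Int.divModEquiv q).symm) ∘ Equiv.prodComm (Fin q) ℤ) p := by
    rw [thetaSeries, ← (Int.divModEquiv q).symm.tsum_eq, ← (Equiv.prodComm (Fin q) ℤ).tsum_eq]
    rfl
  rw [h0, hs3.tsum_prod, tsum_fintype]
  have h1 : ∀ r : Fin q, ∑' m : ℤ,
      ((F ∘ (Int.divModEquiv q).symm) ∘ Equiv.prodComm (Fin q) ℤ) (r, m)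
      = 1 / (q * csqrt z) * ∑' n : ℤ,
        unitExp (((-a * ((r : ℕ) : ℤ) ^ 2 + n * ((r : ℕ) : ℤ) : ℤ) : ℝ) / q) *
        Complex.exp (-Real.pi * (1 / ((q : ℂ) ^ 2 * z)) * (n : ℂ) ^ 2) := by
    intro r
    have h2 : ∀ m : ℤ, ((F ∘ (Int.divModEquiv q).symm) ∘ Equiv.prodComm (Fin q) ℤ) (r, m)
        = unitExp (((-a * ((r : ℕ) : ℤ) ^ 2 : ℤ) : ℝ) / q) *
          Complex.exp (-Real.pi * z * ((m : ℂ) * q + (r : ℕ)) ^ 2) := by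
      intro m
      -- The rational part of the phase depends only on the residue `r` of `k = mq + r`.
      have h3 : unitExp (((-a * ((r : ℕ) : ℤ) ^ 2 : ℤ) : ℝ) / q)
          = unitExp (((-a * (m * q + ((r : ℕ) : ℤ)) ^ 2 : ℤ) : ℝ) / q) :=
        unitExp_div_congr hq ⟨a * m * (m * q + 2 * ((r : ℕ) : ℤ)), by ring⟩
      rw [h3, unitExp, ← Complex.exp_add]
      simp only [hF, Function.comp_apply, Equiv.prodComm_apply, Prod.swap_prod_mk,
        Int.divModEquiv, Equiv.coe_fn_symm_mk]
      congr 1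
      push_cast
      field_simp
      ring
    rw [tsum_congr h2, tsum_mul_left, tsum_exp_residue_class hq hz]
    rw [mul_left_comm, ← tsum_mul_left]
    congr 1
    refine tsum_congr fun n => ?_
    rw [← mul_assoc, ← unitExp_add]
    congr 2
    push_cast
    ring
  rw [Finset.sum_congr rfl fun r _ => h1 r, ← Finset.mul_sum, ← Summable.tsum_finsetSum]
  · congr 1
    refine tsum_congr fun n => ?_
    rw [quadGauss, Finset.sum_mul, ← Fin.sum_univ_eq_sum_range (fun r : ℕ =>
      unitExp (((-a * (r : ℤ) ^ 2 + n * (r : ℤ) : ℤ) : ℝ) / q) *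
        Complex.exp (-Real.pi * (1 / ((q : ℂ) ^ 2 * z)) * (n : ℂ) ^ 2)) q]
  · intro r _
    refine Summable.of_norm ?_
    refine (summable_exp_neg_pi_mul_sq hzinv).norm.congr fun n => ?_
    rw [norm_mul, norm_unitExp, one_mul]

/-- Near a reduced fraction `a/q` the theta series is close to the zero frequency term of its
Poisson summation. -/
lemma exists_thetaSeries_rational_approx : ∃ C : ℝ, 0 < C ∧ ∀ q : ℕ, 0 < q → ∀ a : ℤ,
    IsCoprime a q → ∀ z : ℂ, 0 < z.re →
      ‖thetaSeries (z + 2 * ((a : ℂ) / q) * Complex.I) - quadGauss a 0 q / q * (1 / csqrt z)‖ ≤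
        C * (q * ‖z‖ * Real.sqrt (q * ‖z‖)) / z.re := by
  have hS : Summable fun n : ℤ => 1 / (n : ℝ) ^ 2 := Real.summable_one_div_int_pow.2 (by norm_num)
  set S : ℝ := ∑' n : ℤ, 1 / (n : ℝ) ^ 2 with hSdef
  have hS0 : 0 ≤ S := tsum_nonneg fun n => by positivity
  refine ⟨Real.sqrt 2 * S / Real.pi + 1, by positivity, fun q hq a ha z hz => ?_⟩
  have hz0 : z ≠ 0 := by rintro rfl; simp at hz
  have hq' : (q : ℂ) ≠ 0 := by exact_mod_cast hq.ne'
  have hqR : (0 : ℝ) < q := by exact_mod_cast hq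
  have hnz : 0 < ‖z‖ := norm_pos_iff.2 hz0
  set R : ℝ := z.re / ((q : ℝ) ^ 2 * ‖z‖ ^ 2) with hR
  have hRpos : 0 < R := by positivity
  have hzinv : (1 / ((q : ℂ) ^ 2 * z)).re = R := by
    have : (1 / ((q : ℂ) ^ 2 * z)) = ((1 / (q : ℝ) ^ 2 : ℝ) : ℂ) * z⁻¹ := by
      push_cast; field_simp
    rw [this, Complex.re_ofReal_mul, Complex.inv_re, Complex.normSq_eq_norm_sq, hR]
    field_simp
  set E : ℤ → ℂ := fun n => quadGauss a n q *
        Complex.exp (-Real.pi * (1 / ((q : ℂ) ^ 2 * z)) * (n : ℂ) ^ 2) with hE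
  have hEnorm : ∀ n : ℤ, ‖E n‖ = ‖quadGauss a n q‖ * Real.exp (-Real.pi * R * (n : ℝ) ^ 2) := by
    intro n
    rw [hE, norm_mul, norm_exp_neg_pi_mul_sq, hzinv]
  have hG := norm_quadGauss_le hq ha
  have hbound : ∀ n : ℤ, ‖if n = 0 then 0 else E n‖ ≤
      Real.sqrt (2 * q) / (Real.pi * R) * (1 / (n : ℝ) ^ 2) := by
    intro n
    split_ifs with hn
    · simp [hn]
    · rw [hEnorm]
      have hn2 : (0 : ℝ) < (n : ℝ) ^ 2 := by positivity
      have hy : 0 < Real.pi * R * (n : ℝ) ^ 2 := by positivity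
      -- The bound `e^(-y) ≤ 1/y` is enough: it makes the nonzero frequencies summable against
      -- `1/n²`.
      have h1 : Real.exp (-Real.pi * R * (n : ℝ) ^ 2) ≤ 1 / (Real.pi * R * (n : ℝ) ^ 2) := by
        rw [show -Real.pi * R * (n : ℝ) ^ 2 = -(Real.pi * R * (n : ℝ) ^ 2) by ring, Real.exp_neg,
          ← one_div]
        exact one_div_le_one_div_of_le hy (by linarith [Real.add_one_le_exp (Real.pi * R * (n : ℝ) ^ 2)])
      calc _ ≤ Real.sqrt (2 * q) * (1 / (Real.pi * R * (n : ℝ) ^ 2)) :=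
            mul_le_mul (hG n) h1 (Real.exp_pos _).le (Real.sqrt_nonneg _)
        _ = _ := by field_simp
  have hsumE : Summable E := by
    have hsq : Summable fun n : ℤ => Real.sqrt (2 * q) * Real.exp (-Real.pi * R * (n : ℝ) ^ 2) := by
      refine Summable.mul_left _ ?_
      refine (summable_exp_neg_pi_mul_sq (z := 1 / ((q : ℂ) ^ 2 * z)) (by rw [hzinv]; exact hRpos)
        ).norm.congr fun n => ?_
      rw [norm_exp_neg_pi_mul_sq, hzinv]
    refine Summable.of_norm_bounded hsq fun n => ?_
    rw [hEnorm]
    exact mul_le_mul_of_nonneg_right (hG n) (Real.exp_pos _).le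
  rw [thetaSeries_rational hq a hz, hsumE.tsum_eq_add_tsum_ite 0]
  have hE0 : E 0 = quadGauss a 0 q := by simp [hE]
  have h2 : 1 / ((q : ℂ) * csqrt z) * (E 0 + ∑' n : ℤ, if n = 0 then 0 else E n) -
      quadGauss a 0 q / q * (1 / csqrt z)
      = 1 / ((q : ℂ) * csqrt z) * ∑' n : ℤ, if n = 0 then 0 else E n := by
    have := csqrt_ne_zero hz0
    rw [hE0]
    field_simp
    ring
  rw [h2, norm_mul]
  have h3 : ‖∑' n : ℤ, if n = 0 then 0 else E n‖ ≤ Real.sqrt (2 * q) / (Real.pi * R) * S :=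
    tsum_of_norm_bounded (hS.hasSum.mul_left _) hbound
  have h4 : ‖1 / ((q : ℂ) * csqrt z)‖ = 1 / (q * Real.sqrt ‖z‖) := by
    rw [norm_div, norm_mul, norm_csqrt]
    simp
  rw [h4]
  have hs1 : Real.sqrt (2 * q) = Real.sqrt 2 * Real.sqrt q := Real.sqrt_mul (by norm_num) _
  have hs2 : Real.sqrt (q * ‖z‖) = Real.sqrt q * Real.sqrt ‖z‖ := Real.sqrt_mul hqR.le _
  have hs3 : Real.sqrt ‖z‖ ^ 2 = ‖z‖ := Real.sq_sqrt hnz.le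
  have hs4 : 0 < Real.sqrt ‖z‖ := Real.sqrt_pos.2 hnz
  calc _ ≤ 1 / (q * Real.sqrt ‖z‖) * (Real.sqrt (2 * q) / (Real.pi * R) * S) :=
        mul_le_mul_of_nonneg_left h3 (by positivity)
    _ = Real.sqrt 2 * S / Real.pi * (q * ‖z‖ * Real.sqrt (q * ‖z‖)) / z.re := by
        rw [hR, hs1, hs2]
        generalize Real.sqrt ‖z‖ = s at *
        rw [← hs3]
        field_simp
    _ ≤ _ := by
        gcongr
        linarith

/-! ### The smoothed symbol on arcs and its density -/

/-- The Fourier series with coefficients `e^{-πk²/N²} - e^{-4πk²/N²}` at the squares. -/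
noncomputable def squareSymbol (N : ℕ) (α : ℝ) : ℂ :=
  thetaSeries (((1 / (N : ℝ) ^ 2 : ℝ) : ℂ) + 2 * α * Complex.I) -
    thetaSeries (((4 / (N : ℝ) ^ 2 : ℝ) : ℂ) + 2 * α * Complex.I)

/-- The continuous analogue of `squareSymbol`. -/
noncomputable def squareDensity (N : ℕ) (β : ℝ) : ℂ :=
  1 / csqrt (((1 / (N : ℝ) ^ 2 : ℝ) : ℂ) + 2 * β * Complex.I) -
    1 / csqrt (((4 / (N : ℝ) ^ 2 : ℝ) : ℂ) + 2 * β * Complex.I)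

lemma re_add_two_mul_I (c β : ℝ) : ((c : ℂ) + 2 * β * Complex.I).re = c := by simp

lemma norm_add_two_mul_I_sq (c β : ℝ) :
    ‖(c : ℂ) + 2 * β * Complex.I‖ ^ 2 = c ^ 2 + 4 * β ^ 2 := by
  rw [← Complex.normSq_eq_norm_sq, Complex.normSq_apply]
  simp
  ring

lemma norm_add_two_mul_I_le {c : ℝ} (hc : 0 ≤ c) (β : ℝ) :
    ‖(c : ℂ) + 2 * β * Complex.I‖ ≤ c + 2 * |β| := by
  refine (norm_add_le _ _).trans ?_
  simp [abs_of_nonneg hc]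

/-- On the arc of radius `1/(qN)` around `a/q`, the symbol is the Gauss sum times the density up to
`O(√N)`. -/
lemma exists_squareSymbol_arc_approx : ∃ C : ℝ, 0 < C ∧ ∀ N q : ℕ, 0 < q → q ≤ N → ∀ a : ℤ,
    IsCoprime a q → ∀ β : ℝ, |β| ≤ 1 / (q * N) →
      ‖squareSymbol N ((a : ℝ) / q + β) - quadGauss a 0 q / q * squareDensity N β‖ ≤
        C * Real.sqrt N := by
  obtain ⟨C, hC, h⟩ := exists_thetaSeries_rational_approx
  refine ⟨2 * (C * (6 * Real.sqrt 6)), by positivity, fun N q hq hqN a ha β hβ => ?_⟩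
  have hqR : (0 : ℝ) < q := by exact_mod_cast hq
  have hNR : (0 : ℝ) < N := by exact_mod_cast hq.trans_le hqN
  have hqN' : (q : ℝ) ≤ N := by exact_mod_cast hqN
  have key : ∀ c : ℝ, 1 / (N : ℝ) ^ 2 ≤ c → c ≤ 4 / (N : ℝ) ^ 2 →
      ‖thetaSeries ((c : ℂ) + 2 * (((a : ℝ) / q + β : ℝ) : ℂ) * Complex.I) -
        quadGauss a 0 q / q * (1 / csqrt ((c : ℂ) + 2 * β * Complex.I))‖ ≤
        C * (6 * Real.sqrt 6) * Real.sqrt N := by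
    intro c hc1 hc2
    have hc : 0 < c := lt_of_lt_of_le (by positivity) hc1
    have h1 := h q hq a ha ((c : ℂ) + 2 * β * Complex.I) (by rw [re_add_two_mul_I]; exact hc)
    rw [re_add_two_mul_I] at h1
    have h2 : (c : ℂ) + 2 * β * Complex.I + 2 * ((a : ℂ) / q) * Complex.I
        = (c : ℂ) + 2 * (((a : ℝ) / q + β : ℝ) : ℂ) * Complex.I := by
      push_cast; ring
    rw [h2] at h1
    refine h1.trans ?_
    set Z := ‖(c : ℂ) + 2 * β * Complex.I‖
    -- `6 = 4 + 2`: the width contributes `4q/N² ≤ 4/N` since `q ≤ N`, the displacement contributes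
    -- `2/N`. The error `(6/N)^(3/2) N²` is then `6√6 √N`.
    have hZ : q * Z ≤ 6 / N := by
      have h3 : Z ≤ c + 2 * |β| := norm_add_two_mul_I_le hc.le β
      calc q * Z ≤ q * (4 / (N : ℝ) ^ 2 + 2 * (1 / (q * N))) := by gcongr; linarith
        _ = 4 * q / (N : ℝ) ^ 2 + 2 / N := by field_simp
        _ ≤ 4 * N / (N : ℝ) ^ 2 + 2 / N := by gcongr
        _ = 6 / N := by field_simp; norm_num
    have hsq : Real.sqrt (6 / N) = Real.sqrt 6 * Real.sqrt N / N := by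
      rw [Real.sqrt_div (by norm_num)]
      have : Real.sqrt N ^ 2 = N := Real.sq_sqrt hNR.le
      have h4 : 0 < Real.sqrt N := Real.sqrt_pos.2 hNR
      field_simp
      rw [this]
    calc C * (q * Z * Real.sqrt (q * Z)) / c
        ≤ C * (6 / N * Real.sqrt (6 / N)) / (1 / (N : ℝ) ^ 2) := by gcongr
      _ = C * (6 * Real.sqrt 6) * Real.sqrt N := by
          rw [hsq]
          field_simp
  have h1 := key (1 / (N : ℝ) ^ 2) le_rfl (by gcongr; norm_num)
  have h2 := key (4 / (N : ℝ) ^ 2) (by gcongr; norm_num) le_rfl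
  have h3 : squareSymbol N ((a : ℝ) / q + β) - quadGauss a 0 q / q * squareDensity N β
      = (thetaSeries (((1 / (N : ℝ) ^ 2 : ℝ) : ℂ) + 2 * (((a : ℝ) / q + β : ℝ) : ℂ) * Complex.I) -
        quadGauss a 0 q / q * (1 / csqrt (((1 / (N : ℝ) ^ 2 : ℝ) : ℂ) + 2 * β * Complex.I))) -
        (thetaSeries (((4 / (N : ℝ) ^ 2 : ℝ) : ℂ) + 2 * (((a : ℝ) / q + β : ℝ) : ℂ) * Complex.I) -
        quadGauss a 0 q / q * (1 / csqrt (((4 / (N : ℝ) ^ 2 : ℝ) : ℂ) + 2 * β * Complex.I))) := by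
    rw [squareSymbol, squareDensity]
    ring
  rw [h3]
  refine (norm_sub_le _ _).trans ?_
  linarith

lemma norm_one_div_csqrt_le {N : ℕ} (hN : 0 < N) {c : ℝ} (hc : 1 / (N : ℝ) ^ 2 ≤ c) (β : ℝ) :
    ‖1 / csqrt ((c : ℂ) + 2 * β * Complex.I)‖ ≤ N := by
  have hNR : (0 : ℝ) < N := by exact_mod_cast hN
  have hc0 : 0 < c := lt_of_lt_of_le (by positivity) hc
  have h1 : c ≤ ‖(c : ℂ) + 2 * β * Complex.I‖ := by
    have := Complex.abs_re_le_norm ((c : ℂ) + 2 * β * Complex.I)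
    rw [re_add_two_mul_I] at this
    exact (le_abs_self _).trans this
  rw [norm_div, norm_one, norm_csqrt]
  have h2 : 1 / (N : ℝ) ≤ Real.sqrt ‖(c : ℂ) + 2 * β * Complex.I‖ := by
    refine Real.le_sqrt_of_sq_le ?_
    rw [div_pow, one_pow]
    linarith
  calc _ ≤ 1 / (1 / (N : ℝ)) := one_div_le_one_div_of_le (by positivity) h2
    _ = N := by field_simp

lemma norm_squareDensity_le {N : ℕ} (hN : 0 < N) (β : ℝ) : ‖squareDensity N β‖ ≤ 2 * N := by
  have h1 := norm_one_div_csqrt_le hN (c := 1 / (N : ℝ) ^ 2) le_rfl β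
  have h2 := norm_one_div_csqrt_le hN (c := 4 / (N : ℝ) ^ 2) (by gcongr; norm_num) β
  refine (norm_sub_le _ _).trans ?_
  linarith

lemma continuous_squareDensity {N : ℕ} (hN : 0 < N) : Continuous (squareDensity N) := by
  have hNR : (0 : ℝ) < N := by exact_mod_cast hN
  have key : ∀ c : ℝ, 0 < c → Continuous fun β : ℝ => 1 / csqrt ((c : ℂ) + 2 * β * Complex.I) := by
    intro c hc
    have hre : ∀ β : ℝ, 0 < ((c : ℂ) + 2 * β * Complex.I).re := fun β => by
      rw [re_add_two_mul_I]; exact hc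
    refine continuous_const.div ?_ fun β => csqrt_ne_zero fun h => ?_
    · unfold csqrt
      exact Continuous.cpow (by fun_prop) continuous_const fun β => Or.inl (hre β)
    · have := hre β
      rw [h] at this
      simp at this
  exact (key _ (by positivity)).sub (key _ (by positivity))

/-- Rationalizing, `1/√z - 1/√w = (w - z)/(√z √w (√z + √w))` with `w - z = 3/N²`, and each factor of
the denominator has norm at least `|z|^(1/2)`. The resulting decay `|β|^(-3/2)` is written in the
form in which integrability of powers of `1 + x²` is available. -/
lemma norm_squareDensity_le_rpow {N : ℕ} (hN : 0 < N) (β : ℝ) :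
    ‖squareDensity N β‖ ≤ 3 * N * (1 + ‖(N : ℝ) ^ 2 * β‖ ^ 2) ^ (-(3 / 2 : ℝ) / 2) := by
  have hNR : (0 : ℝ) < N := by exact_mod_cast hN
  set z : ℂ := ((1 / (N : ℝ) ^ 2 : ℝ) : ℂ) + 2 * β * Complex.I with hz
  set w : ℂ := ((4 / (N : ℝ) ^ 2 : ℝ) : ℂ) + 2 * β * Complex.I with hw
  have hzre : 0 < z.re := by rw [hz, re_add_two_mul_I]; positivity
  have hwre : 0 < w.re := by rw [hw, re_add_two_mul_I]; positivity
  have hz0 : z ≠ 0 := by intro h; rw [h] at hzre; simp at hzre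
  have hw0 : w ≠ 0 := by intro h; rw [h] at hwre; simp at hwre
  have hzw : ‖z‖ ≤ ‖w‖ := by
    refine le_of_sq_le_sq ?_ (norm_nonneg _)
    rw [hz, hw, norm_add_two_mul_I_sq, norm_add_two_mul_I_sq]
    gcongr
    norm_num
  have hsz := csqrt_ne_zero hz0
  have hsw := csqrt_ne_zero hw0
  have hnz : 0 < ‖csqrt z‖ := norm_pos_iff.2 hsz
  have hadd := norm_csqrt_le_norm_add hzre hwre
  have hadd0 : csqrt z + csqrt w ≠ 0 := norm_pos_iff.1 (hnz.trans_le hadd)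
  have hle : ‖csqrt z‖ ≤ ‖csqrt w‖ := by
    rw [norm_csqrt, norm_csqrt]; exact Real.sqrt_le_sqrt hzw
  have h1 : squareDensity N β = (w - z) / (csqrt z * csqrt w * (csqrt z + csqrt w)) := by
    rw [squareDensity, ← hz, ← hw]
    rw [div_sub_div _ _ hsz hsw, div_eq_div_iff (mul_ne_zero hsz hsw)
      (mul_ne_zero (mul_ne_zero hsz hsw) hadd0)]
    linear_combination (csqrt z * csqrt w) * csqrt_sq w - (csqrt z * csqrt w) * csqrt_sq z
  have h2 : ‖w - z‖ = 3 / (N : ℝ) ^ 2 := by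
    have : w - z = ((3 / (N : ℝ) ^ 2 : ℝ) : ℂ) := by
      rw [hz, hw]; push_cast; ring
    rw [this, Complex.norm_real, Real.norm_of_nonneg (by positivity)]
  have h3 : ‖squareDensity N β‖ ≤ 3 / (N : ℝ) ^ 2 / ‖csqrt z‖ ^ 3 := by
    rw [h1, norm_div, h2, norm_mul, norm_mul]
    gcongr
    calc ‖csqrt z‖ ^ 3 = ‖csqrt z‖ * ‖csqrt z‖ * ‖csqrt z‖ := by ring
      _ ≤ _ := by gcongr
  refine h3.trans ?_
  set T : ℝ := 1 + ‖(N : ℝ) ^ 2 * β‖ ^ 2 with hT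
  have hTpos : 0 < T := by positivity
  have h4 : T / (N : ℝ) ^ 4 ≤ ‖csqrt z‖ ^ 4 := by
    rw [show ‖csqrt z‖ ^ 4 = (‖csqrt z‖ ^ 2) ^ 2 by ring, norm_csqrt_sq, hz,
      norm_add_two_mul_I_sq, hT, Real.norm_eq_abs, sq_abs]
    rw [div_le_iff₀ (by positivity)]
    have : (((1 / (N : ℝ) ^ 2) ^ 2 + 4 * β ^ 2) * (N : ℝ) ^ 4) = 1 + 4 * ((N : ℝ) ^ 2 * β) ^ 2 := by
      field_simp
    rw [this]
    nlinarith [sq_nonneg ((N : ℝ) ^ 2 * β)]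
  have h5 : (T / (N : ℝ) ^ 4) ^ (3 / 4 : ℝ) ≤ ‖csqrt z‖ ^ 3 := by
    calc (T / (N : ℝ) ^ 4) ^ (3 / 4 : ℝ) ≤ (‖csqrt z‖ ^ 4) ^ (3 / 4 : ℝ) :=
          Real.rpow_le_rpow (by positivity) h4 (by norm_num)
      _ = ‖csqrt z‖ ^ 3 := by
          rw [← Real.rpow_natCast, ← Real.rpow_mul hnz.le, ← Real.rpow_natCast]
          norm_num
  have h6 : (T / (N : ℝ) ^ 4) ^ (3 / 4 : ℝ) = T ^ (3 / 4 : ℝ) / (N : ℝ) ^ 3 := by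
    rw [Real.div_rpow hTpos.le (by positivity)]
    congr 1
    rw [← Real.rpow_natCast, ← Real.rpow_mul hNR.le, ← Real.rpow_natCast]
    norm_num
  rw [h6] at h5
  have hT34 : 0 < T ^ (3 / 4 : ℝ) := Real.rpow_pos_of_pos hTpos _
  calc 3 / (N : ℝ) ^ 2 / ‖csqrt z‖ ^ 3 ≤ 3 / (N : ℝ) ^ 2 / (T ^ (3 / 4 : ℝ) / (N : ℝ) ^ 3) := by
        gcongr
    _ = 3 * N * (T ^ (3 / 4 : ℝ))⁻¹ := by field_simp
    _ = _ := by rw [← Real.rpow_neg hTpos.le]; norm_num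

/-- The pointwise bound has height `N` and width `N⁻²`, so its integral is `O(1/N)` whatever the
cutoff `δ`. -/
lemma exists_integral_squareDensity_le : ∃ C : ℝ, 0 < C ∧ ∀ N : ℕ, 0 < N → ∀ δ : ℝ, 0 ≤ δ →
    ∫ β in (-δ)..δ, ‖squareDensity N β‖ ≤ C / N := by
  set g : ℝ → ℝ := fun x => (1 + ‖x‖ ^ 2) ^ (-(3 / 2 : ℝ) / 2) with hg
  have hgint : MeasureTheory.Integrable g :=
    integrable_rpow_neg_one_add_norm_sq (by simp; norm_num)
  have hg0 : ∀ x, 0 ≤ g x := fun x => by positivity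
  have hI : 0 ≤ ∫ x, g x := MeasureTheory.integral_nonneg hg0
  refine ⟨3 * (∫ x, g x) + 1, by positivity, fun N hN δ hδ => ?_⟩
  have hNR : (0 : ℝ) < N := by exact_mod_cast hN
  have hN2 : (N : ℝ) ^ 2 ≠ 0 := by positivity
  have hint2 : MeasureTheory.Integrable fun β => 3 * (N : ℝ) * g ((N : ℝ) ^ 2 * β) :=
    (hgint.comp_mul_left' hN2).const_mul _
  rw [intervalIntegral.integral_of_le (by linarith)]
  calc ∫ β in Set.Ioc (-δ) δ, ‖squareDensity N β‖
      ≤ ∫ β in Set.Ioc (-δ) δ, 3 * (N : ℝ) * g ((N : ℝ) ^ 2 * β) := by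
        refine MeasureTheory.integral_mono_of_nonneg (Filter.Eventually.of_forall fun _ =>
          norm_nonneg _) hint2.integrableOn (Filter.Eventually.of_forall fun β => ?_)
        exact norm_squareDensity_le_rpow hN β
    _ ≤ ∫ β, 3 * (N : ℝ) * g ((N : ℝ) ^ 2 * β) := by
        refine MeasureTheory.setIntegral_le_integral hint2 (Filter.Eventually.of_forall fun β => ?_)
        have := hg0 ((N : ℝ) ^ 2 * β)
        positivity
    _ = 3 * (∫ x, g x) / N := by
        rw [MeasureTheory.integral_const_mul, MeasureTheory.Measure.integral_comp_mul_left g,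
          abs_of_nonneg (by positivity), smul_eq_mul]
        field_simp
    _ ≤ _ := by gcongr; linarith

/-! ### Square roots modulo `d` and the singular series -/

/-- The number of square roots of `x` modulo `d`. -/
noncomputable def sqrtCount (d : ℕ) (x : ℤ) : ℕ :=
  ((Finset.range d).filter fun r : ℕ => (d : ℤ) ∣ x - (r : ℤ) ^ 2).card

/-- Two solutions differ by a multiple of `lcm(u, v)`, and `uv = gcd(u, v) · lcm(u, v)`. -/
lemma card_filter_dvd_dvd_le {u v : ℕ} (hu : 0 < u) (hv : 0 < v) (m : ℤ) :
    ((Finset.range (u * v)).filter fun r : ℕ => (u : ℤ) ∣ r ∧ (v : ℤ) ∣ r + m).card ≤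
      Nat.gcd u v := by
  set l := Nat.lcm u v with hl
  have hlpos : 0 < l := Nat.lcm_pos hu hv
  have hgl : Nat.gcd u v * l = u * v := Nat.gcd_mul_lcm u v
  have hinj : Set.InjOn (fun r : ℕ => r / l)
      ((Finset.range (u * v)).filter fun r : ℕ => (u : ℤ) ∣ r ∧ (v : ℤ) ∣ r + m) := by
    intro r hr s hs hrs
    simp only [Finset.coe_filter, Finset.mem_range, Set.mem_ofPred_eq] at hr hs
    have h1 : (u : ℤ) ∣ (r : ℤ) - s := dvd_sub hr.2.1 hs.2.1
    have h2 : (v : ℤ) ∣ (r : ℤ) - s := by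
      have := dvd_sub hr.2.2 hs.2.2
      rwa [add_sub_add_right_eq_sub] at this
    have h3 : r ≡ s [MOD l] := by
      rw [Nat.modEq_iff_dvd]
      have h4 : ((l : ℕ) : ℤ) ∣ (r : ℤ) - s := by
        rw [Int.natCast_dvd]
        exact Nat.lcm_dvd (Int.natCast_dvd.1 h1) (Int.natCast_dvd.1 h2)
      rwa [← dvd_neg, neg_sub]
    have h4 : r % l = s % l := h3
    have h5 : r / l = s / l := hrs
    rw [← Nat.div_add_mod r l, ← Nat.div_add_mod s l, h4, h5]
  calc _ ≤ (Finset.range (Nat.gcd u v)).card := by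
        refine Finset.card_le_card_of_injOn _ (fun r hr => ?_) hinj
        simp only [Finset.coe_filter, Finset.mem_range, Set.mem_ofPred_eq] at hr
        simp only [Finset.coe_range, Set.mem_Iio]
        rw [Nat.div_lt_iff_lt_mul hlpos, hgl]
        exact hr.1
    _ = _ := Finset.card_range _

/-- The number of square roots of `x` modulo `d` is bounded independently of `x`. -/
lemma sqrtCount_le {d : ℕ} (hd : 0 < d) (x : ℤ) :
    sqrtCount d x ≤ ∑ u ∈ d.divisors, Nat.gcd u (d / u) := by
  rw [sqrtCount]
  rcases Finset.eq_empty_or_nonempty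
    ((Finset.range d).filter fun r : ℕ => (d : ℤ) ∣ x - (r : ℤ) ^ 2) with h | ⟨s, hs⟩
  · rw [h]; simp
  · have hs2 := (Finset.mem_filter.1 hs).2
    have hdZ : (d : ℤ) ≠ 0 := by exact_mod_cast hd.ne'
    -- Relative to a fixed root `s`, every root is `s + t` with `d ∣ t(t + 2s)`; `T u` collects the
    -- `t` for which `u` divides the first factor and `d/u` the second.
    set T : ℕ → Finset ℕ := fun u => (Finset.range d).filter fun r : ℕ =>
      (u : ℤ) ∣ r ∧ ((d / u : ℕ) : ℤ) ∣ r + 2 * s with hT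
    have hinj : Set.InjOn (fun r : ℕ => (((r : ℤ) - s) % d).toNat)
        ((Finset.range d).filter fun r : ℕ => (d : ℤ) ∣ x - (r : ℤ) ^ 2) := by
      intro r hr r' hr' h
      simp only [Finset.coe_filter, Finset.mem_range, Set.mem_ofPred_eq] at hr hr'
      have h1 := Int.emod_nonneg ((r : ℤ) - s) hdZ
      have h2 := Int.emod_nonneg ((r' : ℤ) - s) hdZ
      have h3 : ((r : ℤ) - s) % d = ((r' : ℤ) - s) % d := by
        have : (((r : ℤ) - s) % d).toNat = (((r' : ℤ) - s) % d).toNat := h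
        omega
      have h4 : (d : ℤ) ∣ (r : ℤ) - r' := by
        have h5 : (r' : ℤ) - s ≡ r - s [ZMOD d] := h3.symm
        have := h5.dvd
        rwa [sub_sub_sub_cancel_right] at this
      obtain ⟨c, hc⟩ := h4
      have hc0 : c = 0 := by
        have hr1 := hr.1
        have hr2 := hr'.1
        by_contra hne
        rcases lt_or_gt_of_ne hne with h6 | h6
        · nlinarith
        · nlinarith
      rw [hc0] at hc
      omega
    have hmaps : ∀ r ∈ ((Finset.range d).filter fun r : ℕ => (d : ℤ) ∣ x - (r : ℤ) ^ 2),
        (((r : ℤ) - s) % d).toNat ∈ d.divisors.biUnion T := by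
      intro r hr
      have hr2 := (Finset.mem_filter.1 hr).2
      set t : ℕ := (((r : ℤ) - s) % d).toNat with ht
      have h1 := Int.emod_nonneg ((r : ℤ) - s) hdZ
      have h1' := Int.emod_lt_of_pos ((r : ℤ) - s) (by exact_mod_cast hd : (0 : ℤ) < d)
      have htZ : (t : ℤ) = ((r : ℤ) - s) % d := by omega
      have htd : (d : ℤ) ∣ (r : ℤ) - s - t := by
        rw [htZ]; exact Int.dvd_self_sub_emod
      have h2 : (d : ℤ) ∣ (t : ℤ) * (t + 2 * s) := by
        obtain ⟨c, hc⟩ := htd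
        have h3 : (d : ℤ) ∣ (r : ℤ) ^ 2 - (s : ℤ) ^ 2 := by
          have := dvd_sub hs2 hr2
          rwa [sub_sub_sub_cancel_left] at this
        have h4 : (t : ℤ) * (t + 2 * s) = ((r : ℤ) ^ 2 - (s : ℤ) ^ 2) - d * (c * (r + s + t)) := by
          have : (t : ℤ) = r - s - d * c := by linarith
          rw [this]; ring
        rw [h4]
        exact dvd_sub h3 (dvd_mul_right _ _)
      have h2' : d ∣ t * (t + 2 * s) := by exact_mod_cast h2
      -- The choice `u = gcd(d, t)` works: `d/u` is coprime to `t/u`, hence divides `t + 2s`.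
      refine Finset.mem_biUnion.2 ⟨Nat.gcd d t, Nat.mem_divisors.2 ⟨Nat.gcd_dvd_left _ _, hd.ne'⟩, ?_⟩
      simp only [hT, Finset.mem_filter, Finset.mem_range]
      refine ⟨by omega, by exact_mod_cast Nat.gcd_dvd_right d t, ?_⟩
      have hg : 0 < Nat.gcd d t := Nat.gcd_pos_of_pos_left _ hd
      have h5 : d / Nat.gcd d t ∣ t / Nat.gcd d t * (t + 2 * s) := by
        refine Nat.dvd_of_mul_dvd_mul_left hg ?_
        rw [Nat.mul_div_cancel' (Nat.gcd_dvd_left d t), ← mul_assoc,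
          Nat.mul_div_cancel' (Nat.gcd_dvd_right d t)]
        exact h2'
      have h6 := (Nat.coprime_div_gcd_div_gcd hg).dvd_of_dvd_mul_left h5
      exact_mod_cast h6
    calc _ ≤ (d.divisors.biUnion T).card := Finset.card_le_card_of_injOn _ hmaps hinj
      _ ≤ ∑ u ∈ d.divisors, (T u).card := Finset.card_biUnion_le
      _ ≤ _ := by
          refine Finset.sum_le_sum fun u hu => ?_
          have hud := Nat.dvd_of_mem_divisors hu
          have hu0 : 0 < u := Nat.pos_of_dvd_of_pos hud hd
          have := card_filter_dvd_dvd_le hu0 (Nat.div_pos (Nat.le_of_dvd hd hud) hu0) (2 * s)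
          rwa [Nat.mul_div_cancel' hud] at this

/-- The singular series coefficient at denominator `q`. -/
noncomputable def singularCoeff (q : ℕ) (x : ℤ) : ℂ :=
  ∑ a ∈ (Finset.Icc 1 q).filter (fun a : ℕ => Nat.Coprime a q),
    quadGauss a 0 q / q * unitExp ((a : ℝ) / q * x)

/-- Ramanujan sums in terms of the Möbius function. -/
lemma sum_coprime_unitExp {q : ℕ} (hq : 0 < q) (m : ℤ) :
    ∑ a ∈ (Finset.Icc 1 q).filter (fun a : ℕ => Nat.Coprime a q), unitExp ((a : ℝ) * m / q) =
      ∑ e ∈ q.divisors, (ArithmeticFunction.moebius e : ℂ) *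
        (if ((q / e : ℕ) : ℤ) ∣ m then ((q / e : ℕ) : ℂ) else 0) := by
  have hmob : ∀ n : ℕ, 0 < n → ∑ e ∈ n.divisors, (ArithmeticFunction.moebius e : ℂ)
      = if n = 1 then 1 else 0 := by
    intro n hn
    have h := congrArg (fun f : ArithmeticFunction ℂ => f n)
      (ArithmeticFunction.coe_moebius_mul_coe_zeta (R := ℂ))
    simp only [ArithmeticFunction.one_apply] at h
    rw [ArithmeticFunction.coe_mul_zeta_apply] at h
    simpa using h
  -- Coprimality is detected by `∑ μ(e)` over the common divisors `e` of `a` and `q`.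
  have h1 : ∀ a ∈ Finset.Icc 1 q, (if Nat.Coprime a q then unitExp ((a : ℝ) * m / q) else 0)
      = ∑ e ∈ q.divisors, if e ∣ a then
          (ArithmeticFunction.moebius e : ℂ) * unitExp ((a : ℝ) * m / q) else 0 := by
    intro a _
    have h2 : q.divisors.filter (fun e => e ∣ a) = (Nat.gcd a q).divisors := by
      ext e
      simp only [Finset.mem_filter, Nat.mem_divisors, Nat.dvd_gcd_iff]
      have : Nat.gcd a q ≠ 0 := (Nat.gcd_pos_of_pos_right _ hq).ne'
      have := hq.ne'
      tauto
    rw [← Finset.sum_filter, h2, ← Finset.sum_mul, hmob _ (Nat.gcd_pos_of_pos_right _ hq)]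
    simp [Nat.Coprime]
  rw [Finset.sum_filter, Finset.sum_congr rfl h1, Finset.sum_comm]
  refine Finset.sum_congr rfl fun e he => ?_
  have hed := Nat.dvd_of_mem_divisors he
  have he0 : 0 < e := Nat.pos_of_dvd_of_pos hed hq
  obtain ⟨d, rfl⟩ := hed
  have hd0 : 0 < d := Nat.pos_of_mul_pos_left hq
  rw [Nat.mul_div_cancel_left _ he0, ← sum_unitExp_div hd0 m, Finset.mul_sum, ← Finset.sum_filter]
  -- Periodicity moves the residues `0, …, d - 1` to `1, …, d`, matching the multiples `e(b + 1)` of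
  -- `e` in `[1, q]`.
  have hshift : ∑ b ∈ Finset.range d, (ArithmeticFunction.moebius e : ℂ) *
      unitExp ((b : ℝ) * m / d) = ∑ b ∈ Finset.range d, (ArithmeticFunction.moebius e : ℂ) *
      unitExp (((b + 1 : ℕ) : ℝ) * m / d) := by
    rw [← Finset.mul_sum, ← Finset.mul_sum]
    congr 1
    have hdR : (d : ℝ) ≠ 0 := by positivity
    have h3 : ∀ b : ℕ, unitExp ((b : ℝ) * m / d) = unitExp ((((b : ℤ) * m : ℤ) : ℝ) / d) := by
      intro b; push_cast; rfl
    simp_rw [h3]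
    rw [← sum_range_periodic_add (fun r => unitExp (((r * m : ℤ) : ℝ) / d))
      (fun x y h => unitExp_div_congr hd0 (by rw [← sub_mul]; exact h.mul_right _)) 1]
    rfl
  rw [hshift]
  symm
  refine Finset.sum_nbij (fun b => e * (b + 1)) ?_ ?_ ?_ ?_
  · intro b hb
    rw [Finset.mem_range] at hb
    simp only [Finset.mem_filter, Finset.mem_Icc]
    refine ⟨⟨Nat.mul_pos he0 (Nat.succ_pos _), Nat.mul_le_mul_left _ hb⟩, dvd_mul_right _ _⟩
  · intro b _ b' _ h
    have := Nat.eq_of_mul_eq_mul_left he0 h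
    omega
  · intro a ha
    simp only [Finset.coe_filter, Finset.mem_Icc, Set.mem_ofPred_eq] at ha
    obtain ⟨⟨ha1, ha2⟩, c, rfl⟩ := ha
    have hc : 0 < c := Nat.pos_of_mul_pos_left ha1
    have hcd : c ≤ d := Nat.le_of_mul_le_mul_left ha2 he0
    refine ⟨c - 1, ?_, ?_⟩
    · simp only [Finset.coe_range, Set.mem_Iio]; omega
    · show e * (c - 1 + 1) = e * c
      rw [Nat.sub_add_cancel hc]
  · intro b _
    congr 2
    have hdR : (d : ℝ) ≠ 0 := by positivity
    have heR : (e : ℝ) ≠ 0 := by positivity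
    push_cast
    field_simp

lemma card_filter_dvd_sub_sq {d e : ℕ} (hd : 0 < d) (x : ℤ) :
    ((Finset.range (e * d)).filter fun r : ℕ => (d : ℤ) ∣ x - (r : ℤ) ^ 2).card
      ≤ e * sqrtCount d x := by
  have h : ((Finset.range (e * d)).filter fun r : ℕ => (d : ℤ) ∣ x - (r : ℤ) ^ 2).card
      ≤ ((Finset.range e) ×ˢ
        ((Finset.range d).filter fun r : ℕ => (d : ℤ) ∣ x - (r : ℤ) ^ 2)).card := by
    refine Finset.card_le_card_of_injOn (fun r => (r / d, r % d)) ?_ ?_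
    · intro r hr
      simp only [Finset.coe_filter, Finset.mem_range, Set.mem_ofPred_eq] at hr
      simp only [Finset.coe_product, Finset.coe_filter, Finset.mem_range, Set.mem_prod,
        Finset.coe_range, Set.mem_Iio, Set.mem_ofPred_eq]
      refine ⟨(Nat.div_lt_iff_lt_mul hd).2 hr.1, Nat.mod_lt _ hd, ?_⟩
      have h1 : (r : ℤ) = d * (r / d : ℕ) + (r % d : ℕ) := by
        exact_mod_cast (Nat.div_add_mod r d).symm
      have h2 : x - ((r % d : ℕ) : ℤ) ^ 2 = (x - (r : ℤ) ^ 2)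
          + d * ((r / d : ℕ) * (r + (r % d : ℕ))) := by
        linear_combination ((r : ℤ) + (r % d : ℕ)) * h1
      rw [h2]
      exact dvd_add hr.2 (dvd_mul_right _ _)
    · intro r _ r' _ h
      simp only [Prod.mk.injEq] at h
      rw [← Nat.div_add_mod r d, ← Nat.div_add_mod r' d, h.1, h.2]
  rw [Finset.card_product, Finset.card_range] at h
  exact h

/-- Opening the Gauss sum and summing over `a` first gives Ramanujan sums in `x - r²`. With `q =
ed`, the divisor `e` contributes at most `d/q` times the number of `r` modulo `q` with `d ∣ x - r²`,
which is at most `e · sqrtCount d x`; the factors cancel. -/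
lemma norm_singularCoeff_le {q : ℕ} (hq : 0 < q) (x : ℤ) :
    ‖singularCoeff q x‖ ≤ ∑ d ∈ q.divisors, (sqrtCount d x : ℝ) := by
  have hqR : (0 : ℝ) < q := by exact_mod_cast hq
  have h1 : singularCoeff q x = (1 / (q : ℂ)) * ∑ e ∈ q.divisors,
      ∑ r ∈ Finset.range q, (ArithmeticFunction.moebius e : ℂ) *
        (if ((q / e : ℕ) : ℤ) ∣ x - (r : ℤ) ^ 2 then ((q / e : ℕ) : ℂ) else 0) := by
    rw [Finset.sum_comm]
    simp_rw [← sum_coprime_unitExp hq]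
    rw [singularCoeff, Finset.sum_comm, Finset.mul_sum]
    refine Finset.sum_congr rfl fun a _ => ?_
    rw [quadGauss, Finset.sum_div, Finset.sum_mul, Finset.mul_sum]
    refine Finset.sum_congr rfl fun r _ => ?_
    rw [div_mul_eq_mul_div, ← unitExp_add, one_div, div_eq_inv_mul]
    congr 2
    push_cast
    field_simp
    ring
  rw [h1, norm_mul, ← Nat.sum_div_divisors q (fun d => (sqrtCount d x : ℝ))]
  have h2 : ‖(1 / (q : ℂ))‖ = 1 / q := by simp
  rw [h2, one_div, inv_mul_le_iff₀ hqR, Finset.mul_sum]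
  refine (norm_sum_le _ _).trans (Finset.sum_le_sum fun e he => ?_)
  have hed := Nat.dvd_of_mem_divisors he
  have he0 : 0 < e := Nat.pos_of_dvd_of_pos hed hq
  obtain ⟨d, rfl⟩ := hed
  have hd0 : 0 < d := Nat.pos_of_mul_pos_left hq
  rw [Nat.mul_div_cancel_left _ he0]
  refine (norm_sum_le _ _).trans ?_
  have hmu : ‖(ArithmeticFunction.moebius e : ℂ)‖ ≤ 1 := by
    rcases ArithmeticFunction.moebius_eq_or e with h | h | h <;> simp [h]
  have h3 : ∀ r ∈ Finset.range (e * d), ‖(ArithmeticFunction.moebius e : ℂ) *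
        (if (d : ℤ) ∣ x - (r : ℤ) ^ 2 then (d : ℂ) else 0)‖ ≤
        if (d : ℤ) ∣ x - (r : ℤ) ^ 2 then (d : ℝ) else 0 := by
    intro r _
    rw [norm_mul]
    split_ifs
    · simpa using mul_le_mul_of_nonneg_right hmu (Nat.cast_nonneg (α := ℝ) d)
    · simp
  refine (Finset.sum_le_sum h3).trans ?_
  rw [← Finset.sum_filter, Finset.sum_const, nsmul_eq_mul]
  have h4 : (((Finset.range (e * d)).filter fun r : ℕ => (d : ℤ) ∣ x - (r : ℤ) ^ 2).card : ℝ)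
      ≤ e * sqrtCount d x := by exact_mod_cast card_filter_dvd_sub_sq hd0 x
  calc _ ≤ (e * sqrtCount d x : ℝ) * d := by gcongr
    _ = _ := by push_cast; ring

lemma sum_inv_multiples_le {g : ℕ} (hg : 0 < g) (Q : ℕ) :
    ∑ u ∈ (Finset.Icc 1 Q).filter (fun u => g ∣ u), (1 / (u : ℝ)) ≤
      1 / g * ∑ u ∈ Finset.Icc 1 Q, (1 / (u : ℝ)) := by
  have hsub : (Finset.Icc 1 Q).filter (fun u => g ∣ u) ⊆ (Finset.Icc 1 Q).image (fun u => g * u) := by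
    intro u hu
    simp only [Finset.mem_filter, Finset.mem_Icc] at hu
    obtain ⟨⟨h1, h2⟩, c, rfl⟩ := hu
    exact Finset.mem_image.2 ⟨c, Finset.mem_Icc.2 ⟨Nat.pos_of_mul_pos_left h1,
      (Nat.le_mul_of_pos_left c hg).trans h2⟩, rfl⟩
  calc _ ≤ ∑ u ∈ (Finset.Icc 1 Q).image (fun u => g * u), (1 / (u : ℝ)) :=
        Finset.sum_le_sum_of_subset_of_nonneg hsub fun _ _ _ => by positivity
    _ = ∑ u ∈ Finset.Icc 1 Q, (1 / ((g * u : ℕ) : ℝ)) :=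
        Finset.sum_image fun a _ b _ h => Nat.eq_of_mul_eq_mul_left hg h
    _ = _ := by
        rw [Finset.mul_sum]
        refine Finset.sum_congr rfl fun u _ => ?_
        push_cast
        rw [one_div_mul_one_div]

/-- Bound `gcd(u, v)` by the sum of all `g` dividing both `u` and `v`. The sums over `u` and `v`
separate, each is at most `H/g`, and `∑ g (H/g)² = H³`. -/
lemma sum_gcd_div_mul_le (Q : ℕ) :
    ∑ u ∈ Finset.Icc 1 Q, ∑ v ∈ Finset.Icc 1 Q, (Nat.gcd u v : ℝ) / (u * v) ≤
      (∑ u ∈ Finset.Icc 1 Q, (1 / (u : ℝ))) ^ 3 := by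
  set H := ∑ u ∈ Finset.Icc 1 Q, (1 / (u : ℝ)) with hH
  have hH0 : 0 ≤ H := Finset.sum_nonneg fun _ _ => by positivity
  have h1 : ∀ u ∈ Finset.Icc 1 Q, ∀ v ∈ Finset.Icc 1 Q, (Nat.gcd u v : ℝ) / (u * v) ≤
      ∑ g ∈ Finset.Icc 1 Q, (g : ℝ) * ((if g ∣ u then 1 / (u : ℝ) else 0) *
        (if g ∣ v then 1 / (v : ℝ) else 0)) := by
    intro u hu v hv
    rw [Finset.mem_Icc] at hu hv
    have hmem : Nat.gcd u v ∈ Finset.Icc 1 Q := Finset.mem_Icc.2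
      ⟨Nat.gcd_pos_of_pos_left _ hu.1, (Nat.gcd_le_left _ hu.1).trans hu.2⟩
    refine le_trans (le_of_eq ?_) (Finset.single_le_sum (f := fun g : ℕ => (g : ℝ) *
      ((if g ∣ u then 1 / (u : ℝ) else 0) * (if g ∣ v then 1 / (v : ℝ) else 0)))
      (fun g _ => by positivity) hmem)
    simp only [Nat.gcd_dvd_left, Nat.gcd_dvd_right, if_true]
    rw [one_div_mul_one_div, mul_one_div]
  calc _ ≤ ∑ u ∈ Finset.Icc 1 Q, ∑ v ∈ Finset.Icc 1 Q, ∑ g ∈ Finset.Icc 1 Q,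
        (g : ℝ) * ((if g ∣ u then 1 / (u : ℝ) else 0) * (if g ∣ v then 1 / (v : ℝ) else 0)) :=
        Finset.sum_le_sum fun u hu => Finset.sum_le_sum fun v hv => h1 u hu v hv
    _ = ∑ g ∈ Finset.Icc 1 Q, (g : ℝ) *
        (∑ u ∈ (Finset.Icc 1 Q).filter (fun u => g ∣ u), (1 / (u : ℝ))) ^ 2 := by
        rw [Finset.sum_congr rfl fun u _ => Finset.sum_comm, Finset.sum_comm]
        refine Finset.sum_congr rfl fun g _ => ?_
        rw [sq, Finset.sum_filter, Finset.sum_mul_sum, Finset.mul_sum]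
        exact Finset.sum_congr rfl fun u _ => (Finset.mul_sum _ _ _).symm
    _ ≤ ∑ g ∈ Finset.Icc 1 Q, (1 / (g : ℝ)) * H ^ 2 := by
        refine Finset.sum_le_sum fun g hg => ?_
        have hg0 : 0 < g := (Finset.mem_Icc.1 hg).1
        have hgR : (0 : ℝ) < g := by exact_mod_cast hg0
        have h2 := sum_inv_multiples_le hg0 Q
        have h3 : 0 ≤ ∑ u ∈ (Finset.Icc 1 Q).filter (fun u => g ∣ u), (1 / (u : ℝ)) :=
          Finset.sum_nonneg fun _ _ => by positivity
        calc _ ≤ (g : ℝ) * (1 / g * H) ^ 2 := by gcongr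
          _ = _ := by field_simp
    _ = H ^ 3 := by rw [← Finset.sum_mul, ← hH]; ring

lemma sum_sqrtCount_div_le (Q : ℕ) (x : ℤ) :
    ∑ d ∈ Finset.Icc 1 Q, (sqrtCount d x : ℝ) / d ≤
      (∑ u ∈ Finset.Icc 1 Q, (1 / (u : ℝ))) ^ 3 := by
  refine le_trans ?_ (sum_gcd_div_mul_le Q)
  have h1 : ∀ d ∈ Finset.Icc 1 Q, (sqrtCount d x : ℝ) / d ≤
      ∑ u ∈ Finset.Icc 1 Q, ∑ v ∈ Finset.Icc 1 Q,
        if u * v = d then (Nat.gcd u v : ℝ) / (u * v) else 0 := by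
    intro d hd
    rw [Finset.mem_Icc] at hd
    have h2 : (sqrtCount d x : ℝ) ≤ ∑ u ∈ d.divisors, (Nat.gcd u (d / u) : ℝ) := by
      exact_mod_cast sqrtCount_le hd.1 x
    rw [← Nat.sum_divisorsAntidiagonal (fun u v => (Nat.gcd u v : ℝ))] at h2
    rw [← Finset.sum_product', ← Finset.sum_filter]
    have h3 : ((Finset.Icc 1 Q ×ˢ Finset.Icc 1 Q).filter fun p => p.1 * p.2 = d)
        = d.divisorsAntidiagonal := by
      ext ⟨u, v⟩
      simp only [Finset.mem_filter, Finset.mem_product, Finset.mem_Icc,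
        Nat.mem_divisorsAntidiagonal]
      constructor
      · rintro ⟨-, h⟩
        exact ⟨h, by omega⟩
      · rintro ⟨rfl, h⟩
        have hu : 0 < u := Nat.pos_of_mul_pos_right hd.1
        have hv : 0 < v := Nat.pos_of_mul_pos_left hd.1
        exact ⟨⟨⟨hu, (Nat.le_mul_of_pos_right u hv).trans hd.2⟩,
          ⟨hv, (Nat.le_mul_of_pos_left v hu).trans hd.2⟩⟩, rfl⟩
    rw [h3]
    have h4 : ∀ p ∈ d.divisorsAntidiagonal, (Nat.gcd p.1 p.2 : ℝ) / (p.1 * p.2)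
        = (Nat.gcd p.1 p.2 : ℝ) / d := by
      intro p hp
      rw [← (Nat.mem_divisorsAntidiagonal.1 hp).1]
      push_cast
      rfl
    rw [Finset.sum_congr rfl h4, ← Finset.sum_div]
    gcongr
  refine (Finset.sum_le_sum h1).trans ?_
  rw [Finset.sum_comm]
  refine Finset.sum_le_sum fun u _ => ?_
  rw [Finset.sum_comm]
  refine Finset.sum_le_sum fun v _ => ?_
  rw [Finset.sum_ite_eq]
  split_ifs
  · exact le_rfl
  · positivity

/-- Interchange the sums over `q` and `d ∣ q`: each `d` divides at most `Q/d` of the `q ≤ Q`.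
Averaging over `q` is what keeps the loss to a power of a logarithm. -/
lemma sum_norm_singularCoeff_le (Q : ℕ) (x : ℤ) :
    ∑ q ∈ Finset.Icc 1 Q, ‖singularCoeff q x‖ ≤
      Q * (∑ u ∈ Finset.Icc 1 Q, (1 / (u : ℝ))) ^ 3 := by
  have h1 : ∀ q ∈ Finset.Icc 1 Q, ‖singularCoeff q x‖ ≤
      ∑ d ∈ Finset.Icc 1 Q, if d ∣ q then (sqrtCount d x : ℝ) else 0 := by
    intro q hq
    rw [Finset.mem_Icc] at hq
    refine (norm_singularCoeff_le hq.1 x).trans ?_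
    rw [← Finset.sum_filter]
    refine Finset.sum_le_sum_of_subset_of_nonneg (fun d hd => ?_) fun _ _ _ => by positivity
    have hdq := Nat.dvd_of_mem_divisors hd
    exact Finset.mem_filter.2 ⟨Finset.mem_Icc.2 ⟨Nat.pos_of_dvd_of_pos hdq hq.1,
      (Nat.le_of_dvd hq.1 hdq).trans hq.2⟩, hdq⟩
  refine (Finset.sum_le_sum h1).trans ?_
  rw [Finset.sum_comm]
  calc _ ≤ ∑ d ∈ Finset.Icc 1 Q, (Q : ℝ) * ((sqrtCount d x : ℝ) / d) := by
        refine Finset.sum_le_sum fun d hd => ?_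
        rw [← Finset.sum_filter, Finset.sum_const, nsmul_eq_mul]
        have h2 : ((Finset.Icc 1 Q).filter fun q => d ∣ q).card = Q / d := by
          have := Nat.Ioc_filter_dvd_card_eq_div Q d
          rwa [← Finset.Icc_succ_left_eq_Ioc] at this
        rw [h2]
        have h3 : ((Q / d : ℕ) : ℝ) ≤ (Q : ℝ) / d := Nat.cast_div_le
        calc _ ≤ (Q : ℝ) / d * (sqrtCount d x : ℝ) := by gcongr
          _ = _ := by ring
    _ = Q * ∑ d ∈ Finset.Icc 1 Q, (sqrtCount d x : ℝ) / d := by rw [Finset.mul_sum]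
    _ ≤ _ := by gcongr; exact sum_sqrtCount_div_le Q x

lemma exists_sum_norm_singularCoeff_le {ε : ℝ} (hε : 0 < ε) : ∃ C : ℝ, 0 < C ∧ ∀ Q : ℕ, 1 ≤ Q →
    ∀ x : ℤ, ∑ q ∈ Finset.Icc 1 Q, ‖singularCoeff q x‖ ≤ C * (Q : ℝ) ^ (1 + ε) := by
  refine ⟨(1 + 1 / (ε / 3)) ^ 3, by positivity, fun Q hQ x => ?_⟩
  have hQR : (1 : ℝ) ≤ Q := by exact_mod_cast hQ
  refine (sum_norm_singularCoeff_le Q x).trans ?_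
  have h1 : ∑ u ∈ Finset.Icc 1 Q, (1 / (u : ℝ)) ≤ 1 + Real.log Q := by
    have := harmonic_le_one_add_log Q
    rw [harmonic_eq_sum_Icc] at this
    push_cast at this
    simpa [one_div] using this
  have h2 : Real.log Q ≤ (Q : ℝ) ^ (ε / 3) / (ε / 3) :=
    Real.log_le_rpow_div (by positivity) (by positivity)
  have h3 : 1 ≤ (Q : ℝ) ^ (ε / 3) := Real.one_le_rpow hQR (by positivity)
  have h4 : ∑ u ∈ Finset.Icc 1 Q, (1 / (u : ℝ)) ≤ (1 + 1 / (ε / 3)) * (Q : ℝ) ^ (ε / 3) := by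
    calc _ ≤ (Q : ℝ) ^ (ε / 3) + (Q : ℝ) ^ (ε / 3) / (ε / 3) := by linarith
      _ = _ := by ring
  calc _ ≤ Q * ((1 + 1 / (ε / 3)) * (Q : ℝ) ^ (ε / 3)) ^ 3 := by
        gcongr
    _ = (1 + 1 / (ε / 3)) ^ 3 * (Q * ((Q : ℝ) ^ (ε / 3)) ^ 3) := by ring
    _ = _ := by
        congr 1
        rw [Real.rpow_add (by positivity), Real.rpow_one, ← Real.rpow_natCast, ← Real.rpow_mul
          (by positivity)]
        norm_num

/-! ### Fourier coefficients of the smoothed symbol -/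

lemma thetaSeries_eq_tsum_unitExp (c α : ℝ) :
    thetaSeries ((c : ℂ) + 2 * α * Complex.I) =
      ∑' k : ℤ, (Real.exp (-Real.pi * c * (k : ℝ) ^ 2) : ℂ) * unitExp (-(α * (k : ℝ) ^ 2)) := by
  refine tsum_congr fun k => ?_
  rw [unitExp, Complex.ofReal_exp, ← Complex.exp_add]
  congr 1
  push_cast
  ring

lemma summable_exp_neg_pi_mul_sq_real {c : ℝ} (hc : 0 < c) :
    Summable fun k : ℤ => Real.exp (-Real.pi * c * (k : ℝ) ^ 2) := by
  have h := (summable_exp_neg_pi_mul_sq (z := (c : ℂ)) (by simpa using hc)).norm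
  refine h.congr fun k => ?_
  rw [norm_exp_neg_pi_mul_sq]
  simp

lemma continuous_thetaSeries_add_two_mul_I {c : ℝ} (hc : 0 < c) :
    Continuous fun α : ℝ => thetaSeries ((c : ℂ) + 2 * α * Complex.I) := by
  simp_rw [thetaSeries_eq_tsum_unitExp]
  refine continuous_tsum (fun k => by fun_prop) (summable_exp_neg_pi_mul_sq_real hc) fun k α => ?_
  rw [norm_mul, norm_unitExp, mul_one, Complex.norm_real, Real.norm_of_nonneg (Real.exp_pos _).le]

lemma continuous_squareSymbol {N : ℕ} (hN : 0 < N) : Continuous (squareSymbol N) := by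
  have hNR : (0 : ℝ) < N := by exact_mod_cast hN
  exact (continuous_thetaSeries_add_two_mul_I (by positivity)).sub
    (continuous_thetaSeries_add_two_mul_I (by positivity))

/-- Termwise integration, justified by absolute convergence; orthogonality keeps the `k` with `k² =
n`. -/
lemma hasSum_integral_thetaSeries {c : ℝ} (hc : 0 < c) (t : ℝ) (n : ℤ) :
    HasSum (fun k : ℤ => (((if n = k ^ 2 then Real.exp (-Real.pi * c * (k : ℝ) ^ 2) else 0 : ℝ)) : ℂ))
      (∫ α in t..(t + 1), thetaSeries ((c : ℂ) + 2 * α * Complex.I) * unitExp (α * n)) := by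
  have hS := summable_exp_neg_pi_mul_sq_real hc
  have hterm : ∀ k : ℤ, ∀ α : ℝ, ‖(Real.exp (-Real.pi * c * (k : ℝ) ^ 2) : ℂ) *
      unitExp (-(α * (k : ℝ) ^ 2)) * unitExp (α * n)‖ = Real.exp (-Real.pi * c * (k : ℝ) ^ 2) := by
    intro k α
    rw [norm_mul, norm_mul, norm_unitExp, norm_unitExp, mul_one, mul_one, Complex.norm_real,
      Real.norm_of_nonneg (Real.exp_pos _).le]
  have h := intervalIntegral.hasSum_integral_of_dominated_convergence
    (μ := MeasureTheory.volume) (a := t) (b := t + 1)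
    (F := fun (k : ℤ) (α : ℝ) => (Real.exp (-Real.pi * c * (k : ℝ) ^ 2) : ℂ) *
      unitExp (-(α * (k : ℝ) ^ 2)) * unitExp (α * n))
    (f := fun α => thetaSeries ((c : ℂ) + 2 * α * Complex.I) * unitExp (α * n))
    (fun k _ => Real.exp (-Real.pi * c * (k : ℝ) ^ 2))
    (fun k => (by fun_prop : Continuous _).aestronglyMeasurable)
    (fun k => Filter.Eventually.of_forall fun α _ => (hterm k α).le)
    (Filter.Eventually.of_forall fun α _ => hS)
    intervalIntegrable_const
    (Filter.Eventually.of_forall fun α _ => by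
      rw [thetaSeries_eq_tsum_unitExp]
      refine HasSum.mul_right _ (Summable.hasSum (Summable.of_norm (hS.congr fun k => ?_)))
      rw [norm_mul, norm_unitExp, mul_one, Complex.norm_real,
        Real.norm_of_nonneg (Real.exp_pos _).le])
  refine h.congr_fun fun k => ?_
  have h2 : ∀ α : ℝ, (Real.exp (-Real.pi * c * (k : ℝ) ^ 2) : ℂ) *
      unitExp (-(α * (k : ℝ) ^ 2)) * unitExp (α * n) =
      (Real.exp (-Real.pi * c * (k : ℝ) ^ 2) : ℂ) * unitExp (α * ((n - k ^ 2 : ℤ) : ℝ)) := by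
    intro α
    rw [mul_assoc, ← unitExp_add]
    congr 2
    push_cast
    ring
  simp_rw [h2]
  rw [intervalIntegral.integral_const_mul, integral_unitExp_int_mul]
  simp only [sub_eq_zero]
  split_ifs <;> simp

/-- The Fourier coefficients of `squareSymbol` are nonnegative and bounded below on squares. -/
lemma exists_integral_squareSymbol {N : ℕ} (hN : 0 < N) (t : ℝ) (n : ℤ) : ∃ κ : ℝ,
    (κ : ℂ) = ∫ α in t..(t + 1), squareSymbol N α * unitExp (α * n) ∧ 0 ≤ κ ∧
    ∀ k : ℕ, N < 2 * k → k ≤ N → n = (k : ℤ) ^ 2 →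
      Real.exp (-Real.pi) * (1 - Real.exp (-(3 / 4 * Real.pi))) ≤ κ := by
  have hNR : (0 : ℝ) < N := by exact_mod_cast hN
  have hc1 : (0 : ℝ) < 1 / (N : ℝ) ^ 2 := by positivity
  have hc2 : (0 : ℝ) < 4 / (N : ℝ) ^ 2 := by positivity
  have h1 := hasSum_integral_thetaSeries hc1 t n
  have h2 := hasSum_integral_thetaSeries hc2 t n
  set w : ℤ → ℝ := fun k => (if n = k ^ 2 then Real.exp (-Real.pi * (1 / (N : ℝ) ^ 2) * (k : ℝ) ^ 2)
    else 0) - (if n = k ^ 2 then Real.exp (-Real.pi * (4 / (N : ℝ) ^ 2) * (k : ℝ) ^ 2) else 0)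
    with hw
  have hint : ∀ c : ℝ, 0 < c → IntervalIntegrable (fun α : ℝ =>
      thetaSeries ((c : ℂ) + 2 * α * Complex.I) * unitExp (α * n)) MeasureTheory.volume t (t + 1) :=
    fun c hc => ((continuous_thetaSeries_add_two_mul_I hc).mul (by fun_prop)).intervalIntegrable _ _
  have h3 : HasSum (fun k : ℤ => (w k : ℂ))
      (∫ α in t..(t + 1), squareSymbol N α * unitExp (α * n)) := by
    have h4 : ∫ α in t..(t + 1), squareSymbol N α * unitExp (α * n) =
        (∫ α in t..(t + 1), thetaSeries (((1 / (N : ℝ) ^ 2 : ℝ) : ℂ) + 2 * α * Complex.I) *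
          unitExp (α * n)) - ∫ α in t..(t + 1),
          thetaSeries (((4 / (N : ℝ) ^ 2 : ℝ) : ℂ) + 2 * α * Complex.I) * unitExp (α * n) := by
      rw [← intervalIntegral.integral_sub (hint _ hc1) (hint _ hc2)]
      refine intervalIntegral.integral_congr fun α _ => ?_
      simp only [squareSymbol]
      ring
    rw [h4]
    refine (h1.sub h2).congr_fun fun k => ?_
    simp only [hw]
    push_cast
    rfl
  have hwsum : Summable w := by
    have := h3.summable
    exact_mod_cast this
  have hw0 : ∀ k, 0 ≤ w k := by
    intro k
    simp only [hw]
    split_ifs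
    · rw [sub_nonneg]
      refine Real.exp_le_exp.2 ?_
      have h5 : 1 / (N : ℝ) ^ 2 ≤ 4 / (N : ℝ) ^ 2 := by gcongr; norm_num
      have h6 := mul_le_mul_of_nonneg_left h5 (mul_nonneg Real.pi_pos.le (sq_nonneg (k : ℝ)))
      linarith
    · simp
  refine ⟨∑' k, w k, ?_, tsum_nonneg hw0, fun k hk1 hk2 hk3 => ?_⟩
  · rw [Complex.ofReal_tsum]
    exact h3.tsum_eq
  · refine le_trans ?_ (hwsum.le_tsum (k : ℤ) fun j _ => hw0 j)
    simp only [hw, hk3, if_true]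
    -- With `s = k²/N²` in `[1/4, 1]`, the term is `e^(-πs)(1 - e^(-3πs))`. Bounding the first
    -- factor at `s = 1` and the second at `s = 1/4` gives the constant.
    set s : ℝ := 1 / (N : ℝ) ^ 2 * (((k : ℕ) : ℤ) : ℝ) ^ 2 with hs
    have hk1' : (N : ℝ) < 2 * k := by exact_mod_cast hk1
    have hk2' : (k : ℝ) ≤ N := by exact_mod_cast hk2
    have hs1 : s ≤ 1 := by
      rw [hs, Int.cast_natCast, one_div, inv_mul_le_iff₀ (by positivity), mul_one]
      gcongr
    have hs2 : 1 / 4 ≤ s := by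
      rw [hs, Int.cast_natCast, one_div_mul_eq_div, le_div_iff₀ (by positivity)]
      nlinarith
    have e1 : Real.exp (-Real.pi * (1 / (N : ℝ) ^ 2) * (((k : ℕ) : ℤ) : ℝ) ^ 2)
        = Real.exp (-Real.pi * s) := by
      congr 1
      rw [hs]; ring
    have e2 : Real.exp (-Real.pi * (4 / (N : ℝ) ^ 2) * (((k : ℕ) : ℤ) : ℝ) ^ 2)
        = Real.exp (-Real.pi * s) * Real.exp (-(3 * s * Real.pi)) := by
      rw [← Real.exp_add]
      congr 1
      rw [hs]; ring
    rw [e1, e2, ← mul_one_sub]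
    have e3 : Real.exp (-Real.pi) ≤ Real.exp (-Real.pi * s) := by
      refine Real.exp_le_exp.2 ?_
      nlinarith [Real.pi_pos]
    have e4 : Real.exp (-(3 * s * Real.pi)) ≤ Real.exp (-(3 / 4 * Real.pi)) := by
      refine Real.exp_le_exp.2 ?_
      nlinarith [Real.pi_pos]
    have e5 : Real.exp (-(3 / 4 * Real.pi)) ≤ 1 := Real.exp_le_one_iff.2 (by
      have := Real.pi_pos; linarith)
    exact mul_le_mul e3 (by linarith) (by linarith) (Real.exp_pos _).le

/-! ### Major arcs -/

/-- The numerators of the reduced fractions of denominator `q` in `(0, 1]`. -/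
def reducedNumerators (q : ℕ) : Finset ℕ :=
  (Finset.Icc 1 q).filter (fun a : ℕ => Nat.Coprime a q)

lemma mem_reducedNumerators {q a : ℕ} :
    a ∈ reducedNumerators q ↔ (1 ≤ a ∧ a ≤ q) ∧ Nat.Coprime a q := by
  simp [reducedNumerators]

/-- The density of the squares, cut off to the arc of radius `1/(qN)`. -/
noncomputable def arcDensity (N q : ℕ) : ℝ → ℂ :=
  Set.indicator (Set.Ioc (-(1 / ((q : ℝ) * N))) (1 / ((q : ℝ) * N))) (squareDensity N)

/-- The contribution of the major arcs with denominators at most `Q`. -/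
noncomputable def majorPart (N Q : ℕ) (α : ℝ) : ℂ :=
  ∑ q ∈ Finset.Icc 1 Q, ∑ a ∈ reducedNumerators q,
    quadGauss a 0 q / q * arcDensity N q (α - (a : ℝ) / q)

/-- Arcs around distinct reduced fractions are disjoint. -/
lemma reduced_fraction_unique {N Q : ℕ} (hQN : 2 * Q < N) {q q' a a' : ℕ}
    (hq : q ∈ Finset.Icc 1 Q) (hq' : q' ∈ Finset.Icc 1 Q) (ha : Nat.Coprime a q)
    (ha' : Nat.Coprime a' q') {α : ℝ} (h : |α - (a : ℝ) / q| ≤ 1 / (q * N))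
    (h' : |α - (a' : ℝ) / q'| ≤ 1 / (q' * N)) : q = q' ∧ a = a' := by
  rw [Finset.mem_Icc] at hq hq'
  have hqR : (0 : ℝ) < q := by exact_mod_cast hq.1
  have hqR' : (0 : ℝ) < q' := by exact_mod_cast hq'.1
  have hNR : (0 : ℝ) < N := by exact_mod_cast (by omega : 0 < N)
  have h1 : |(a : ℝ) / q - (a' : ℝ) / q'| ≤ 1 / (q * N) + 1 / (q' * N) := by
    have := abs_sub_le ((a : ℝ) / q) α ((a' : ℝ) / q')
    rw [abs_sub_comm] at h
    linarith
  -- Overlapping arcs force `|aq' - a'q| ≤ (q + q')/N ≤ 2Q/N < 1`, so this integer vanishes.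
  have h2 : |(a : ℝ) * q' - a' * q| < 1 := by
    have h3 : (a : ℝ) * q' - a' * q = ((a : ℝ) / q - (a' : ℝ) / q') * (q * q') := by
      field_simp
    rw [h3, abs_mul, abs_of_pos (mul_pos hqR hqR')]
    calc _ ≤ (1 / ((q : ℝ) * N) + 1 / (q' * N)) * (q * q') := by gcongr
      _ = ((q : ℝ) + q') / N := by field_simp; ring
      _ < 1 := by
        rw [div_lt_one hNR]
        exact_mod_cast (by omega : q + q' < N)
  have h4 : a * q' = a' * q := by
    have h5 : |((a * q' : ℕ) : ℤ) - ((a' * q : ℕ) : ℤ)| < 1 := by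
      have : ((|((a * q' : ℕ) : ℤ) - ((a' * q : ℕ) : ℤ)| : ℤ) : ℝ) < 1 := by
        push_cast; exact h2
      exact_mod_cast this
    have := Int.abs_lt_one_iff.1 h5
    omega
  have h6 : q ∣ q' := ha.symm.dvd_of_dvd_mul_left ⟨a', by rw [h4, mul_comm]⟩
  have h7 : q' ∣ q := ha'.symm.dvd_of_dvd_mul_left ⟨a, by rw [← h4, mul_comm]⟩
  have h8 := Nat.dvd_antisymm h6 h7
  subst h8
  exact ⟨rfl, Nat.eq_of_mul_eq_mul_right hq.1 h4⟩

/-- Dirichlet approximation with denominators at most `N`. -/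
lemma exists_reduced_fraction {N : ℕ} (hN : 0 < N) (α : ℝ) : ∃ q : ℕ, ∃ a : ℤ, 0 < q ∧ q ≤ N ∧
    IsCoprime a (q : ℤ) ∧ |α - (a : ℝ) / q| < 1 / (q * N) := by
  obtain ⟨r, hr1, hr2⟩ := Real.exists_rat_abs_sub_le_and_den_le α hN
  have hNR : (0 : ℝ) < N := by exact_mod_cast hN
  have hd : (0 : ℝ) < r.den := by exact_mod_cast r.pos
  refine ⟨r.den, r.num, r.pos, hr2, ?_, ?_⟩
  · rw [Int.isCoprime_iff_gcd_eq_one]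
    exact r.reduced
  · have h1 : ((r : ℚ) : ℝ) = (r.num : ℝ) / r.den := Rat.cast_def r
    rw [← h1]
    refine hr1.trans_lt ?_
    refine one_div_lt_one_div_of_lt (by positivity) ?_
    nlinarith

lemma arcDensity_eq_zero {N q : ℕ} {β : ℝ} (h : ¬ |β| ≤ 1 / ((q : ℝ) * N)) :
    arcDensity N q β = 0 := by
  refine Set.indicator_of_notMem (fun hm => h ?_) _
  exact abs_le.2 ⟨hm.1.le, hm.2⟩

/-- On a kept arc exactly one term of `majorPart` is nonzero and the arc approximation leaves
`O(√N)`, which is at most `N/√Q`. Off these arcs `majorPart` vanishes, and a Dirichlet approximation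
has denominator `q > Q`, so the main term of the symbol is itself `O(N/√q)`. -/
lemma exists_squareSymbol_sub_majorPart_le : ∃ C : ℝ, 0 < C ∧ ∀ N Q : ℕ, 1 ≤ Q → 2 * Q < N →
    ∀ α ∈ Set.Ioc (1 / (N : ℝ)) (1 / (N : ℝ) + 1),
      ‖squareSymbol N α - majorPart N Q α‖ ≤ C * (N / Real.sqrt Q) := by
  obtain ⟨C, hC, h⟩ := exists_squareSymbol_arc_approx
  refine ⟨C + 2 * Real.sqrt 2, by positivity, fun N Q hQ hQN α hα => ?_⟩
  have hN : 0 < N := by omega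
  have hNR : (0 : ℝ) < N := by exact_mod_cast hN
  have hQR : (0 : ℝ) < Q := by exact_mod_cast hQ
  have hsN : Real.sqrt N ≤ N / Real.sqrt Q := by
    rw [le_div_iff₀ (Real.sqrt_pos.2 hQR)]
    calc Real.sqrt N * Real.sqrt Q ≤ Real.sqrt N * Real.sqrt N := by
          gcongr
          omega
      _ = N := Real.mul_self_sqrt hNR.le
  have hpos : 0 ≤ N / Real.sqrt Q := by positivity
  by_cases hex : ∃ q ∈ Finset.Icc 1 Q, ∃ a ∈ reducedNumerators q,
      α - (a : ℝ) / q ∈ Set.Ioc (-(1 / ((q : ℝ) * N))) (1 / ((q : ℝ) * N))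
  · obtain ⟨q, hq, a, ha, hαq⟩ := hex
    have hqI := Finset.mem_Icc.1 hq
    have haI := mem_reducedNumerators.1 ha
    have habs : |α - (a : ℝ) / q| ≤ 1 / ((q : ℝ) * N) := abs_le.2 ⟨hαq.1.le, hαq.2⟩
    have hm : majorPart N Q α = quadGauss a 0 q / q * squareDensity N (α - (a : ℝ) / q) := by
      rw [majorPart, Finset.sum_eq_single q, Finset.sum_eq_single a]
      · rw [arcDensity, Set.indicator_of_mem hαq]
      · intro a' ha' hne
        rw [arcDensity_eq_zero, mul_zero]
        intro hc
        exact hne (reduced_fraction_unique hQN hq hq haI.2 (mem_reducedNumerators.1 ha').2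
          habs hc).2.symm
      · intro hc; exact absurd ha hc
      · intro q' hq' hne
        refine Finset.sum_eq_zero fun a' ha' => ?_
        rw [arcDensity_eq_zero, mul_zero]
        intro hc
        exact hne (reduced_fraction_unique hQN hq hq' haI.2 (mem_reducedNumerators.1 ha').2
          habs hc).1.symm
      · intro hc; exact absurd hq hc
    have h1 := h N q hqI.1 (by omega) a (Nat.isCoprime_iff_coprime.2 haI.2) (α - (a : ℝ) / q) habs
    rw [Int.cast_natCast, add_sub_cancel] at h1
    rw [hm]
    calc _ ≤ C * Real.sqrt N := h1
      _ ≤ C * (N / Real.sqrt Q) := by gcongr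
      _ ≤ _ := by
        refine mul_le_mul_of_nonneg_right ?_ hpos
        have := Real.sqrt_nonneg 2
        linarith
  · push Not at hex
    have hm : majorPart N Q α = 0 := by
      refine Finset.sum_eq_zero fun q hq => Finset.sum_eq_zero fun a ha => ?_
      rw [arcDensity, Set.indicator_of_notMem (hex q hq a ha), mul_zero]
    obtain ⟨q, a, hq0, hqN, hcop, hlt⟩ := exists_reduced_fraction hN α
    have hqR : (0 : ℝ) < q := by exact_mod_cast hq0
    have hlt2 := abs_lt.1 hlt
    -- If `q ≤ Q`, the choice of the interval `(1/N, 1 + 1/N]` forces `1 ≤ a ≤ q`, so `α` would lie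
    -- on a kept arc.
    have hQq : Q < q := by
      by_contra hcon
      push Not at hcon
      have hqN2 : (q : ℝ) + 1 ≤ N := by exact_mod_cast (by omega : q + 1 ≤ N)
      have ha1 : 0 < a := by
        have h1 : 1 / ((q : ℝ) * N) ≤ 1 / N := by
          refine one_div_le_one_div_of_le hNR ?_
          have : (1 : ℝ) ≤ q := by exact_mod_cast hq0
          nlinarith
        have h2 : 0 < (a : ℝ) / q := by linarith [hα.1, hlt2.2]
        have h3 : 0 < (a : ℝ) := by
          rcases div_pos_iff.1 h2 with h | h
          · exact h.1
          · linarith [h.2]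
        exact_mod_cast h3
      have ha2 : a ≤ q := by
        have h2 : (a : ℝ) / q < 1 + 1 / N + 1 / (q * N) := by linarith [hα.2, hlt2.1]
        have h3 : (a : ℝ) < q + 1 := by
          rw [div_lt_iff₀ hqR] at h2
          have h4 : (1 + 1 / (N : ℝ) + 1 / (q * N)) * q = q + (q + 1) / N := by
            field_simp
            ring
          have h5 : ((q : ℝ) + 1) / N ≤ 1 := (div_le_one hNR).2 hqN2
          linarith
        have h6 : a < q + 1 := by exact_mod_cast h3
        omega
      lift a to ℕ using ha1.le
      have hmem : a ∈ reducedNumerators q := mem_reducedNumerators.2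
        ⟨⟨by exact_mod_cast ha1, by exact_mod_cast ha2⟩, Nat.isCoprime_iff_coprime.1 hcop⟩
      refine hex q (Finset.mem_Icc.2 ⟨hq0, hcon⟩) a hmem ?_
      rw [Int.cast_natCast] at hlt2
      exact ⟨hlt2.1, hlt2.2.le⟩
    have h1 := h N q hq0 hqN a hcop (α - (a : ℝ) / q) hlt.le
    rw [add_sub_cancel] at h1
    rw [hm, sub_zero]
    have hG := norm_quadGauss_le hq0 hcop 0
    have hs : Real.sqrt q ^ 2 = q := Real.sq_sqrt hqR.le
    have hsq : 0 < Real.sqrt q := Real.sqrt_pos.2 hqR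
    have h2 : ‖quadGauss a 0 q / q * squareDensity N (α - (a : ℝ) / q)‖
        ≤ 2 * Real.sqrt 2 * (N / Real.sqrt Q) := by
      rw [norm_mul, norm_div, Complex.norm_natCast]
      calc _ ≤ Real.sqrt (2 * q) / q * (2 * N) := by
            gcongr
            exact norm_squareDensity_le hN _
        _ = 2 * Real.sqrt 2 * (N / Real.sqrt q) := by
            rw [Real.sqrt_mul (by norm_num)]
            generalize Real.sqrt q = s at *
            rw [← hs]
            field_simp
        _ ≤ _ := by
            gcongr
    calc ‖squareSymbol N α‖ = ‖(squareSymbol N α - quadGauss a 0 q / q *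
          squareDensity N (α - (a : ℝ) / q)) + quadGauss a 0 q / q *
          squareDensity N (α - (a : ℝ) / q)‖ := by rw [sub_add_cancel]
      _ ≤ C * Real.sqrt N + 2 * Real.sqrt 2 * (N / Real.sqrt Q) :=
          (norm_add_le _ _).trans (add_le_add h1 h2)
      _ ≤ C * (N / Real.sqrt Q) + 2 * Real.sqrt 2 * (N / Real.sqrt Q) := by gcongr
      _ = _ := by ring

lemma arcDensity_sub_mul {N q : ℕ} (θ : ℝ) (n : ℤ) :
    (fun α : ℝ => arcDensity N q (α - θ) * unitExp (α * n)) =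
      Set.indicator (Set.Ioc (θ - 1 / ((q : ℝ) * N)) (θ + 1 / ((q : ℝ) * N)))
        (fun α => squareDensity N (α - θ) * unitExp (α * n)) := by
  funext α
  have hiff : α - θ ∈ Set.Ioc (-(1 / ((q : ℝ) * N))) (1 / ((q : ℝ) * N)) ↔
      α ∈ Set.Ioc (θ - 1 / ((q : ℝ) * N)) (θ + 1 / ((q : ℝ) * N)) := by
    simp only [Set.mem_Ioc]
    constructor <;> rintro ⟨h1, h2⟩ <;> constructor <;> linarith
  by_cases h : α - θ ∈ Set.Ioc (-(1 / ((q : ℝ) * N))) (1 / ((q : ℝ) * N))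
  · rw [arcDensity, Set.indicator_of_mem h, Set.indicator_of_mem (hiff.1 h)]
  · rw [arcDensity, Set.indicator_of_notMem h, Set.indicator_of_notMem (fun hc => h (hiff.2 hc)),
      zero_mul]

lemma intervalIntegrable_arcDensity {N q : ℕ} (hN : 0 < N) (θ : ℝ) (n : ℤ) (t : ℝ) :
    IntervalIntegrable (fun α : ℝ => arcDensity N q (α - θ) * unitExp (α * n))
      MeasureTheory.volume t (t + 1) := by
  have hcont := continuous_squareDensity hN
  rw [arcDensity_sub_mul, intervalIntegrable_iff_integrableOn_Ioc_of_le (by linarith)]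
  have hc : Continuous fun α => squareDensity N (α - θ) * unitExp (α * n) := by fun_prop
  exact hc.integrableOn_Ioc.indicator measurableSet_Ioc

lemma integral_arcDensity {N q : ℕ} (hN : 0 < N) {θ t : ℝ} (n : ℤ)
    (h1 : t ≤ θ - 1 / ((q : ℝ) * N)) (h2 : θ + 1 / ((q : ℝ) * N) ≤ t + 1) :
    ∫ α in t..(t + 1), arcDensity N q (α - θ) * unitExp (α * n) =
      unitExp (θ * n) * ∫ β in (-(1 / ((q : ℝ) * N)))..(1 / ((q : ℝ) * N)),
        squareDensity N β * unitExp (β * n) := by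
  have hδ : 0 ≤ 1 / ((q : ℝ) * N) := by positivity
  have e := congrArg (fun F : ℝ → ℂ => ∫ α in t..(t + 1), F α) (arcDensity_sub_mul (N := N) (q := q) θ n)
  beta_reduce at e
  rw [e, intervalIntegral.integral_of_le (by linarith),
    MeasureTheory.setIntegral_indicator measurableSet_Ioc,
    Set.inter_eq_self_of_subset_right (Set.Ioc_subset_Ioc h1 h2),
    ← intervalIntegral.integral_of_le (by linarith)]
  have h3 : ∀ α : ℝ, squareDensity N (α - θ) * unitExp (α * n) =
      (fun β => unitExp (θ * n) * (squareDensity N β * unitExp (β * n))) (α - θ) := by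
    intro α
    simp only
    rw [mul_left_comm, ← unitExp_add]
    congr 2
    ring
  simp_rw [h3]
  rw [intervalIntegral.integral_comp_sub_right
    (fun β => unitExp (θ * n) * (squareDensity N β * unitExp (β * n))),
    intervalIntegral.integral_const_mul]
  congr 2 <;> ring

lemma intervalIntegrable_fun_sum {ι : Type*} (s : Finset ι) {f : ι → ℝ → ℂ} {a b : ℝ}
    (h : ∀ i ∈ s, IntervalIntegrable (f i) MeasureTheory.volume a b) :
    IntervalIntegrable (fun x => ∑ i ∈ s, f i x) MeasureTheory.volume a b := by
  have := IntervalIntegrable.sum s h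
  rwa [Finset.sum_fn] at this

lemma intervalIntegrable_majorPart {N : ℕ} (hN : 0 < N) (Q : ℕ) (n : ℤ) (t : ℝ) :
    IntervalIntegrable (fun α : ℝ => majorPart N Q α * unitExp (α * n))
      MeasureTheory.volume t (t + 1) := by
  simp only [majorPart, Finset.sum_mul, mul_assoc]
  refine intervalIntegrable_fun_sum _ fun q _ => intervalIntegrable_fun_sum _ fun a _ => ?_
  exact (intervalIntegrable_arcDensity hN _ n t).const_mul _

/-- The kernel of the major arcs is pointwise small. -/
lemma exists_integral_majorPart_le {ε : ℝ} (hε : 0 < ε) : ∃ C : ℝ, 0 < C ∧ ∀ N Q : ℕ, 1 ≤ Q →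
    2 * Q < N → ∀ n : ℤ,
      ‖∫ α in (1 / (N : ℝ))..(1 / (N : ℝ) + 1), majorPart N Q α * unitExp (α * n)‖ ≤
        C * ((Q : ℝ) ^ (1 + ε) / N) := by
  obtain ⟨C₁, hC₁, h₁⟩ := exists_sum_norm_singularCoeff_le hε
  obtain ⟨C₂, hC₂, h₂⟩ := exists_integral_squareDensity_le
  refine ⟨C₁ * C₂, by positivity, fun N Q hQ hQN n => ?_⟩
  have hN : 0 < N := by omega
  have hNR : (0 : ℝ) < N := by exact_mod_cast hN
  set J : ℕ → ℂ := fun q => ∫ β in (-(1 / ((q : ℝ) * N)))..(1 / ((q : ℝ) * N)),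
        squareDensity N β * unitExp (β * n) with hJ
  have hJle : ∀ q, ‖J q‖ ≤ C₂ / N := by
    intro q
    refine le_trans ?_ (h₂ N hN (1 / ((q : ℝ) * N)) (by positivity))
    refine (intervalIntegral.norm_integral_le_integral_norm (by
      have : 0 ≤ 1 / ((q : ℝ) * N) := by positivity
      linarith)).trans (le_of_eq ?_)
    refine intervalIntegral.integral_congr fun β _ => ?_
    simp only [norm_mul, norm_unitExp, mul_one]
  -- The arc integral depends on `a` only through `e(an/q)`, so the sum over `a` assembles the
  -- singular series coefficient.
  have heq : ∫ α in (1 / (N : ℝ))..(1 / (N : ℝ) + 1), majorPart N Q α * unitExp (α * n)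
      = ∑ q ∈ Finset.Icc 1 Q, singularCoeff q n * J q := by
    simp only [majorPart, Finset.sum_mul, mul_assoc]
    rw [intervalIntegral.integral_finsetSum fun q _ => intervalIntegrable_fun_sum _ fun a _ =>
      (intervalIntegrable_arcDensity hN _ n _).const_mul _]
    refine Finset.sum_congr rfl fun q hq => ?_
    rw [intervalIntegral.integral_finsetSum fun a _ =>
      (intervalIntegrable_arcDensity hN _ n _).const_mul _, singularCoeff, Finset.sum_mul]
    refine Finset.sum_congr rfl fun a ha => ?_
    have hq1 := Finset.mem_Icc.1 hq
    have ha1 := mem_reducedNumerators.1 ha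
    have hqR : (0 : ℝ) < q := by exact_mod_cast hq1.1
    rw [intervalIntegral.integral_const_mul, integral_arcDensity hN n, ← mul_assoc]
    -- The arc stays inside the interval of integration: `a/q - 1/(qN) ≥ 1/N` as `q + 1 ≤ N`, and
    -- `a/q + 1/(qN) ≤ 1 + 1/N`.
    · have haR : (1 : ℝ) ≤ a := by exact_mod_cast ha1.1.1
      have hqN : (q : ℝ) + 1 ≤ N := by exact_mod_cast (by omega : q + 1 ≤ N)
      rw [le_sub_iff_add_le]
      calc 1 / (N : ℝ) + 1 / (q * N) = (q + 1) / N / q := by field_simp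
        _ ≤ 1 / q := by
            gcongr
            rwa [div_le_one hNR]
        _ ≤ a / q := by gcongr
    · have haq : (a : ℝ) / q ≤ 1 := by
        rw [div_le_one hqR]
        exact_mod_cast ha1.1.2
      have : 1 / ((q : ℝ) * N) ≤ 1 / N := by
        refine one_div_le_one_div_of_le hNR ?_
        have : (1 : ℝ) ≤ q := by exact_mod_cast hq1.1
        nlinarith
      linarith
  rw [heq]
  calc _ ≤ ∑ q ∈ Finset.Icc 1 Q, ‖singularCoeff q n‖ * (C₂ / N) := by
        refine (norm_sum_le _ _).trans (Finset.sum_le_sum fun q _ => ?_)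
        rw [norm_mul]
        gcongr
        exact hJle q
    _ = (∑ q ∈ Finset.Icc 1 Q, ‖singularCoeff q n‖) * (C₂ / N) := by rw [Finset.sum_mul]
    _ ≤ (C₁ * (Q : ℝ) ^ (1 + ε)) * (C₂ / N) := by gcongr; exact h₁ Q hQ n
    _ = _ := by ring

/-! ### Fourier multipliers on `ℓ²` -/

/-- The trigonometric polynomial with real coefficients `f` supported on `s`. -/
noncomputable def trigPoly (s : Finset ℤ) (f : ℤ → ℝ) (α : ℝ) : ℂ :=
  ∑ y ∈ s, (f y : ℂ) * unitExp (α * y)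

@[fun_prop] lemma continuous_trigPoly (s : Finset ℤ) (f : ℤ → ℝ) : Continuous (trigPoly s f) := by
  unfold trigPoly
  fun_prop

lemma conj_trigPoly (s : Finset ℤ) (f : ℤ → ℝ) (α : ℝ) :
    (starRingEnd ℂ) (trigPoly s f α) = ∑ y ∈ s, (f y : ℂ) * unitExp (-(α * y)) := by
  rw [trigPoly, map_sum]
  refine Finset.sum_congr rfl fun y _ => ?_
  rw [map_mul, conj_unitExp, Complex.conj_ofReal]

lemma trigPoly_mul_conj (s : Finset ℤ) (f g : ℤ → ℝ) (α : ℝ) :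
    trigPoly s f α * (starRingEnd ℂ) (trigPoly s g α) =
      ∑ x ∈ s, ∑ y ∈ s, ((f y * g x : ℝ) : ℂ) * unitExp (α * ((y - x : ℤ) : ℝ)) := by
  rw [conj_trigPoly, trigPoly, Finset.sum_mul_sum, Finset.sum_comm]
  refine Finset.sum_congr rfl fun x _ => Finset.sum_congr rfl fun y _ => ?_
  have : unitExp (α * ((y - x : ℤ) : ℝ)) = unitExp (α * y) * unitExp (-(α * x)) := by
    rw [← unitExp_add]
    congr 1
    push_cast
    ring
  rw [this]
  push_cast
  ring

/-- Parseval's identity for trigonometric polynomials. -/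
lemma integral_norm_trigPoly_sq (s : Finset ℤ) (f : ℤ → ℝ) (t : ℝ) :
    ∫ α in t..(t + 1), ‖trigPoly s f α‖ ^ 2 = ∑ y ∈ s, f y ^ 2 := by
  have h1 : ((∫ α in t..(t + 1), ‖trigPoly s f α‖ ^ 2 : ℝ) : ℂ) = ((∑ y ∈ s, f y ^ 2 : ℝ) : ℂ) := by
    rw [← intervalIntegral.integral_ofReal]
    have h2 : ∀ α : ℝ, ((‖trigPoly s f α‖ ^ 2 : ℝ) : ℂ) =
        ∑ x ∈ s, ∑ y ∈ s, ((f y * f x : ℝ) : ℂ) * unitExp (α * ((y - x : ℤ) : ℝ)) := by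
      intro α
      rw [← trigPoly_mul_conj, Complex.mul_conj, Complex.normSq_eq_norm_sq]
    simp_rw [h2]
    rw [intervalIntegral.integral_finsetSum fun x _ =>
      (by fun_prop : Continuous _).intervalIntegrable _ _]
    push_cast
    refine Finset.sum_congr rfl fun x hx => ?_
    rw [intervalIntegral.integral_finsetSum fun y _ =>
      (by fun_prop : Continuous _).intervalIntegrable _ _]
    have h3 : ∀ y ∈ s, ∫ α in t..(t + 1), ((f y : ℂ) * f x) * unitExp (α * ((y : ℝ) - x)) =
        if y = x then ((f y : ℂ) * f x) else 0 := by
      intro y _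
      have := integral_unitExp_int_mul t (y - x)
      push_cast at this
      rw [intervalIntegral.integral_const_mul, this]
      simp only [sub_eq_zero]
      split_ifs <;> simp
    rw [Finset.sum_congr rfl h3, Finset.sum_ite_eq' s x, if_pos hx, sq]
  exact_mod_cast h1

/-- A bounded Fourier multiplier is bounded on `ℓ²`, in bilinear form. -/
lemma norm_sum_multiplier_le {h : ℝ → ℂ} {t M : ℝ} (hM : 0 ≤ M)
    (hint : ∀ n : ℤ, IntervalIntegrable (fun α => h α * unitExp (α * n)) MeasureTheory.volume t (t + 1))
    (hbd : ∀ α ∈ Set.Ioc t (t + 1), ‖h α‖ ≤ M) (s : Finset ℤ) (f g : ℤ → ℝ) :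
    ‖∑ x ∈ s, ∑ y ∈ s, ((f y * g x : ℝ) : ℂ) *
        ∫ α in t..(t + 1), h α * unitExp (α * ((y - x : ℤ) : ℝ))‖ ≤
      M * (Real.sqrt (∑ y ∈ s, f y ^ 2) * Real.sqrt (∑ x ∈ s, g x ^ 2)) := by
  have hrep : ∑ x ∈ s, ∑ y ∈ s, ((f y * g x : ℝ) : ℂ) *
        ∫ α in t..(t + 1), h α * unitExp (α * ((y - x : ℤ) : ℝ))
      = ∫ α in t..(t + 1), h α * (trigPoly s f α * (starRingEnd ℂ) (trigPoly s g α)) := by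
    have h2 : ∀ α : ℝ, h α * (trigPoly s f α * (starRingEnd ℂ) (trigPoly s g α)) =
        ∑ x ∈ s, ∑ y ∈ s, ((f y * g x : ℝ) : ℂ) * (h α * unitExp (α * ((y - x : ℤ) : ℝ))) := by
      intro α
      rw [trigPoly_mul_conj, Finset.mul_sum]
      refine Finset.sum_congr rfl fun x _ => ?_
      rw [Finset.mul_sum]
      exact Finset.sum_congr rfl fun y _ => mul_left_comm _ _ _
    simp_rw [h2]
    rw [intervalIntegral.integral_finsetSum fun x _ => intervalIntegrable_fun_sum _ fun y _ =>
      (hint _).const_mul _]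
    refine Finset.sum_congr rfl fun x _ => ?_
    rw [intervalIntegral.integral_finsetSum fun y _ => (hint _).const_mul _]
    exact Finset.sum_congr rfl fun y _ => (intervalIntegral.integral_const_mul _ _).symm
  set A := Real.sqrt (∑ y ∈ s, f y ^ 2) with hA
  set B := Real.sqrt (∑ x ∈ s, g x ^ 2) with hB
  have hA2 : A ^ 2 = ∑ y ∈ s, f y ^ 2 := Real.sq_sqrt (Finset.sum_nonneg fun _ _ => sq_nonneg _)
  have hB2 : B ^ 2 = ∑ x ∈ s, g x ^ 2 := Real.sq_sqrt (Finset.sum_nonneg fun _ _ => sq_nonneg _)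
  have hA0 : 0 ≤ A := Real.sqrt_nonneg _
  have hB0 : 0 ≤ B := Real.sqrt_nonneg _
  have hzero : ∀ u : ℤ → ℝ, ∑ y ∈ s, u y ^ 2 = 0 → ∀ y ∈ s, u y = 0 := by
    intro u hu y hy
    exact pow_eq_zero_iff two_ne_zero |>.1
      ((Finset.sum_eq_zero_iff_of_nonneg fun _ _ => sq_nonneg _).1 hu y hy)
  rcases hA0.eq_or_lt with hA1 | hA1
  · have hf := hzero f (by rw [← hA2, ← hA1]; simp)
    rw [Finset.sum_eq_zero fun x _ => Finset.sum_eq_zero fun y hy => by rw [hf y hy]; simp]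
    simp only [norm_zero]
    positivity
  rcases hB0.eq_or_lt with hB1 | hB1
  · have hg := hzero g (by rw [← hB2, ← hB1]; simp)
    rw [Finset.sum_eq_zero fun x hx => Finset.sum_eq_zero fun y _ => by rw [hg x hx]; simp]
    simp only [norm_zero]
    positivity
  rw [hrep]
  have hci : ∀ u : ℤ → ℝ, IntervalIntegrable (fun α => ‖trigPoly s u α‖ ^ 2)
      MeasureTheory.volume t (t + 1) := fun u => (by fun_prop : Continuous _).intervalIntegrable _ _
  -- A weighted arithmetic-geometric mean inequality replaces Cauchy-Schwarz for the integral. The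
  -- weights make both squares contribute equally after Parseval; dividing by `AB` is why the
  -- degenerate cases were removed.
  have hpt : ∀ α ∈ Set.Ioc t (t + 1),
      ‖h α * (trigPoly s f α * (starRingEnd ℂ) (trigPoly s g α))‖ ≤
        M / (2 * A * B) * (B ^ 2 * ‖trigPoly s f α‖ ^ 2 + A ^ 2 * ‖trigPoly s g α‖ ^ 2) := by
    intro α hα
    rw [norm_mul, norm_mul, RCLike.norm_conj]
    have h3 : ‖trigPoly s f α‖ * ‖trigPoly s g α‖ ≤
        (B ^ 2 * ‖trigPoly s f α‖ ^ 2 + A ^ 2 * ‖trigPoly s g α‖ ^ 2) / (2 * A * B) := by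
      rw [le_div_iff₀ (by positivity)]
      nlinarith [sq_nonneg (B * ‖trigPoly s f α‖ - A * ‖trigPoly s g α‖)]
    calc _ ≤ M * ((B ^ 2 * ‖trigPoly s f α‖ ^ 2 + A ^ 2 * ‖trigPoly s g α‖ ^ 2) / (2 * A * B)) :=
          mul_le_mul (hbd α hα) h3 (by positivity) hM
      _ = _ := by ring
  refine (intervalIntegral.norm_integral_le_of_norm_le (by linarith)
    (Filter.Eventually.of_forall hpt)
    ((((hci f).const_mul _).add ((hci g).const_mul _)).const_mul _)).trans (le_of_eq ?_)
  rw [intervalIntegral.integral_const_mul, intervalIntegral.integral_add ((hci f).const_mul _)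
    ((hci g).const_mul _), intervalIntegral.integral_const_mul, intervalIntegral.integral_const_mul,
    integral_norm_trigPoly_sq, integral_norm_trigPoly_sq, ← hA2, ← hB2]
  field_simp
  ring

/-! ### The high-low decomposition -/

/-- The indicator function of the squares `k²` with `N/2 < k ≤ N`. -/
noncomputable def dyadicSquareKernel (N : ℕ) (n : ℤ) : ℝ :=
  ∑ k ∈ Finset.Ioc (N / 2) N, if n = (k : ℤ) ^ 2 then 1 else 0

lemma dyadicSquareKernel_cases (N : ℕ) (n : ℤ) : dyadicSquareKernel N n = 0 ∨
    (dyadicSquareKernel N n = 1 ∧ ∃ k : ℕ, N < 2 * k ∧ k ≤ N ∧ n = (k : ℤ) ^ 2) := by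
  by_cases h : ∃ k ∈ Finset.Ioc (N / 2) N, n = (k : ℤ) ^ 2
  · obtain ⟨k, hk, rfl⟩ := h
    refine Or.inr ⟨?_, k, ?_, ?_, rfl⟩
    · rw [dyadicSquareKernel, Finset.sum_eq_single k]
      · simp
      · intro j _ hj
        rw [if_neg]
        intro hc
        have hc' : k ^ 2 = j ^ 2 := by exact_mod_cast hc
        exact hj (Nat.pow_left_injective (by norm_num : 2 ≠ 0) hc').symm
      · intro hc; exact absurd hk hc
    all_goals rw [Finset.mem_Ioc] at hk; omega
  · push Not at h
    exact Or.inl (Finset.sum_eq_zero fun k hk => if_neg (h k hk))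

lemma dyadicSquareKernel_le_one (N : ℕ) (n : ℤ) : dyadicSquareKernel N n ≤ 1 := by
  rcases dyadicSquareKernel_cases N n with h | ⟨h, -⟩ <;> rw [h]
  exact zero_le_one

/-- The high-low estimate: the operator with the kernel of the dyadic squares is the sum of an
operator of small norm on `ℓ²` and one of small norm from `ℓ¹` to `ℓ^∞`. -/
lemma exists_dyadicSquareKernel_high_low {ε : ℝ} (hε : 0 < ε) : ∃ C : ℝ, 0 < C ∧
    ∀ N Q : ℕ, 1 ≤ N → 1 ≤ Q → ∀ (s : Finset ℤ) (f g : ℤ → ℝ), (∀ x, 0 ≤ f x) → (∀ x, 0 ≤ g x) →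
      ∑ x ∈ s, ∑ y ∈ s, dyadicSquareKernel N (y - x) * (f y * g x) ≤
        C * (N / Real.sqrt Q * (Real.sqrt (∑ y ∈ s, f y ^ 2) * Real.sqrt (∑ x ∈ s, g x ^ 2)) +
          (Q : ℝ) ^ (1 + ε) / N * ((∑ y ∈ s, f y) * ∑ x ∈ s, g x)) := by
  obtain ⟨C₁, hC₁, h₁⟩ := exists_squareSymbol_sub_majorPart_le
  obtain ⟨C₂, hC₂, h₂⟩ := exists_integral_majorPart_le hε
  set c : ℝ := Real.exp (-Real.pi) * (1 - Real.exp (-(3 / 4 * Real.pi))) with hc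
  have hc0 : 0 < c := mul_pos (Real.exp_pos _) (sub_pos.2 (Real.exp_lt_one_iff.2 (by
    have := Real.pi_pos; linarith)))
  set C : ℝ := (C₁ + C₂) / c + 2 with hC
  have hC0 : 0 < C := by positivity
  refine ⟨C, hC0, fun N Q hN hQ s f g hf hg => ?_⟩
  have hNR : (0 : ℝ) < N := by exact_mod_cast hN
  have hQR : (1 : ℝ) ≤ Q := by exact_mod_cast hQ
  set A := Real.sqrt (∑ y ∈ s, f y ^ 2) * Real.sqrt (∑ x ∈ s, g x ^ 2) with hA
  have hA0 : 0 ≤ A := by positivity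
  set B := (∑ y ∈ s, f y) * ∑ x ∈ s, g x with hB
  have hB0 : 0 ≤ B := mul_nonneg (Finset.sum_nonneg fun y _ => hf y)
    (Finset.sum_nonneg fun y _ => hg y)
  have hBsum : ∑ x ∈ s, ∑ y ∈ s, f y * g x = B := by
    rw [hB, Finset.sum_mul_sum, Finset.sum_comm]
  have hQpow : (Q : ℝ) ≤ (Q : ℝ) ^ (1 + ε) := by
    conv_lhs => rw [← Real.rpow_one (Q : ℝ)]
    exact Real.rpow_le_rpow_of_exponent_le hQR (by linarith)
  have hQpow0 : 0 ≤ (Q : ℝ) ^ (1 + ε) := by positivity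
  -- For `N ≤ 2Q` the low term alone suffices: the kernel is at most `1 ≤ 2 Q^(1+ε)/N`, which
  -- accounts for the summand `2` in `C`. The arcs are needed, and disjoint, only for `2Q < N`.
  rcases le_or_gt N (2 * Q) with hNQ | hQN
  · have h1 : ∑ x ∈ s, ∑ y ∈ s, dyadicSquareKernel N (y - x) * (f y * g x) ≤ B := by
      rw [← hBsum]
      refine Finset.sum_le_sum fun x _ => Finset.sum_le_sum fun y _ => ?_
      exact mul_le_of_le_one_left (mul_nonneg (hf y) (hg x)) (dyadicSquareKernel_le_one _ _)
    have h2 : (1 : ℝ) ≤ 2 * ((Q : ℝ) ^ (1 + ε) / N) := by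
      rw [← mul_div_assoc, le_div_iff₀ hNR]
      have : (N : ℝ) ≤ 2 * Q := by exact_mod_cast hNQ
      linarith
    have h3 : (2 : ℝ) ≤ C := by
      rw [hC]
      have : 0 < (C₁ + C₂) / c := by positivity
      linarith
    calc _ ≤ B := h1
      _ ≤ 2 * ((Q : ℝ) ^ (1 + ε) / N) * B := le_mul_of_one_le_left hB0 h2
      _ ≤ C * ((Q : ℝ) ^ (1 + ε) / N) * B := by gcongr
      _ = C * (0 + (Q : ℝ) ^ (1 + ε) / N * B) := by ring
      _ ≤ _ := by gcongr; positivity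
  · set t : ℝ := 1 / (N : ℝ) with ht
    choose κ hκ1 hκ2 hκ3 using fun n : ℤ => exists_integral_squareSymbol hN t n
    -- Nonnegativity of `κ` lets it serve as a majorant; this is where `f, g ≥ 0` enters.
    have hker : ∀ n, dyadicSquareKernel N n ≤ κ n / c := by
      intro n
      rcases dyadicSquareKernel_cases N n with h | ⟨h, k, hk1, hk2, hk3⟩
      · rw [h]; exact div_nonneg (hκ2 n) hc0.le
      · rw [h, le_div_iff₀ hc0, one_mul]; exact hκ3 n k hk1 hk2 hk3
    have hi1 : ∀ n : ℤ, IntervalIntegrable (fun α => squareSymbol N α * unitExp (α * n))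
        MeasureTheory.volume t (t + 1) := fun n =>
      ((continuous_squareSymbol hN).mul (by fun_prop)).intervalIntegrable _ _
    have hi2 : ∀ n : ℤ, IntervalIntegrable (fun α => majorPart N Q α * unitExp (α * n))
        MeasureTheory.volume t (t + 1) := fun n => intervalIntegrable_majorPart hN Q n t
    have hi3 : ∀ n : ℤ, IntervalIntegrable (fun α => (squareSymbol N α - majorPart N Q α) *
        unitExp (α * n)) MeasureTheory.volume t (t + 1) := fun n => by
      simp_rw [sub_mul]
      exact (hi1 n).sub (hi2 n)
    have hsplit : ∀ n : ℤ, (κ n : ℂ) = (∫ α in t..(t + 1), (squareSymbol N α - majorPart N Q α) *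
        unitExp (α * n)) + ∫ α in t..(t + 1), majorPart N Q α * unitExp (α * n) := by
      intro n
      rw [hκ1, ← intervalIntegral.integral_add (hi3 n) (hi2 n)]
      refine intervalIntegral.integral_congr fun α _ => ?_
      ring
    have hhigh := norm_sum_multiplier_le (t := t) (M := C₁ * (N / Real.sqrt Q)) (by positivity) hi3
      (fun α hα => h₁ N Q hQ hQN α hα) s f g
    have hlow : ‖∑ x ∈ s, ∑ y ∈ s, ((f y * g x : ℝ) : ℂ) *
        ∫ α in t..(t + 1), majorPart N Q α * unitExp (α * ((y - x : ℤ) : ℝ))‖ ≤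
        C₂ * ((Q : ℝ) ^ (1 + ε) / N) * B := by
      rw [← hBsum, Finset.mul_sum]
      refine (norm_sum_le _ _).trans (Finset.sum_le_sum fun x _ => ?_)
      rw [Finset.mul_sum]
      refine (norm_sum_le _ _).trans (Finset.sum_le_sum fun y _ => ?_)
      have hfg := mul_nonneg (hf y) (hg x)
      rw [norm_mul, Complex.norm_real, Real.norm_of_nonneg hfg, mul_comm]
      exact mul_le_mul_of_nonneg_right (h₂ N Q hQ hQN _) hfg
    have hκsum : ∑ x ∈ s, ∑ y ∈ s, κ (y - x) * (f y * g x) ≤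
        C₁ * (N / Real.sqrt Q) * A + C₂ * ((Q : ℝ) ^ (1 + ε) / N) * B := by
      have e1 : ((∑ x ∈ s, ∑ y ∈ s, κ (y - x) * (f y * g x) : ℝ) : ℂ) =
          (∑ x ∈ s, ∑ y ∈ s, ((f y * g x : ℝ) : ℂ) * ∫ α in t..(t + 1),
            (squareSymbol N α - majorPart N Q α) * unitExp (α * ((y - x : ℤ) : ℝ))) +
          ∑ x ∈ s, ∑ y ∈ s, ((f y * g x : ℝ) : ℂ) *
            ∫ α in t..(t + 1), majorPart N Q α * unitExp (α * ((y - x : ℤ) : ℝ)) := by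
        rw [← Finset.sum_add_distrib, Complex.ofReal_sum]
        refine Finset.sum_congr rfl fun x _ => ?_
        rw [← Finset.sum_add_distrib, Complex.ofReal_sum]
        refine Finset.sum_congr rfl fun y _ => ?_
        rw [← mul_add, ← hsplit, Complex.ofReal_mul, mul_comm]
      calc _ ≤ ‖((∑ x ∈ s, ∑ y ∈ s, κ (y - x) * (f y * g x) : ℝ) : ℂ)‖ := by
            rw [Complex.norm_real]
            exact Real.le_norm_self _
        _ ≤ _ := by
            rw [e1]
            exact (norm_add_le _ _).trans (add_le_add hhigh hlow)
    calc _ ≤ ∑ x ∈ s, ∑ y ∈ s, κ (y - x) / c * (f y * g x) :=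
          Finset.sum_le_sum fun x _ => Finset.sum_le_sum fun y _ =>
            mul_le_mul_of_nonneg_right (hker _) (mul_nonneg (hf y) (hg x))
      _ = (∑ x ∈ s, ∑ y ∈ s, κ (y - x) * (f y * g x)) / c := by
          simp_rw [Finset.sum_div, div_mul_eq_mul_div]
      _ ≤ (C₁ * (N / Real.sqrt Q) * A + C₂ * ((Q : ℝ) ^ (1 + ε) / N) * B) / c := by gcongr
      _ = C₁ / c * (N / Real.sqrt Q * A) + C₂ / c * ((Q : ℝ) ^ (1 + ε) / N * B) := by ring
      _ ≤ C * (N / Real.sqrt Q * A) + C * ((Q : ℝ) ^ (1 + ε) / N * B) := by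
          have h5 : C₁ / c ≤ C := by
            rw [hC, add_div]
            have : 0 < C₂ / c := by positivity
            linarith
          have h6 : C₂ / c ≤ C := by
            rw [hC, add_div]
            have : 0 < C₁ / c := by positivity
            linarith
          gcongr
      _ = _ := by ring

/-- Cauchy-Schwarz over the pairs with `y - x = m`; on these either coordinate determines the other.
-/
lemma sum_shift_le_sqrt_mul_sqrt (s : Finset ℤ) (f g : ℤ → ℝ) (m : ℤ) :
    ∑ x ∈ s, ∑ y ∈ s, (if y - x = m then 1 else 0) * (f y * g x) ≤
      Real.sqrt (∑ y ∈ s, f y ^ 2) * Real.sqrt (∑ x ∈ s, g x ^ 2) := by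
  set P := (s ×ˢ s).filter fun p : ℤ × ℤ => p.2 - p.1 = m with hP
  have h1 : ∑ x ∈ s, ∑ y ∈ s, (if y - x = m then 1 else 0) * (f y * g x) =
      ∑ p ∈ P, f p.2 * g p.1 := by
    rw [hP, Finset.sum_filter, Finset.sum_product]
    refine Finset.sum_congr rfl fun x _ => Finset.sum_congr rfl fun y _ => ?_
    split_ifs <;> simp
  rw [h1]
  refine (Real.sum_mul_le_sqrt_mul_sqrt _ _ _).trans ?_
  have h2 : ∑ p ∈ P, f p.2 ^ 2 ≤ ∑ y ∈ s, f y ^ 2 := by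
    rw [← Finset.sum_image (s := P) (g := fun p => p.2) (f := fun y => f y ^ 2)]
    · refine Finset.sum_le_sum_of_subset_of_nonneg (fun y hy => ?_) fun _ _ _ => sq_nonneg _
      obtain ⟨p, hp, rfl⟩ := Finset.mem_image.1 hy
      exact (Finset.mem_product.1 (Finset.mem_filter.1 hp).1).2
    · intro p hp p' hp' h
      have h3 := (Finset.mem_filter.1 hp).2
      have h4 := (Finset.mem_filter.1 hp').2
      simp only at h
      exact Prod.ext (by omega) h
  have h2' : ∑ p ∈ P, g p.1 ^ 2 ≤ ∑ y ∈ s, g y ^ 2 := by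
    rw [← Finset.sum_image (s := P) (g := fun p => p.1) (f := fun y => g y ^ 2)]
    · refine Finset.sum_le_sum_of_subset_of_nonneg (fun y hy => ?_) fun _ _ _ => sq_nonneg _
      obtain ⟨p, hp, rfl⟩ := Finset.mem_image.1 hy
      exact (Finset.mem_product.1 (Finset.mem_filter.1 hp).1).1
    · intro p hp p' hp' h
      have h3 := (Finset.mem_filter.1 hp).2
      have h4 := (Finset.mem_filter.1 hp').2
      simp only at h
      exact Prod.ext h (by omega)
  exact mul_le_mul (Real.sqrt_le_sqrt h2) (Real.sqrt_le_sqrt h2') (Real.sqrt_nonneg _)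
    (Real.sqrt_nonneg _)

lemma sum_dyadicSquareKernel_le (N : ℕ) (s : Finset ℤ) (f g : ℤ → ℝ) :
    ∑ x ∈ s, ∑ y ∈ s, dyadicSquareKernel N (y - x) * (f y * g x) ≤
      N * (Real.sqrt (∑ y ∈ s, f y ^ 2) * Real.sqrt (∑ x ∈ s, g x ^ 2)) := by
  have h1 : ∑ x ∈ s, ∑ y ∈ s, dyadicSquareKernel N (y - x) * (f y * g x) =
      ∑ k ∈ Finset.Ioc (N / 2) N, ∑ x ∈ s, ∑ y ∈ s,
        (if y - x = (k : ℤ) ^ 2 then 1 else 0) * (f y * g x) := by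
    simp_rw [dyadicSquareKernel, Finset.sum_mul]
    rw [Finset.sum_congr rfl fun x _ => Finset.sum_comm, Finset.sum_comm]
  rw [h1]
  refine (Finset.sum_le_sum fun k _ => sum_shift_le_sqrt_mul_sqrt s f g _).trans ?_
  rw [Finset.sum_const, nsmul_eq_mul, Nat.card_Ioc]
  gcongr
  omega

/-! ### Interpolation through level sets -/

/-- The part of `f` taking values in `[4^i, 4^(i+1))`. -/
noncomputable def levelPart (f : ℤ → ℝ) (i : ℤ) (x : ℤ) : ℝ :=
  if Int.log 4 (f x) = i then f x else 0

lemma levelPart_nonneg {f : ℤ → ℝ} (hf : ∀ x, 0 ≤ f x) (i x : ℤ) : 0 ≤ levelPart f i x := by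
  rw [levelPart]
  split_ifs
  exacts [hf x, le_rfl]

lemma sum_levelPart (f : ℤ → ℝ) {s J : Finset ℤ} (hJ : ∀ x ∈ s, Int.log 4 (f x) ∈ J) {x : ℤ}
    (hx : x ∈ s) : ∑ i ∈ J, levelPart f i x = f x := by
  simp only [levelPart]
  rw [Finset.sum_ite_eq, if_pos (hJ x hx)]

lemma sum_sum_levelPart_rpow (f : ℤ → ℝ) {p : ℝ} (hp : 0 < p) {s J : Finset ℤ}
    (hJ : ∀ x ∈ s, Int.log 4 (f x) ∈ J) :
    ∑ i ∈ J, ∑ x ∈ s, levelPart f i x ^ p = ∑ x ∈ s, f x ^ p := by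
  rw [Finset.sum_comm]
  refine Finset.sum_congr rfl fun x hx => ?_
  have : ∀ i ∈ J, levelPart f i x ^ p = if Int.log 4 (f x) = i then f x ^ p else 0 := by
    intro i _
    rw [levelPart]
    split_ifs
    · rfl
    · exact Real.zero_rpow hp.ne'
  rw [Finset.sum_congr rfl this, Finset.sum_ite_eq, if_pos (hJ x hx)]

/-- Since `Int.log 4 0 = 0`, zeros of `f` are filed under level `0`; the first alternative covers
them as well as the points of other levels. -/
lemma levelPart_eq_zero_or {f : ℤ → ℝ} (hf : ∀ x, 0 ≤ f x) (i x : ℤ) : levelPart f i x = 0 ∨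
    ((4 : ℝ) ^ (i : ℝ) ≤ levelPart f i x ∧ levelPart f i x ≤ (4 : ℝ) ^ ((i : ℝ) + 1)) := by
  rcases (levelPart_nonneg hf i x).eq_or_lt with h | h
  · exact Or.inl h.symm
  · right
    have hi : Int.log 4 (f x) = i := by
      by_contra hne
      rw [levelPart, if_neg hne] at h
      exact lt_irrefl _ h
    have hval : levelPart f i x = f x := if_pos hi
    rw [hval] at h ⊢
    have h1 := Int.zpow_log_le_self (b := 4) (by norm_num) h
    have h2 := Int.lt_zpow_succ_log_self (b := 4) (by norm_num) (f x)
    rw [hi] at h1 h2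
    refine ⟨?_, ?_⟩
    · rw [Real.rpow_intCast]; exact_mod_cast h1
    · have e : (i : ℝ) + 1 = ((i + 1 : ℤ) : ℝ) := by push_cast; rfl
      rw [e, Real.rpow_intCast]
      exact_mod_cast h2.le

/-- Write `v² = v^(2-p) v^p` and use the upper end of the level, as `2 - p ≥ 0`. -/
lemma sum_levelPart_sq_le {f : ℤ → ℝ} (hf : ∀ x, 0 ≤ f x) {p : ℝ} (hp0 : 0 < p) (hp : p ≤ 2)
    (s : Finset ℤ) (i : ℤ) : ∑ x ∈ s, levelPart f i x ^ 2 ≤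
      (4 : ℝ) ^ (((i : ℝ) + 1) * (2 - p)) * ∑ x ∈ s, levelPart f i x ^ p := by
  rw [Finset.mul_sum]
  refine Finset.sum_le_sum fun x _ => ?_
  rcases levelPart_eq_zero_or hf i x with h | ⟨h1, h2⟩
  · rw [h, Real.zero_rpow hp0.ne']
    simp
  · have hpos : 0 < levelPart f i x := (Real.rpow_pos_of_pos (by norm_num) _).trans_le h1
    calc levelPart f i x ^ 2 = levelPart f i x ^ (2 - p) * levelPart f i x ^ p := by
          rw [← Real.rpow_add hpos, sub_add_cancel, Real.rpow_two]
      _ ≤ ((4 : ℝ) ^ ((i : ℝ) + 1)) ^ (2 - p) * levelPart f i x ^ p := by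
          gcongr
      _ = _ := by rw [← Real.rpow_mul (by norm_num)]

/-- Write `v = v^(1-p) v^p` and use the lower end of the level, as `1 - p ≤ 0`. -/
lemma sum_levelPart_le {f : ℤ → ℝ} (hf : ∀ x, 0 ≤ f x) {p : ℝ} (hp : 1 ≤ p)
    (s : Finset ℤ) (i : ℤ) : ∑ x ∈ s, levelPart f i x ≤
      (4 : ℝ) ^ ((i : ℝ) * (1 - p)) * ∑ x ∈ s, levelPart f i x ^ p := by
  rw [Finset.mul_sum]
  refine Finset.sum_le_sum fun x _ => ?_
  rcases levelPart_eq_zero_or hf i x with h | ⟨h1, h2⟩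
  · rw [h, Real.zero_rpow (by linarith)]
    simp
  · have h4 : (0 : ℝ) < (4 : ℝ) ^ (i : ℝ) := Real.rpow_pos_of_pos (by norm_num) _
    have hpos : 0 < levelPart f i x := h4.trans_le h1
    calc levelPart f i x = levelPart f i x ^ (1 - p) * levelPart f i x ^ p := by
          rw [← Real.rpow_add hpos, sub_add_cancel, Real.rpow_one]
      _ ≤ ((4 : ℝ) ^ (i : ℝ)) ^ (1 - p) * levelPart f i x ^ p := by
          refine mul_le_mul_of_nonneg_right ?_ (Real.rpow_nonneg hpos.le _)
          exact Real.rpow_le_rpow_of_nonpos h4 h1 (by linarith)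
      _ = _ := by rw [← Real.rpow_mul (by norm_num)]

/-- The two-sided geometric weights occurring in the interpolation. -/
noncomputable def interpolationWeight (p : ℝ) (n : ℤ) : ℝ :=
  if n < 0 then (4 : ℝ) ^ ((n : ℝ) * (1 - p / 2)) else (4 : ℝ) ^ ((n : ℝ) * (3 / 4 - p / 2))

lemma interpolationWeight_nonneg (p : ℝ) (n : ℤ) : 0 ≤ interpolationWeight p n := by
  rw [interpolationWeight]
  split_ifs <;> positivity

/-- Decay at `-∞` is the condition `p < 2`, decay at `+∞` the condition `p > 3/2`. -/
lemma summable_interpolationWeight {p : ℝ} (hp : 3 / 2 < p) (hp2 : p < 2) :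
    Summable (interpolationWeight p) := by
  refine Summable.of_nat_of_neg ?_ ?_
  · have h : Summable fun n : ℕ => ((4 : ℝ) ^ (3 / 4 - p / 2)) ^ n :=
      summable_geometric_of_lt_one (by positivity)
        (Real.rpow_lt_one_of_one_lt_of_neg (by norm_num) (by linarith))
    refine h.congr fun n => ?_
    rw [interpolationWeight, if_neg (by omega), Int.cast_natCast, mul_comm,
      Real.rpow_mul (by norm_num), Real.rpow_natCast]
  · have h : Summable fun n : ℕ => ((4 : ℝ) ^ (-(1 - p / 2))) ^ n :=
      summable_geometric_of_lt_one (by positivity)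
        (Real.rpow_lt_one_of_one_lt_of_neg (by norm_num) (by linarith))
    refine h.congr fun n => ?_
    rw [← Real.rpow_natCast, ← Real.rpow_mul (by norm_num), interpolationWeight]
    split_ifs with hn
    · congr 1
      push_cast
      ring
    · have : n = 0 := by omega
      subst this
      simp

/-- The bilinear form with kernel `K` on the finite set `s`. -/
def bilinForm (s : Finset ℤ) (K : ℤ → ℤ → ℝ) (f g : ℤ → ℝ) : ℝ :=
  ∑ x ∈ s, ∑ y ∈ s, K x y * (f y * g x)

lemma bilinForm_eq_sum_levelPart (K : ℤ → ℤ → ℝ) (f g : ℤ → ℝ) {s J : Finset ℤ}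
    (hf : ∀ x ∈ s, Int.log 4 (f x) ∈ J) (hg : ∀ x ∈ s, Int.log 4 (g x) ∈ J) :
    bilinForm s K f g = ∑ i ∈ J, ∑ j ∈ J, bilinForm s K (levelPart f i) (levelPart g j) := by
  have h1 : bilinForm s K f g = ∑ x ∈ s, ∑ y ∈ s, ∑ i ∈ J, ∑ j ∈ J,
      K x y * (levelPart f i y * levelPart g j x) := by
    refine Finset.sum_congr rfl fun x hx => Finset.sum_congr rfl fun y hy => ?_
    simp_rw [← Finset.mul_sum]
    rw [sum_levelPart g hg hx, ← Finset.sum_mul, sum_levelPart f hf hy]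
  rw [h1]
  simp only [bilinForm]
  rw [Finset.sum_congr rfl fun x _ => Finset.sum_comm, Finset.sum_comm]
  refine Finset.sum_congr rfl fun i _ => ?_
  rw [Finset.sum_congr rfl fun x _ => Finset.sum_comm, Finset.sum_comm]

lemma sum_interpolationWeight_le {p : ℝ} (hp : 3 / 2 < p) (hp2 : p < 2) (i : ℤ) (J : Finset ℤ) :
    ∑ j ∈ J, interpolationWeight p (i + j) ≤ ∑' n, interpolationWeight p n := by
  rw [← Finset.sum_image (s := J) (g := fun j => i + j) (f := interpolationWeight p)
    (fun a _ b _ h => by simpa using h)]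
  exact (summable_interpolationWeight hp hp2).sum_le_tsum _ fun n _ => interpolationWeight_nonneg p n

/-- Interpolation between an `ℓ²` bound and a family of high-low bounds, for normalised functions. -/
lemma bilinForm_le_of_normalized {p : ℝ} (hp : 3 / 2 < p) (hp2 : p < 2) {s : Finset ℤ}
    {K : ℤ → ℤ → ℝ} {D V : ℝ} (hD : 0 ≤ D) (hV : 0 < V)
    (hA : ∀ f g : ℤ → ℝ, (∀ x, 0 ≤ f x) → (∀ x, 0 ≤ g x) → bilinForm s K f g ≤
      D * (Real.sqrt (∑ y ∈ s, f y ^ 2) * Real.sqrt (∑ x ∈ s, g x ^ 2)))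
    (hB : ∀ Q : ℕ, 1 ≤ Q → ∀ f g : ℤ → ℝ, (∀ x, 0 ≤ f x) → (∀ x, 0 ≤ g x) → bilinForm s K f g ≤
      D * (1 / Real.sqrt Q * (Real.sqrt (∑ y ∈ s, f y ^ 2) * Real.sqrt (∑ x ∈ s, g x ^ 2)) +
        (Q : ℝ) ^ (2 * p - 2) * V * ((∑ y ∈ s, f y) * ∑ x ∈ s, g x)))
    {f g : ℤ → ℝ} (hf : ∀ x, 0 ≤ f x) (hg : ∀ x, 0 ≤ g x)
    (hfV : ∑ x ∈ s, f x ^ p = 1 / V) (hgV : ∑ x ∈ s, g x ^ p = 1 / V) :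
    bilinForm s K f g ≤
      D * (((4 : ℝ) ^ (2 - p) * ∑' n, interpolationWeight p n) + 1) * (1 / V) := by
  set J : Finset ℤ := s.image (fun x => Int.log 4 (f x)) ∪ s.image (fun x => Int.log 4 (g x)) with hJ
  have hJf : ∀ x ∈ s, Int.log 4 (f x) ∈ J := fun x hx =>
    Finset.mem_union_left _ (Finset.mem_image_of_mem _ hx)
  have hJg : ∀ x ∈ s, Int.log 4 (g x) ∈ J := fun x hx =>
    Finset.mem_union_right _ (Finset.mem_image_of_mem _ hx)
  set a : ℤ → ℝ := fun i => ∑ x ∈ s, levelPart f i x ^ p with ha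
  set b : ℤ → ℝ := fun i => ∑ x ∈ s, levelPart g i x ^ p with hb
  have ha0 : ∀ i, 0 ≤ a i := fun i => Finset.sum_nonneg fun x _ =>
    Real.rpow_nonneg (levelPart_nonneg hf i x) _
  have hb0 : ∀ i, 0 ≤ b i := fun i => Finset.sum_nonneg fun x _ =>
    Real.rpow_nonneg (levelPart_nonneg hg i x) _
  have haS : ∑ i ∈ J, a i = 1 / V := by
    rw [← hfV]; exact sum_sum_levelPart_rpow f (by linarith) hJf
  have hbS : ∑ i ∈ J, b i = 1 / V := by
    rw [← hgV]; exact sum_sum_levelPart_rpow g (by linarith) hJg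
  -- The factor `4^(2-p)` comes from the upper ends `4^(i+1)`, `4^(j+1)`. Replacing the geometric
  -- mean of `a i` and `b j` by their arithmetic mean lets the double sum be done one index at a
  -- time.
  have h2 : ∀ i j : ℤ, Real.sqrt (∑ y ∈ s, levelPart f i y ^ 2) *
      Real.sqrt (∑ x ∈ s, levelPart g j x ^ 2) ≤
      (4 : ℝ) ^ (2 - p) * (4 : ℝ) ^ (((i + j : ℤ) : ℝ) * (1 - p / 2)) * ((a i + b j) / 2) := by
    intro i j
    rw [← Real.sqrt_mul (Finset.sum_nonneg fun _ _ => sq_nonneg _)]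
    refine Real.sqrt_le_iff.2 ⟨?_, ?_⟩
    · have := ha0 i
      have := hb0 j
      positivity
    · calc _ ≤ ((4 : ℝ) ^ (((i : ℝ) + 1) * (2 - p)) * a i) *
            ((4 : ℝ) ^ (((j : ℝ) + 1) * (2 - p)) * b j) :=
          mul_le_mul (sum_levelPart_sq_le hf (by linarith) hp2.le s i)
            (sum_levelPart_sq_le hg (by linarith) hp2.le s j)
            (Finset.sum_nonneg fun _ _ => sq_nonneg _) (by have := ha0 i; positivity)
        _ = ((4 : ℝ) ^ (2 - p) * (4 : ℝ) ^ (((i + j : ℤ) : ℝ) * (1 - p / 2))) ^ 2 * (a i * b j) := by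
          rw [← Real.rpow_add (by norm_num), ← Real.rpow_natCast, ← Real.rpow_mul (by norm_num),
            mul_mul_mul_comm, ← Real.rpow_add (by norm_num)]
          congr 2
          push_cast
          ring
        _ ≤ ((4 : ℝ) ^ (2 - p) * (4 : ℝ) ^ (((i + j : ℤ) : ℝ) * (1 - p / 2))) ^ 2 *
            ((a i + b j) / 2) ^ 2 := by
          gcongr
          nlinarith [sq_nonneg (a i - b j)]
        _ = _ := by ring
  have h1 : ∀ i j : ℤ, (∑ y ∈ s, levelPart f i y) * ∑ x ∈ s, levelPart g j x ≤
      (4 : ℝ) ^ (((i + j : ℤ) : ℝ) * (1 - p)) * (a i * b j) := by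
    intro i j
    calc _ ≤ ((4 : ℝ) ^ ((i : ℝ) * (1 - p)) * a i) * ((4 : ℝ) ^ ((j : ℝ) * (1 - p)) * b j) :=
          mul_le_mul (sum_levelPart_le hf (by linarith) s i) (sum_levelPart_le hg (by linarith) s j)
            (Finset.sum_nonneg fun x _ => levelPart_nonneg hg j x) (by have := ha0 i; positivity)
      _ = _ := by
          rw [mul_mul_mul_comm, ← Real.rpow_add (by norm_num)]
          congr 2
          push_cast
          ring
  have key : ∀ i j : ℤ, bilinForm s K (levelPart f i) (levelPart g j) ≤
      D * ((4 : ℝ) ^ (2 - p) * (interpolationWeight p (i + j) * ((a i + b j) / 2)) +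
        V * (a i * b j)) := by
    intro i j
    have hab : 0 ≤ V * (a i * b j) := mul_nonneg hV.le (mul_nonneg (ha0 i) (hb0 j))
    -- For small products of levels the `ℓ²` bound alone decays.
    by_cases hn : i + j < 0
    · refine (hA _ _ (levelPart_nonneg hf i) (levelPart_nonneg hg j)).trans ?_
      refine mul_le_mul_of_nonneg_left ?_ hD
      rw [interpolationWeight, if_pos hn]
      linarith [h2 i j]
    · push Not at hn
      obtain ⟨n, hn'⟩ := Int.eq_ofNat_of_zero_le hn
      have hnR : ((i + j : ℤ) : ℝ) = (n : ℝ) := by rw [hn']; simp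
      -- `Q = 4^(n/2)` balances the low term: `Q^(2p-2)` cancels `4^(n(1-p))` exactly, while
      -- `Q^(-1/2) = 4^(-n/4)` turns the `ℓ²` growth into `4^(n(3/4 - p/2))`. Levels to base `4`
      -- make this `Q` an integer.
      refine (hB (2 ^ n) (Nat.one_le_two_pow) _ _ (levelPart_nonneg hf i)
        (levelPart_nonneg hg j)).trans ?_
      refine mul_le_mul_of_nonneg_left ?_ hD
      have e0 : ((2 ^ n : ℕ) : ℝ) = (4 : ℝ) ^ ((n : ℝ) * (1 / 2)) := by
        have : (4 : ℝ) = 2 ^ (2 : ℝ) := by norm_num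
        rw [this, ← Real.rpow_mul (by norm_num), show (2 : ℝ) * ((n : ℝ) * (1 / 2)) = n by ring,
          Real.rpow_natCast]
        push_cast
        rfl
      have e1 : 1 / Real.sqrt ((2 ^ n : ℕ) : ℝ) = (4 : ℝ) ^ ((n : ℝ) * (-(1 / 4))) := by
        rw [e0, Real.sqrt_eq_rpow, ← Real.rpow_mul (by norm_num), one_div,
          ← Real.rpow_neg (by norm_num)]
        congr 1
        ring
      have e2 : ((2 ^ n : ℕ) : ℝ) ^ (2 * p - 2) = (4 : ℝ) ^ ((n : ℝ) * (p - 1)) := by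
        rw [e0, ← Real.rpow_mul (by norm_num)]
        congr 1
        ring
      rw [e1, e2, interpolationWeight, if_neg (not_lt.2 hn)]
      have h2' := h2 i j
      have h1' := h1 i j
      rw [hnR] at h2' h1' ⊢
      refine add_le_add ?_ ?_
      · calc _ ≤ (4 : ℝ) ^ ((n : ℝ) * (-(1 / 4))) * ((4 : ℝ) ^ (2 - p) *
              (4 : ℝ) ^ ((n : ℝ) * (1 - p / 2)) * ((a i + b j) / 2)) := by gcongr
          _ = (4 : ℝ) ^ (2 - p) * (((4 : ℝ) ^ ((n : ℝ) * (-(1 / 4))) *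
              (4 : ℝ) ^ ((n : ℝ) * (1 - p / 2))) * ((a i + b j) / 2)) := by ring
          _ = _ := by
              rw [← Real.rpow_add (by norm_num)]
              congr 4
              ring
      · calc _ ≤ (4 : ℝ) ^ ((n : ℝ) * (p - 1)) * V * ((4 : ℝ) ^ ((n : ℝ) * (1 - p)) *
              (a i * b j)) := by gcongr
          _ = ((4 : ℝ) ^ ((n : ℝ) * (p - 1)) * (4 : ℝ) ^ ((n : ℝ) * (1 - p))) *
              (V * (a i * b j)) := by ring
          _ = _ := by
              rw [← Real.rpow_add (by norm_num),
                show (n : ℝ) * (p - 1) + (n : ℝ) * (1 - p) = 0 by ring, Real.rpow_zero, one_mul]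
  set U := ∑' n, interpolationWeight p n with hU
  have hsumA : ∑ i ∈ J, ∑ j ∈ J, interpolationWeight p (i + j) * a i ≤ U * (1 / V) := by
    rw [← haS, Finset.mul_sum]
    refine Finset.sum_le_sum fun i _ => ?_
    rw [← Finset.sum_mul]
    exact mul_le_mul_of_nonneg_right (sum_interpolationWeight_le hp hp2 i J) (ha0 i)
  have hsumB : ∑ i ∈ J, ∑ j ∈ J, interpolationWeight p (i + j) * b j ≤ U * (1 / V) := by
    rw [← hbS, Finset.mul_sum, Finset.sum_comm]
    refine Finset.sum_le_sum fun j _ => ?_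
    rw [← Finset.sum_mul]
    refine mul_le_mul_of_nonneg_right ?_ (hb0 j)
    simp_rw [add_comm _ j]
    exact sum_interpolationWeight_le hp hp2 j J
  have hsumV : ∑ i ∈ J, ∑ j ∈ J, a i * b j = 1 / V * (1 / V) := by
    rw [← Finset.sum_mul_sum, haS, hbS]
  rw [bilinForm_eq_sum_levelPart K f g hJf hJg]
  calc _ ≤ ∑ i ∈ J, ∑ j ∈ J, D * ((4 : ℝ) ^ (2 - p) * (interpolationWeight p (i + j) *
        ((a i + b j) / 2)) + V * (a i * b j)) :=
        Finset.sum_le_sum fun i _ => Finset.sum_le_sum fun j _ => key i j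
    _ = D * ((4 : ℝ) ^ (2 - p) * ((∑ i ∈ J, ∑ j ∈ J, interpolationWeight p (i + j) * a i +
          ∑ i ∈ J, ∑ j ∈ J, interpolationWeight p (i + j) * b j) / 2) +
          V * ∑ i ∈ J, ∑ j ∈ J, a i * b j) := by
        simp only [Finset.mul_sum, ← Finset.sum_add_distrib, Finset.sum_div]
        refine Finset.sum_congr rfl fun i _ => Finset.sum_congr rfl fun j _ => ?_
        ring
    _ ≤ D * ((4 : ℝ) ^ (2 - p) * ((U * (1 / V) + U * (1 / V)) / 2) + V * (1 / V * (1 / V))) := by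
        rw [hsumV]
        gcongr
    _ = _ := by
        field_simp
        ring

/-- Interpolation between an `ℓ²` bound and a family of high-low bounds. -/
lemma exists_bilinForm_interpolation {p : ℝ} (hp : 3 / 2 < p) (hp2 : p < 2) : ∃ C : ℝ, 0 < C ∧
    ∀ (s : Finset ℤ) (K : ℤ → ℤ → ℝ) (D V : ℝ), 0 ≤ D → 0 < V →
    (∀ f g : ℤ → ℝ, (∀ x, 0 ≤ f x) → (∀ x, 0 ≤ g x) → bilinForm s K f g ≤
      D * (Real.sqrt (∑ y ∈ s, f y ^ 2) * Real.sqrt (∑ x ∈ s, g x ^ 2))) →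
    (∀ Q : ℕ, 1 ≤ Q → ∀ f g : ℤ → ℝ, (∀ x, 0 ≤ f x) → (∀ x, 0 ≤ g x) → bilinForm s K f g ≤
      D * (1 / Real.sqrt Q * (Real.sqrt (∑ y ∈ s, f y ^ 2) * Real.sqrt (∑ x ∈ s, g x ^ 2)) +
        (Q : ℝ) ^ (2 * p - 2) * V * ((∑ y ∈ s, f y) * ∑ x ∈ s, g x))) →
    ∀ f g : ℤ → ℝ, (∀ x, 0 ≤ f x) → (∀ x, 0 ≤ g x) → bilinForm s K f g ≤
      C * D * V ^ (2 / p - 1) *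
        ((∑ x ∈ s, f x ^ p) ^ (1 / p) * (∑ x ∈ s, g x ^ p) ^ (1 / p)) := by
  have hU : 0 ≤ ∑' n, interpolationWeight p n := tsum_nonneg (interpolationWeight_nonneg p)
  refine ⟨((4 : ℝ) ^ (2 - p) * ∑' n, interpolationWeight p n) + 1, by positivity, ?_⟩
  intro s K D V hD hV hA hB f g hf hg
  set C := ((4 : ℝ) ^ (2 - p) * ∑' n, interpolationWeight p n) + 1 with hC
  have hp0 : 0 < p := by linarith
  have hS0 : ∀ u : ℤ → ℝ, (∀ x, 0 ≤ u x) → 0 ≤ ∑ x ∈ s, u x ^ p := fun u hu =>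
    Finset.sum_nonneg fun x _ => Real.rpow_nonneg (hu x) _
  have hzero : ∀ u : ℤ → ℝ, (∀ x, 0 ≤ u x) → ∑ x ∈ s, u x ^ p = 0 → ∀ x ∈ s, u x = 0 := by
    intro u hu h x hx
    have := (Finset.sum_eq_zero_iff_of_nonneg fun x _ => Real.rpow_nonneg (hu x) p).1 h x hx
    exact (Real.rpow_eq_zero (hu x) hp0.ne').1 this
  set F := ∑ x ∈ s, f x ^ p with hF
  set G := ∑ x ∈ s, g x ^ p with hG
  have hRHS : 0 ≤ C * D * V ^ (2 / p - 1) * (F ^ (1 / p) * G ^ (1 / p)) := by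
    have := hS0 f hf
    have := hS0 g hg
    positivity
  rcases (hS0 f hf).eq_or_lt with hF0 | hF0
  · have hz := hzero f hf hF0.symm
    refine le_trans (le_of_eq ?_) hRHS
    exact Finset.sum_eq_zero fun x _ => Finset.sum_eq_zero fun y hy => by rw [hz y hy]; ring
  rcases (hS0 g hg).eq_or_lt with hG0 | hG0
  · have hz := hzero g hg hG0.symm
    refine le_trans (le_of_eq ?_) hRHS
    exact Finset.sum_eq_zero fun x hx => Finset.sum_eq_zero fun y _ => by rw [hz x hx]; ring
  change 0 < F at hF0
  change 0 < G at hG0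
  have hnorm : ∀ u : ℤ → ℝ, (∀ x, 0 ≤ u x) → 0 < ∑ x ∈ s, u x ^ p →
      ∑ x ∈ s, ((1 / (V * ∑ x ∈ s, u x ^ p)) ^ (1 / p) * u x) ^ p = 1 / V := by
    intro u hu hu0
    have h1 : ∀ x ∈ s, ((1 / (V * ∑ x ∈ s, u x ^ p)) ^ (1 / p) * u x) ^ p =
        (1 / (V * ∑ x ∈ s, u x ^ p)) * u x ^ p := by
      intro x _
      rw [Real.mul_rpow (by positivity) (hu x), ← Real.rpow_mul (by positivity),
        one_div_mul_cancel hp0.ne', Real.rpow_one]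
    rw [Finset.sum_congr rfl h1, ← Finset.mul_sum]
    field_simp
  -- Scaling factors which make both `p`-th power sums equal to `1/V`.
  set l := (1 / (V * F)) ^ (1 / p) with hl
  set m := (1 / (V * G)) ^ (1 / p) with hm
  have hl0 : 0 < l := by positivity
  have hm0 : 0 < m := by positivity
  have h := bilinForm_le_of_normalized hp hp2 hD hV hA hB (f := fun x => l * f x)
    (g := fun x => m * g x) (fun x => mul_nonneg hl0.le (hf x)) (fun x => mul_nonneg hm0.le (hg x))
    (hnorm f hf hF0) (hnorm g hg hG0)
  have hscale : bilinForm s K (fun x => l * f x) (fun x => m * g x) =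
      l * m * bilinForm s K f g := by
    simp only [bilinForm, Finset.mul_sum]
    refine Finset.sum_congr rfl fun x _ => Finset.sum_congr rfl fun y _ => ?_
    ring
  rw [hscale] at h
  have hlm : 1 / (l * m) * (1 / V) = V ^ (2 / p - 1) * (F ^ (1 / p) * G ^ (1 / p)) := by
    rw [hl, hm, one_div (V * F), one_div (V * G), Real.inv_rpow (by positivity),
      Real.inv_rpow (by positivity), Real.mul_rpow hV.le hF0.le, Real.mul_rpow hV.le hG0.le,
      Real.rpow_sub hV, Real.rpow_one, show 2 / p = 1 / p + 1 / p by ring, Real.rpow_add hV]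
    field_simp
  calc bilinForm s K f g = 1 / (l * m) * (l * m * bilinForm s K f g) := by field_simp
    _ ≤ 1 / (l * m) * (D * C * (1 / V)) := by gcongr
    _ = C * D * (1 / (l * m) * (1 / V)) := by ring
    _ = _ := by rw [hlm]; ring

/-! ### The improving inequality -/

/-- The `ℓ^p` improving bound for the dyadic squares, in bilinear form. -/
lemma exists_bilinForm_dyadicSquareKernel_le {p : ℝ} (hp : 3 / 2 < p) (hp2 : p < 2) :
    ∃ C : ℝ, 0 < C ∧ ∀ N : ℕ, 1 ≤ N → ∀ (s : Finset ℤ) (f g : ℤ → ℝ), (∀ x, 0 ≤ f x) →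
      (∀ x, 0 ≤ g x) → bilinForm s (fun x y => dyadicSquareKernel N (y - x)) f g ≤
        C * (N : ℝ) ^ (3 - 4 / p) *
          ((∑ x ∈ s, f x ^ p) ^ (1 / p) * (∑ x ∈ s, g x ^ p) ^ (1 / p)) := by
  -- The loss `ε = 2p - 3`, positive because `p > 3/2`, makes `1 + ε = 2p - 2`, the exponent
  -- required by the interpolation.
  obtain ⟨C₁, hC₁, h₁⟩ := exists_dyadicSquareKernel_high_low (ε := 2 * p - 3) (by linarith)
  obtain ⟨C₂, hC₂, h₂⟩ := exists_bilinForm_interpolation hp hp2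
  refine ⟨C₂ * (C₁ + 1), by positivity, fun N hN s f g hf hg => ?_⟩
  have hNR : (0 : ℝ) < N := by exact_mod_cast hN
  -- With `D` of order `N` and `V = N⁻²`, the factor `D V^(2/p - 1)` is of order `N^(3 - 4/p)`; `C₁
  -- + 1` dominates the constants of both hypotheses.
  have h := h₂ s (fun x y => dyadicSquareKernel N (y - x)) ((C₁ + 1) * N) (1 / (N : ℝ) ^ 2)
    (by positivity) (by positivity) ?_ ?_ f g hf hg
  · refine h.trans (le_of_eq ?_)
    have hpow : (N : ℝ) * (1 / (N : ℝ) ^ 2) ^ (2 / p - 1) = (N : ℝ) ^ (3 - 4 / p) := by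
      rw [one_div, ← Real.rpow_natCast, ← Real.rpow_neg hNR.le, ← Real.rpow_mul hNR.le]
      nth_rewrite 1 [← Real.rpow_one (N : ℝ)]
      rw [← Real.rpow_add hNR]
      congr 1
      push_cast
      ring
    rw [← hpow]
    ring
  · intro f g hf hg
    refine (sum_dyadicSquareKernel_le N s f g).trans ?_
    refine mul_le_mul_of_nonneg_right ?_ (by positivity)
    nlinarith
  · intro Q hQ f g hf hg
    refine (h₁ N Q hN hQ s f g hf hg).trans ?_
    rw [show 1 + (2 * p - 3) = 2 * p - 2 by ring]
    have hf' : 0 ≤ ∑ y ∈ s, f y := Finset.sum_nonneg fun y _ => hf y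
    have hg' : 0 ≤ ∑ y ∈ s, g y := Finset.sum_nonneg fun y _ => hg y
    calc _ = C₁ * N * (1 / Real.sqrt Q * (Real.sqrt (∑ y ∈ s, f y ^ 2) *
          Real.sqrt (∑ x ∈ s, g x ^ 2)) + (Q : ℝ) ^ (2 * p - 2) * (1 / (N : ℝ) ^ 2) *
          ((∑ y ∈ s, f y) * ∑ x ∈ s, g x)) := by field_simp
      _ ≤ _ := by
          gcongr
          linarith

/-- The indicator function of the squares `k²` with `1 ≤ k ≤ N`. -/
noncomputable def squareKernel (N : ℕ) (n : ℤ) : ℝ :=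
  ∑ k ∈ Finset.Icc 1 N, if n = (k : ℤ) ^ 2 then 1 else 0

lemma squareKernel_eq_add (N : ℕ) (n : ℤ) :
    squareKernel N n = squareKernel (N / 2) n + dyadicSquareKernel N n := by
  have h : ∀ M : ℕ, Finset.Icc 1 M = Finset.Ioc 0 M := fun M => by
    ext k; simp only [Finset.mem_Icc, Finset.mem_Ioc]; omega
  rw [squareKernel, squareKernel, dyadicSquareKernel, h, h]
  exact (Finset.sum_Ioc_consecutive _ (Nat.zero_le _) (Nat.div_le_self N 2)).symm

lemma bilinForm_squareKernel_le (N : ℕ) (s : Finset ℤ) (f g : ℤ → ℝ) :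
    bilinForm s (fun x y => squareKernel N (y - x)) f g ≤
      N * (Real.sqrt (∑ y ∈ s, f y ^ 2) * Real.sqrt (∑ x ∈ s, g x ^ 2)) := by
  have h1 : bilinForm s (fun x y => squareKernel N (y - x)) f g =
      ∑ k ∈ Finset.Icc 1 N, ∑ x ∈ s, ∑ y ∈ s,
        (if y - x = (k : ℤ) ^ 2 then 1 else 0) * (f y * g x) := by
    simp_rw [bilinForm, squareKernel, Finset.sum_mul]
    rw [Finset.sum_congr rfl fun x _ => Finset.sum_comm, Finset.sum_comm]
  rw [h1]
  refine (Finset.sum_le_sum fun k _ => sum_shift_le_sqrt_mul_sqrt s f g _).trans (le_of_eq ?_)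
  rw [Finset.sum_const, nsmul_eq_mul, Nat.card_Icc, Nat.add_sub_cancel]

/-- The `ℓ^p` improving bound for the squares, in bilinear form. -/
lemma exists_bilinForm_squareKernel_le {p : ℝ} (hp : 3 / 2 < p) (hp2 : p ≤ 2) :
    ∃ C : ℝ, 0 < C ∧ ∀ (N : ℕ) (s : Finset ℤ) (f g : ℤ → ℝ), (∀ x, 0 ≤ f x) →
      (∀ x, 0 ≤ g x) → bilinForm s (fun x y => squareKernel N (y - x)) f g ≤
        C * (N : ℝ) ^ (3 - 4 / p) *
          ((∑ x ∈ s, f x ^ p) ^ (1 / p) * (∑ x ∈ s, g x ^ p) ^ (1 / p)) := by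
  rcases hp2.eq_or_lt with rfl | hp2
  · refine ⟨1, one_pos, fun N s f g _ _ => (bilinForm_squareKernel_le N s f g).trans (le_of_eq ?_)⟩
    simp only [Real.rpow_two, Real.sqrt_eq_rpow]
    norm_num
  · obtain ⟨C, hC, h⟩ := exists_bilinForm_dyadicSquareKernel_le hp hp2
    have hp0 : 0 < p := by linarith
    set e : ℝ := 3 - 4 / p with he
    have he0 : 0 < e := by
      rw [he, sub_pos, div_lt_iff₀ hp0]
      linarith
    have hr : (2 : ℝ) ^ (-e) < 1 := Real.rpow_lt_one_of_one_lt_of_neg (by norm_num) (by linarith)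
    have hr' : 0 < 1 - (2 : ℝ) ^ (-e) := by linarith
    -- This constant `x` solves `2^(-e) x + C = x`, so it reproduces itself when `N` is halved.
    refine ⟨C / (1 - (2 : ℝ) ^ (-e)), by positivity, fun N s f g hf hg => ?_⟩
    set A := (∑ x ∈ s, f x ^ p) ^ (1 / p) * (∑ x ∈ s, g x ^ p) ^ (1 / p) with hA
    have hA0 : 0 ≤ A := mul_nonneg
      (Real.rpow_nonneg (Finset.sum_nonneg fun x _ => Real.rpow_nonneg (hf x) _) _)
      (Real.rpow_nonneg (Finset.sum_nonneg fun x _ => Real.rpow_nonneg (hg x) _) _)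
    induction N using Nat.strong_induction_on with
    | _ N ih =>
      rcases Nat.eq_zero_or_pos N with rfl | hN
      · have : bilinForm s (fun x y => squareKernel 0 (y - x)) f g = 0 := by
          simp [bilinForm, squareKernel]
        rw [this]
        positivity
      · have hNR : (0 : ℝ) < N := by exact_mod_cast hN
        have h1 : bilinForm s (fun x y => squareKernel N (y - x)) f g =
            bilinForm s (fun x y => squareKernel (N / 2) (y - x)) f g +
              bilinForm s (fun x y => dyadicSquareKernel N (y - x)) f g := by
          simp only [bilinForm, squareKernel_eq_add N, add_mul, Finset.sum_add_distrib]
        have h2 := ih (N / 2) (Nat.div_lt_self hN (by norm_num))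
        have h3 := h N hN s f g hf hg
        have h4 : ((N / 2 : ℕ) : ℝ) ^ e ≤ (2 : ℝ) ^ (-e) * (N : ℝ) ^ e := by
          calc ((N / 2 : ℕ) : ℝ) ^ e ≤ ((N : ℝ) / 2) ^ e := by
                gcongr
                exact Nat.cast_div_le
            _ = _ := by
                rw [Real.div_rpow hNR.le (by norm_num), Real.rpow_neg (by norm_num)]
                field_simp
        rw [h1]
        calc _ ≤ C / (1 - (2 : ℝ) ^ (-e)) * ((N / 2 : ℕ) : ℝ) ^ e * A + C * (N : ℝ) ^ e * A :=
              add_le_add h2 h3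
          _ ≤ C / (1 - (2 : ℝ) ^ (-e)) * ((2 : ℝ) ^ (-e) * (N : ℝ) ^ e) * A +
              C * (N : ℝ) ^ e * A := by gcongr
          _ = _ := by
              field_simp
              ring

lemma card_doubledInterval {a b : ℤ} {N : ℕ} (h : (Finset.Icc a b).card = N ^ 2) :
    (doubledInterval a b).card = 2 * N ^ 2 := by
  rw [Int.card_Icc] at h
  rw [doubledInterval, Int.card_Icc, ← h]
  omega

lemma sum_squareKernel_mul {s : Finset ℤ} {f : ℤ → ℝ} (hf : ∀ y, y ∉ s → f y = 0) (N : ℕ) (x : ℤ) :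
    ∑ y ∈ s, squareKernel N (y - x) * f y = ∑ k ∈ Finset.Icc 1 N, f (x + (k : ℤ) ^ 2) := by
  simp only [squareKernel, Finset.sum_mul]
  rw [Finset.sum_comm]
  refine Finset.sum_congr rfl fun k _ => ?_
  have h : ∀ y ∈ s, (if y - x = (k : ℤ) ^ 2 then 1 else 0) * f y =
      if y = x + (k : ℤ) ^ 2 then f y else 0 := by
    intro y _
    simp only [sub_eq_iff_eq_add', ite_mul, one_mul, zero_mul]
  rw [Finset.sum_congr rfl h, Finset.sum_ite_eq']
  split_ifs with hm
  · rfl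
  · exact (hf _ hm).symm

lemma norm_squareAverage_le {s : Finset ℤ} {f : ℤ → ℂ} (hf : Function.support f ⊆ (s : Set ℤ))
    (N : ℕ) (x : ℤ) :
    ‖squareAverage N f x‖ ≤ 1 / N * ∑ y ∈ s, squareKernel N (y - x) * ‖f y‖ := by
  rw [sum_squareKernel_mul (f := fun y => ‖f y‖) (fun y hy => by
    rw [norm_eq_zero]
    by_contra hne
    exact hy (hf hne))]
  rw [squareAverage, norm_mul]
  have : ‖(1 / (N : ℂ))‖ = 1 / N := by simp
  rw [this]
  gcongr
  exact norm_sum_le _ _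

/-- Duality made explicit: the bilinear bound is tested against the extremizer `|A_N f|^(p' - 1)` on
`I`. -/
theorem exists_normalizedNorm_squareAverage_le {p : ℝ} (hp : 3 / 2 < p) (hp2 : p ≤ 2) :
    ∃ C : ℝ, 0 < C ∧ ∀ N : ℕ, 1 ≤ N → ∀ a b : ℤ, (Finset.Icc a b).card = N ^ 2 →
      ∀ f : ℤ → ℂ, Function.support f ⊆ (doubledInterval a b : Set ℤ) →
        normalizedNorm (Finset.Icc a b) (p / (p - 1)) (squareAverage N f) ≤
          C * normalizedNorm (doubledInterval a b) p f := by
  obtain ⟨C, hC, h⟩ := exists_bilinForm_squareKernel_le hp hp2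
  -- The factor `2^(1/p)` compensates for `|2I| = 2N²`.
  refine ⟨C * 2 ^ (1 / p), by positivity, fun N hN a b hcard f hf => ?_⟩
  have hp0 : 0 < p := by linarith
  have hp1 : 0 < p - 1 := by linarith
  have hNR : (0 : ℝ) < N := by exact_mod_cast hN
  set r : ℝ := p / (p - 1) with hr
  have hr0 : 0 < r := by positivity
  have hr1 : r - 1 = 1 / (p - 1) := by rw [hr]; field_simp; ring
  have hrp : (r - 1) * p = r := by rw [hr1, hr]; ring
  have hrinv : 1 / r = 1 - 1 / p := by rw [hr]; field_simp
  set s := doubledInterval a b with hs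
  set I := Finset.Icc a b with hI
  have hIs : I ⊆ s := by
    intro x hx
    rw [hI, Finset.mem_Icc] at hx
    rw [hs, doubledInterval, Finset.mem_Icc]
    omega
  set A : ℤ → ℝ := fun x => ‖squareAverage N f x‖ with hA
  have hA0 : ∀ x, 0 ≤ A x := fun x => norm_nonneg _
  -- As `(r - 1)p = r`, both `∑ g^p` and `∑ A g` equal `X`; dividing by `X^(1/p)` leaves `X^(1/r)`.
  set g : ℤ → ℝ := fun x => if x ∈ I then A x ^ (r - 1) else 0 with hg
  have hg0 : ∀ x, 0 ≤ g x := fun x => by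
    simp only [hg]
    split_ifs
    exacts [Real.rpow_nonneg (hA0 x) _, le_rfl]
  set X := ∑ x ∈ I, A x ^ r with hX
  set F := ∑ x ∈ s, ‖f x‖ ^ p with hF
  have hF0 : 0 ≤ F := Finset.sum_nonneg fun x _ => Real.rpow_nonneg (norm_nonneg _) _
  have hX0 : 0 ≤ X := Finset.sum_nonneg fun x _ => Real.rpow_nonneg (hA0 x) _
  have hgX : ∑ x ∈ s, g x ^ p = X := by
    rw [← Finset.sum_subset hIs (f := fun x => g x ^ p) (fun x _ hx => by
      simp only [hg, if_neg hx]; exact Real.zero_rpow hp0.ne')]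
    refine Finset.sum_congr rfl fun x hx => ?_
    simp only [hg, if_pos hx]
    rw [← Real.rpow_mul (hA0 x), hrp]
  have hXle : X ≤ 1 / N * bilinForm s (fun x y => squareKernel N (y - x)) (fun y => ‖f y‖) g := by
    have e1 : X = ∑ x ∈ s, A x * g x := by
      rw [← Finset.sum_subset hIs (f := fun x => A x * g x) (fun x _ hx => by
        simp only [hg, if_neg hx, mul_zero])]
      refine Finset.sum_congr rfl fun x hx => ?_
      simp only [hg, if_pos hx]
      rcases (hA0 x).eq_or_lt with hz | hz
      · rw [← hz, Real.zero_rpow hr0.ne', zero_mul]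
      · nth_rewrite 2 [← Real.rpow_one (A x)]
        rw [← Real.rpow_add hz, add_sub_cancel]
    rw [e1, bilinForm, Finset.mul_sum]
    refine Finset.sum_le_sum fun x _ => ?_
    calc A x * g x ≤ (1 / N * ∑ y ∈ s, squareKernel N (y - x) * ‖f y‖) * g x :=
          mul_le_mul_of_nonneg_right (norm_squareAverage_le hf N x) (hg0 x)
      _ = _ := by
          rw [mul_assoc, Finset.sum_mul]
          congr 1
          exact Finset.sum_congr rfl fun y _ => by ring
  have hmain : X ≤ C * (N : ℝ) ^ (2 - 4 / p) * F ^ (1 / p) * X ^ (1 / p) := by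
    have h1 := h N s (fun y => ‖f y‖) g (fun y => norm_nonneg _) hg0
    rw [hgX] at h1
    calc X ≤ 1 / N * (C * (N : ℝ) ^ (3 - 4 / p) * (F ^ (1 / p) * X ^ (1 / p))) :=
          hXle.trans (mul_le_mul_of_nonneg_left h1 (by positivity))
      _ = _ := by
          rw [show 3 - 4 / p = 1 + (2 - 4 / p) by ring, Real.rpow_add hNR, Real.rpow_one]
          field_simp
  have hXr : X ^ (1 / r) ≤ C * (N : ℝ) ^ (2 - 4 / p) * F ^ (1 / p) := by
    rcases hX0.eq_or_lt with hz | hz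
    · rw [← hz, Real.zero_rpow (by positivity)]
      positivity
    · rw [hrinv, Real.rpow_sub hz, Real.rpow_one, div_le_iff₀ (Real.rpow_pos_of_pos hz _)]
      exact hmain
  rw [normalizedNorm, normalizedNorm, hcard, card_doubledInterval hcard]
  change (1 / ((N ^ 2 : ℕ) : ℝ) * X) ^ (1 / r) ≤
    C * 2 ^ (1 / p) * (1 / ((2 * N ^ 2 : ℕ) : ℝ) * F) ^ (1 / p)
  push_cast
  have e2 : (1 / (N : ℝ) ^ 2) ^ (1 / r) = (N : ℝ) ^ (-(2 - 2 / p)) := by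
    rw [hrinv, one_div, ← Real.rpow_natCast, ← Real.rpow_neg hNR.le, ← Real.rpow_mul hNR.le]
    congr 1
    push_cast
    ring
  have e3 : (1 / (2 * (N : ℝ) ^ 2)) ^ (1 / p) = (N : ℝ) ^ (-(2 / p)) / 2 ^ (1 / p) := by
    rw [mul_comm, ← div_div, Real.div_rpow (by positivity) (by norm_num), one_div ((N : ℝ) ^ 2),
      ← Real.rpow_natCast, ← Real.rpow_neg hNR.le, ← Real.rpow_mul hNR.le]
    congr 2
    push_cast
    ring
  rw [Real.mul_rpow (by positivity) hX0, Real.mul_rpow (by positivity) hF0, e2, e3]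
  calc _ ≤ (N : ℝ) ^ (-(2 - 2 / p)) * (C * (N : ℝ) ^ (2 - 4 / p) * F ^ (1 / p)) := by gcongr
    _ = C * ((N : ℝ) ^ (-(2 - 2 / p)) * (N : ℝ) ^ (2 - 4 / p)) * F ^ (1 / p) := by ring
    _ = C * (N : ℝ) ^ (-(2 / p)) * F ^ (1 / p) := by
        rw [← Real.rpow_add hNR]
        congr 3
        ring
    _ = _ := by
        have : (0 : ℝ) < 2 ^ (1 / p) := by positivity
        field_simp

/-! ### Failure below `3/2` -/

/-- The average of a point mass is `1/N` at the `N` points at square distance. -/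
lemma squareAverage_single {N k : ℕ} (hk : k ∈ Finset.Icc 1 N) (z : ℤ) :
    squareAverage N (Pi.single z 1) (z - (k : ℤ) ^ 2) = 1 / N := by
  rw [squareAverage, Finset.sum_eq_single k]
  · simp
  · intro j _ hj
    rw [Pi.single_eq_of_ne]
    intro hc
    have h1 : (j : ℤ) ^ 2 = (k : ℤ) ^ 2 := by linarith
    have h2 : j ^ 2 = k ^ 2 := by exact_mod_cast h1
    exact hj (Nat.pow_left_injective (by norm_num : 2 ≠ 0) h2)
  · intro hc; exact absurd hk hc

/-- For a point mass the left side is at least `(N⁻² · N · N^(-r))^(1/r) = N^(-2 + 1/p)`, while the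
right side is at most `|C| N^(-2/p)`. -/
theorem not_exists_normalizedNorm_squareAverage_le {p : ℝ} (hp : 1 < p) (hp2 : p < 3 / 2) :
    ¬ ∃ C : ℝ, ∀ N : ℕ, 1 ≤ N → ∀ a b : ℤ, (Finset.Icc a b).card = N ^ 2 →
      ∀ f : ℤ → ℂ, Function.support f ⊆ (doubledInterval a b : Set ℤ) →
        normalizedNorm (Finset.Icc a b) (p / (p - 1)) (squareAverage N f) ≤
          C * normalizedNorm (doubledInterval a b) p f := by
  rintro ⟨C, hC⟩
  have hp0 : 0 < p := by linarith
  have hp1 : 0 < p - 1 := by linarith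
  set r : ℝ := p / (p - 1) with hr
  have hr0 : 0 < r := by positivity
  have hrinv : 1 / r = 1 - 1 / p := by rw [hr]; field_simp
  have he : 0 < 3 / p - 2 := by
    rw [sub_pos, lt_div_iff₀ hp0]
    linarith
  have key : ∀ N : ℕ, 1 ≤ N → (N : ℝ) ^ (3 / p - 2) ≤ |C| := by
    intro N hN
    have hNR : (0 : ℝ) < N := by exact_mod_cast hN
    -- With `I = [1, N²]` this point lies in `2I`, and every `z - k²`, `1 ≤ k ≤ N`, lies in `I`.
    set z : ℤ := (N : ℤ) ^ 2 + 1 with hz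
    have hcard : (Finset.Icc (1 : ℤ) ((N : ℤ) ^ 2)).card = N ^ 2 := by
      rw [Int.card_Icc, add_sub_cancel_right]
      exact_mod_cast Int.toNat_natCast (N ^ 2)
    have hN2 : (1 : ℤ) ≤ (N : ℤ) ^ 2 := by exact_mod_cast Nat.one_le_pow 2 N hN
    have hzmem : z ∈ doubledInterval 1 ((N : ℤ) ^ 2) := by
      rw [doubledInterval, Finset.mem_Icc, hz]
      constructor <;> linarith
    have h := hC N hN 1 ((N : ℤ) ^ 2) hcard (Pi.single z 1) (by
      intro x hx
      by_cases hxz : x = z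
      · rw [hxz]; exact_mod_cast hzmem
      · exact absurd (Pi.single_eq_of_ne hxz 1) hx)
    rw [normalizedNorm, normalizedNorm, hcard, card_doubledInterval hcard] at h
    have h1 : ∑ x ∈ doubledInterval 1 ((N : ℤ) ^ 2), ‖(Pi.single z (1 : ℂ) : ℤ → ℂ) x‖ ^ p = 1 := by
      rw [Finset.sum_eq_single z]
      · simp
      · intro x _ hx
        rw [Pi.single_eq_of_ne hx, norm_zero, Real.zero_rpow hp0.ne']
      · intro hc; exact absurd hzmem hc
    have h2 : (N : ℝ) * (1 / (N : ℝ)) ^ r ≤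
        ∑ x ∈ Finset.Icc (1 : ℤ) ((N : ℤ) ^ 2), ‖squareAverage N (Pi.single z 1) x‖ ^ r := by
      calc (N : ℝ) * (1 / (N : ℝ)) ^ r = ∑ k ∈ Finset.Icc 1 N,
            ‖squareAverage N (Pi.single z 1) (z - (k : ℤ) ^ 2)‖ ^ r := by
            rw [Finset.sum_congr rfl fun k hk => by rw [squareAverage_single hk]]
            simp
        _ = ∑ x ∈ (Finset.Icc 1 N).image (fun k : ℕ => z - (k : ℤ) ^ 2),
            ‖squareAverage N (Pi.single z 1) x‖ ^ r := by
            rw [Finset.sum_image]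
            intro j _ k _ hjk
            have h3 : (j : ℤ) ^ 2 = (k : ℤ) ^ 2 := by
              simp only at hjk
              linarith
            have h4 : j ^ 2 = k ^ 2 := by exact_mod_cast h3
            exact Nat.pow_left_injective (by norm_num : 2 ≠ 0) h4
        _ ≤ _ := by
            refine Finset.sum_le_sum_of_subset_of_nonneg (fun x hx => ?_)
              fun _ _ _ => Real.rpow_nonneg (norm_nonneg _) _
            obtain ⟨k, hk, rfl⟩ := Finset.mem_image.1 hx
            rw [Finset.mem_Icc] at hk ⊢
            have h5 : (1 : ℤ) ≤ (k : ℤ) ^ 2 := by exact_mod_cast Nat.one_le_pow 2 k hk.1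
            have h6 : (k : ℤ) ^ 2 ≤ (N : ℤ) ^ 2 := by exact_mod_cast Nat.pow_le_pow_left hk.2 2
            rw [hz]
            constructor <;> linarith
    rw [h1] at h
    have h7 : (N : ℝ) ^ (-2 + 1 / p) ≤ |C| * (N : ℝ) ^ (-(2 / p)) := by
      calc (N : ℝ) ^ (-2 + 1 / p) = (1 / ((N : ℝ) ^ 2) * (N * (1 / (N : ℝ)) ^ r)) ^ (1 / r) := by
            have e1 : 1 / ((N : ℝ) ^ 2) * (N * (1 / (N : ℝ)) ^ r) = (N : ℝ) ^ (-1 - r) := by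
              rw [one_div (N : ℝ), Real.inv_rpow hNR.le, Real.rpow_sub hNR, Real.rpow_neg_one]
              field_simp
            rw [e1, ← Real.rpow_mul hNR.le]
            congr 1
            have : r * (1 / r) = 1 := mul_one_div_cancel hr0.ne'
            calc -2 + 1 / p = -(1 - 1 / p) - 1 := by ring
              _ = -(1 / r) - r * (1 / r) := by rw [this, hrinv]
              _ = _ := by ring
        _ ≤ (1 / ((N ^ 2 : ℕ) : ℝ) * ∑ x ∈ Finset.Icc (1 : ℤ) ((N : ℤ) ^ 2),
              ‖squareAverage N (Pi.single z 1) x‖ ^ r) ^ (1 / r) := by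
            push_cast
            gcongr
        _ ≤ C * (1 / ((2 * N ^ 2 : ℕ) : ℝ) * 1) ^ (1 / p) := h
        _ ≤ |C| * (1 / (N : ℝ) ^ 2) ^ (1 / p) := by
            push_cast
            rw [mul_one]
            gcongr
            · exact le_abs_self C
            · nlinarith [sq_nonneg (N : ℝ)]
        _ = _ := by
            rw [one_div ((N : ℝ) ^ 2), ← Real.rpow_natCast, ← Real.rpow_neg hNR.le,
              ← Real.rpow_mul hNR.le]
            congr 2
            push_cast
            ring
    calc (N : ℝ) ^ (3 / p - 2) = (N : ℝ) ^ (-2 + 1 / p) * (N : ℝ) ^ (2 / p) := by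
          rw [← Real.rpow_add hNR]
          congr 1
          ring
      _ ≤ |C| * (N : ℝ) ^ (-(2 / p)) * (N : ℝ) ^ (2 / p) := by gcongr
      _ = |C| := by
          rw [mul_assoc, ← Real.rpow_add hNR, neg_add_cancel, Real.rpow_zero, mul_one]
  have htend := (tendsto_rpow_atTop he).comp tendsto_natCast_atTop_atTop
  obtain ⟨N, hN1, hN2⟩ := ((htend.eventually_gt_atTop |C|).and
    (Filter.eventually_ge_atTop 1)).exists
  exact absurd (key N hN2) (not_le.2 hN1)

theorem theorem1p1 :
    (∀ p : ℝ, 3 / 2 < p → p ≤ 2 →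
      ∃ C : ℝ, 0 < C ∧ ∀ N : ℕ, 1 ≤ N → ∀ a b : ℤ, (Finset.Icc a b).card = N ^ 2 →
        ∀ f : ℤ → ℂ, Function.support f ⊆ (doubledInterval a b : Set ℤ) →
          normalizedNorm (Finset.Icc a b) (p / (p - 1)) (squareAverage N f) ≤
            C * normalizedNorm (doubledInterval a b) p f) ∧
    (∀ p : ℝ, 1 < p → p < 3 / 2 →
      ¬ ∃ C : ℝ, ∀ N : ℕ, 1 ≤ N → ∀ a b : ℤ, (Finset.Icc a b).card = N ^ 2 →
        ∀ f : ℤ → ℂ, Function.support f ⊆ (doubledInterval a b : Set ℤ) →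
          normalizedNorm (Finset.Icc a b) (p / (p - 1)) (squareAverage N f) ≤
            C * normalizedNorm (doubledInterval a b) p f) :=
  ⟨fun _ hp hp2 => exists_normalizedNorm_squareAverage_le hp hp2,
    fun _ hp hp2 => not_exists_normalizedNorm_squareAverage_le hp hp2⟩
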